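/- Let $X$ be the standard 2-complex of a finite presentation $\langle B\mid S\rangle$ of a group $J$, let $\alpha\in B$ be a generator that has infinite order in $J$, and let $c$ be the loop in $X$ that parametrizes the edge labelled $\alpha$. Let $\mathcal P\equiv\langle a_1,\dots,a_n\mid r_1,\dots,r_m\rangle$ be a finite presentation of a group $G$. Let $\mathcal J(\mathcal P)$ be the 2-complex obtained from the rose with edges $a_1,\dots,a_n$ (the 1-skeleton of the standard 2-complex of $\mathcal P$) by adding, for each $i=1,\dots,m$, a copy $X_i$ of $X$ and an annulus $\mathbb S^1\times[0,1]$ one end of which is glued along the edge loop labelled $r_i$ in the rose and the other along the loop $c$ in $X_i$. Let $\mathcal J_G=\pi_1\mathcal J(\mathcal P)$, based at the vertex of the rose. For $b\in B$ write $b_i\in\mathcal J_G$ for the class of the loop that runs along $\{1\}\times[0,1]$ in the $i$-th annulus to the vertex of $X_i$, then around the edge $b$ of $X_i$, and back. There is a unique homomorphism $\mathcal J_G\to G$, the canonical map, that sends the class of the loop $a_j$ to $a_j$ for every $j$ and whose kernel is the normal closure of $\{b_i : b\in B,\ 1\le i\le m\}$. Moreover: 1. If $J$ is perfect, then $H_1(\mathcal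 J_G,\mathbb Z)\cong H_1(G,\mathbb Z)$. 2. If $X$ is aspherical and none of the words $r_1,\dots,r_m$ represents the identity of the free group on $a_1,\dots,a_n$, then $\mathcal J(\mathcal P)$ is aspherical. 3. If the profinite completion $\widehat J$ is trivial, then the canonical map $\mathcal J_G\to G$ induces an isomorphism of profinite completions $\widehat{\mathcal J}_G\to\widehat G$. Here a space is aspherical if it is path connected and its homotopy groups in degrees at least 2 vanish. -/

import Mathlib

open CategoryTheory Topology

noncomputable section

namespace JConstruction

/-! ### Finite presentations -/

/-- The group presented by generators `A` and the family of relators `r`, each relator being a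
word in the letters `a` (written `(a, true)`) and `a⁻¹` (written `(a, false)`). -/
abbrev Grp {A R : Type} (r : R → List (A × Bool)) : Type :=
  PresentedGroup (Set.range fun i => FreeGroup.mk (r i))

/-! ### The rose on a set `A` -/

/-- The two ends of every edge are identified with the vertex. -/
inductive RoseRel (A : Type) : Unit ⊕ (Σ _ : A, unitInterval) → Unit ⊕ (Σ _ : A, unitInterval) → Prop
  | start (a : A) : RoseRel A (Sum.inr ⟨a, 0⟩) (Sum.inl ())
  | finish (a : A) : RoseRel A (Sum.inr ⟨a, 1⟩) (Sum.inl ())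

/-- The rose: the graph with one vertex and one oriented edge for every `a : A`. -/
def Rose (A : Type) : Type := Quot (RoseRel A)

instance (A : Type) : TopologicalSpace (Rose A) :=
  inferInstanceAs (TopologicalSpace (Quot (RoseRel A)))

/-- The vertex of the rose. -/
def Rose.vertex (A : Type) : Rose A := Quot.mk _ (Sum.inl ())

/-- The edge of the rose labelled `a`, as a loop. -/
def Rose.edge {A : Type} (a : A) : Path (Rose.vertex A) (Rose.vertex A) where
  toFun t := Quot.mk _ (Sum.inr ⟨a, t⟩)
  continuous_toFun :=
    continuous_quot_mk.comp (continuous_inr.comp continuous_sigmaMk)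
  source' := Quot.sound (RoseRel.start a)
  target' := Quot.sound (RoseRel.finish a)

/-- The edge loop of a letter: an inverse letter traverses the edge backwards. -/
def Rose.letter {A : Type} : A × Bool → Path (Rose.vertex A) (Rose.vertex A)
  | (a, true) => Rose.edge a
  | (a, false) => (Rose.edge a).symm

/-- The edge loop in the rose that reads a word, from left to right. -/
def Rose.loop {A : Type} : List (A × Bool) → Path (Rose.vertex A) (Rose.vertex A)
  | [] => Path.refl _
  | [x] => Rose.letter x
  | x :: y :: w => (Rose.letter x).trans (Rose.loop (y :: w))

/-! ### The standard 2-complex of a presentation -/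

/-- The closed unit disc. -/
abbrev Disc : Type := Metric.closedBall (0 : ℂ) 1

/-- The boundary point `exp (2πit)` of the disc. -/
def Disc.boundary (t : unitInterval) : Disc :=
  ⟨Circle.exp (2 * Real.pi * t), by
    rw [mem_closedBall_zero_iff, Circle.norm_coe]⟩

/-- The boundary of the disc with index `i` is attached along the edge loop of the relator `r i`. -/
inductive StdRel {A R : Type} (r : R → List (A × Bool)) :
    Rose A ⊕ (Σ _ : R, Disc) → Rose A ⊕ (Σ _ : R, Disc) → Prop
  | attach (i : R) (t : unitInterval) :
      StdRel r (Sum.inr ⟨i, Disc.boundary t⟩) (Sum.inl (Rose.loop (r i) t))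

/-- The standard 2-complex of a presentation: the rose on the generators, with one disc attached
for every relator. -/
def StdComplex {A R : Type} (r : R → List (A × Bool)) : Type := Quot (StdRel r)

instance {A R : Type} (r : R → List (A × Bool)) : TopologicalSpace (StdComplex r) :=
  inferInstanceAs (TopologicalSpace (Quot (StdRel r)))

/-- The inclusion of the 1-skeleton. -/
def StdComplex.ofRose {A R : Type} (r : R → List (A × Bool)) : C(Rose A, StdComplex r) where
  toFun x := Quot.mk _ (Sum.inl x)
  continuous_toFun := continuous_quot_mk.comp continuous_inl

/-- The vertex of the standard 2-complex. -/
def StdComplex.vertex {A R : Type} (r : R → List (A × Bool)) : StdComplex r :=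
  StdComplex.ofRose r (Rose.vertex A)

/-- The edge labelled `a`, as a loop in the standard 2-complex. -/
def StdComplex.edge {A R : Type} (r : R → List (A × Bool)) (a : A) :
    Path (StdComplex.vertex r) (StdComplex.vertex r) :=
  (Rose.edge a).map (StdComplex.ofRose r).continuous

/-! ### The complex `𝒥(𝒫)`

Here `r` is the family of relators of `𝒫` and `s` that of the presentation of `J`, whose standard
2-complex is `X = StdComplex s`; the loop `c` is the edge `α` of `X`. -/

/-- The pieces: the rose on the generators of `𝒫`, and a copy of `X` and an annulus for every
relator of `𝒫`. -/
abbrev JPieces {A R B S : Type} (_ : R → List (A × Bool)) (s : S → List (B × Bool)) : Type :=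
  Rose A ⊕ (Σ _ : R, StdComplex s) ⊕ (Σ _ : R, Circle × unitInterval)

/-- One end of the annulus with index `i` is glued along the edge loop of the relator `r i`, the
other end along the loop `α` of the copy of `X` with index `i`. -/
inductive JRel {A R B S : Type} (r : R → List (A × Bool)) (s : S → List (B × Bool)) (α : B) :
    JPieces r s → JPieces r s → Prop
  | rose (i : R) (t : unitInterval) :
      JRel r s α (Sum.inr (Sum.inr ⟨i, (Circle.exp (2 * Real.pi * t), 0)⟩))
        (Sum.inl (Rose.loop (r i) t))
  | copy (i : R) (t : unitInterval) :
      JRel r s α (Sum.inr (Sum.inr ⟨i, (Circle.exp (2 * Real.pi * t), 1)⟩))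
        (Sum.inr (Sum.inl ⟨i, StdComplex.edge s α t⟩))

/-- The complex `𝒥(𝒫)`. -/
def JComplex {A R B S : Type} (r : R → List (A × Bool)) (s : S → List (B × Bool)) (α : B) : Type :=
  Quot (JRel r s α)

section

variable {A R B S : Type} (r : R → List (A × Bool)) (s : S → List (B × Bool)) (α : B)

instance : TopologicalSpace (JComplex r s α) :=
  inferInstanceAs (TopologicalSpace (Quot (JRel r s α)))

/-- The inclusion of the rose on the generators of `𝒫`. -/
def JComplex.ofRose : C(Rose A, JComplex r s α) where
  toFun x := Quot.mk _ (Sum.inl x)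
  continuous_toFun := continuous_quot_mk.comp continuous_inl

/-- The inclusion of the copy of `X` with index `i`. -/
def JComplex.ofCopy (i : R) : C(StdComplex s, JComplex r s α) where
  toFun x := Quot.mk _ (Sum.inr (Sum.inl ⟨i, x⟩))
  continuous_toFun := continuous_quot_mk.comp
    (continuous_inr.comp (continuous_inl.comp continuous_sigmaMk))

/-- The base vertex of `𝒥(𝒫)`: the vertex of the rose on the generators of `𝒫`. -/
def JComplex.vertex : JComplex r s α := JComplex.ofRose r s α (Rose.vertex A)

/-- The path along the annulus with index `i` (over `1 ∈ 𝕊¹`) from the base vertex to the vertex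
of the copy of `X` with index `i`. -/
def JComplex.tail (i : R) :
    Path (JComplex.vertex r s α) (JComplex.ofCopy r s α i (StdComplex.vertex s)) where
  toFun u := Quot.mk _ (Sum.inr (Sum.inr ⟨i, (1, u)⟩))
  continuous_toFun := continuous_quot_mk.comp (continuous_inr.comp (continuous_inr.comp
    (continuous_sigmaMk.comp (Continuous.prodMk_right 1))))
  source' := by
    have h := Quot.sound (JRel.rose (r := r) (s := s) (α := α) i 0)
    simpa using! h
  target' := by
    have h := Quot.sound (JRel.copy (r := r) (s := s) (α := α) i 0)
    simpa using! h

/-- The loop of the generator `a` of `𝒫`. -/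
def JComplex.genLoop (a : A) : Path (JComplex.vertex r s α) (JComplex.vertex r s α) :=
  (Rose.edge a).map (JComplex.ofRose r s α).continuous

/-- The loop of the copy `bᵢ` of the generator `b` of `J`: along the annulus, around the edge `b`
of the copy of `X` with index `i`, and back. -/
def JComplex.copyLoop (i : R) (b : B) :
    Path (JComplex.vertex r s α) (JComplex.vertex r s α) :=
  (JComplex.tail r s α i).trans
    (((StdComplex.edge s b).map (JComplex.ofCopy r s α i).continuous).trans
      (JComplex.tail r s α i).symm)

end

/-! ### Fundamental groups -/

/-- The fundamental group, with `[γ] * [δ]` the class of the loop that runs first along `γ` and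
then along `δ`. (The product of `FundamentalGroup` is in the opposite order.) -/
abbrev Pi1 (Y : Type) [TopologicalSpace Y] (y : Y) : Type := (FundamentalGroup Y y)ᵐᵒᵖ

/-- The class of a loop in the fundamental group. -/
def Pi1.mk {Y : Type} [TopologicalSpace Y] {y : Y} (γ : Path y y) : Pi1 Y y :=
  MulOpposite.op (FundamentalGroup.fromPath (Path.Homotopic.Quotient.mk γ))

/-- A space is aspherical if it is path connected and its homotopy groups in degrees at least 2
vanish. -/
def IsAspherical (Y : Type) [TopologicalSpace Y] : Prop :=
  PathConnectedSpace Y ∧ ∀ (k : ℕ), 2 ≤ k → ∀ y : Y, Subsingleton (HomotopyGroup.Pi k Y y)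

/-- The group `𝒥_G`, the fundamental group of `𝒥(𝒫)`. -/
abbrev JGroup {A R B S : Type} (r : R → List (A × Bool)) (s : S → List (B × Bool)) (α : B) : Type :=
  Pi1 (JComplex r s α) (JComplex.vertex r s α)

/-- The canonical map `𝒥_G → G`: it sends each generator of `𝒫` to itself, and it is the quotient
by the normal closure of the generators of all the copies of `J`. -/
def IsCanonicalMap {A R B S : Type} (r : R → List (A × Bool)) (s : S → List (B × Bool)) (α : B)
    (κ : JGroup r s α →* Grp r) : Prop :=
  (∀ a : A, κ (Pi1.mk (JComplex.genLoop r s α a)) = PresentedGroup.of a) ∧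
    κ.ker = Subgroup.normalClosure
      (Set.range fun ib : R × B => Pi1.mk (JComplex.copyLoop r s α ib.1 ib.2))

/-- First integral homology of a group. -/
abbrev H1Z (G : Type) [Group G] : ModuleCat ℤ := groupHomology.H1 (Rep.trivial ℤ G ℤ)

/-- The profinite completion of a group. -/
abbrev ProfCompletion (G : Type) [Group G] : ProfiniteGrp :=
  ProfiniteGrp.profiniteCompletion.obj (GrpCat.of G)

/-- The morphism of profinite completions induced by a homomorphism. -/
abbrev ProfCompletion.map {G H : Type} [Group G] [Group H] (f : G →* H) :
    ProfCompletion G ⟶ ProfCompletion H :=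
  ProfiniteGrp.profiniteCompletion.map (GrpCat.ofHom f)

end JConstruction

end

noncomputable section

namespace JConstruction

open scoped unitInterval
open Set

/-! Everything rests on an explicit covering of `𝒥(𝒫)`. Given elements of a group `G` assigned to
the generators `a_j` and `b_i` that satisfy the relators of the copies of `J` and the relations `r_i
= α_i` (a `Holonomy`), one glues `G`-many vertices, edges, discs and strips into a space `JCover`
with a free `G`-action and quotient `𝒥(𝒫)`. The universal choice of `G` is the group `JPres`
presented by exactly these generators and relations.

Monodromy maps `𝒥_G` to `JPres`, and generating loops lift to paths that end at the corresponding
translates of the base point, so monodromy is a left inverse of the evident map `JPres → 𝒥_G`. It is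
injective for the reason that makes the universal covering simply connected: every point of the
covering can be given a homotopy class of paths in `𝒥(𝒫)` from the base vertex to its image,
compatibly with appending paths (`IsTransport`). A loop with closed lift returns to the class it
started from, hence is null-homotopic. This gives the presentation of `𝒥_G`
(`JGroup.bijective_lift`) without van Kampen's theorem.

The canonical map kills the copies of `J` in this presentation. Its kernel therefore lies in every
normal subgroup whose preimage in `J` under each map `J → 𝒥_G` is all of `J`
(`ker_canonicalMap_le`). For perfect `J` the commutator subgroup is such a subgroup; if the
profinite completion of `J` is trivial, every normal subgroup of finite index is.

For asphericity, `r_i` and `α` have infinite order, so amalgamated products show that `J` embeds in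
`JPres` and `α_i` has infinite order. The covering map from `JCover` is then null-homotopic
(`JCover.exists_nullHomotopy_proj`). Over the rose, a null-homotopy is given by path classes at the
vertices. Over a copy of `X`, the map to `X` is contracted inside `X`, where `π₂` vanishes, and then
moved to the base vertex along a locally constant path. Over an annulus lie strips, line times
interval; the contractions of their two ends turn each strip into a map from a line to a loop space,
and maps from lines contract without any condition on `π₂` of `𝒥(𝒫)`. A null-homotopic covering map
forces the higher homotopy groups of the base to vanish (`subsingleton_pi_of_cover`), since maps of
cubes lift. -/

instance contractibleSpace_unitInterval : ContractibleSpace I :=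
  (convex_Icc (0 : ℝ) 1).contractibleSpace ⟨0, by simp⟩

/-! ### Transport of homotopy classes of paths -/

/-- Homotopy classes of paths starting at `y₀`. -/
abbrev Based {Y : Type*} [TopologicalSpace Y] (y₀ : Y) : Type _ :=
  Σ y : Y, Path.Homotopic.Quotient y₀ y

section Follows

variable {Y : Type*} [TopologicalSpace Y] {y₀ : Y}

/-- The class `c'` is obtained from `c` by appending the path `γ`. -/
def Follows (c : Based y₀) (γ : C(I, Y)) (c' : Based y₀) : Prop :=
  ∃ a : Path.Homotopic.Quotient y₀ (γ 0), c = ⟨γ 0, a⟩ ∧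
    c' = ⟨γ 1, a.trans (.mk ⟨γ, rfl, rfl⟩)⟩

/-- `Follows` takes a bare map of the interval, so that composites `p.comp δ` need no casts of end
points; this recovers the version with named ends. -/
theorem follows_path_iff {c c' : Based y₀} {y y' : Y} (γ : Path y y') :
    Follows c γ c' ↔ ∃ a, c = ⟨y, a⟩ ∧ c' = ⟨y', a.trans (.mk γ)⟩ := by
  obtain ⟨γ, rfl, rfl⟩ := γ
  rfl

theorem Follows.fst_left {c c' : Based y₀} {γ : C(I, Y)} (h : Follows c γ c') : c.1 = γ 0 := by
  obtain ⟨a, rfl, rfl⟩ := h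
  rfl

theorem exists_follows {c : Based y₀} {γ : C(I, Y)} (h : c.1 = γ 0) : ∃ c', Follows c γ c' := by
  obtain ⟨y, a⟩ := c
  obtain rfl : y = γ 0 := h
  exact ⟨_, a, rfl, rfl⟩

theorem Follows.unique {c c' c'' : Based y₀} {γ : C(I, Y)} (h : Follows c γ c')
    (h' : Follows c γ c'') : c' = c'' := by
  obtain ⟨a, rfl, rfl⟩ := h
  obtain ⟨b, hb, rfl⟩ := h'
  obtain rfl : a = b := by simpa using hb
  rfl

theorem Follows.trans {c c' c'' : Based y₀} {y y' y'' : Y} {γ : Path y y'} {δ : Path y' y''}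
    (h : Follows c γ c') (h' : Follows c' δ c'') : Follows c (γ.trans δ) c'' := by
  rw [follows_path_iff] at *
  obtain ⟨a, rfl, rfl⟩ := h
  obtain ⟨b, hb, rfl⟩ := h'
  obtain rfl : a.trans (.mk γ) = b := by simpa using hb
  exact ⟨a, rfl, by simp⟩

theorem Follows.symm {c c' : Based y₀} {y y' : Y} {γ : Path y y'}
    (h : Follows c γ c') : Follows c' γ.symm c := by
  rw [follows_path_iff] at *
  obtain ⟨a, rfl, rfl⟩ := h
  exact ⟨_, rfl, by simp⟩

theorem Follows.congr {c c' : Based y₀} {y y' : Y} {γ δ : Path y y'}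
    (h : Follows c γ c') (hγ : γ.Homotopic δ) : Follows c δ c' := by
  rw [follows_path_iff] at *
  obtain ⟨a, rfl, rfl⟩ := h
  exact ⟨a, rfl, by rw [Path.Homotopic.Quotient.eq.mpr hγ]⟩

theorem follows_const (c : Based y₀) : Follows c (.const I c.1) c :=
  (follows_path_iff (Path.refl c.1)).2 ⟨c.2, rfl, by simp⟩

/-- Left cancellation in the fundamental groupoid. This is how a closed lift becomes a
null-homotopy. -/
theorem Follows.homotopic_refl {c : Based y₀} {y : Y} {γ : Path y y} (h : Follows c γ c) :
    γ.Homotopic (.refl y) := by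
  rw [follows_path_iff] at h
  obtain ⟨a, rfl, h⟩ := h
  rw [← Path.Homotopic.Quotient.eq, Path.Homotopic.Quotient.mk_refl]
  have h' : a = a.trans (.mk γ) := by simpa using h
  calc Path.Homotopic.Quotient.mk γ = (a.symm.trans a).trans (.mk γ) := by simp
    _ = _ := by rw [Path.Homotopic.Quotient.trans_assoc, ← h']; simp

/-- Following the images of two paths with the same ends in a simply connected space gives the
same result. -/
theorem Follows.of_simplyConnected {W : Type*} [TopologicalSpace W] [SimplyConnectedSpace W]
    {F : C(W, Y)} {w w' : W} {α : Path w w'} (β : Path w w') {c c' : Based y₀}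
    (h : Follows c (F.comp α) c') : Follows c (F.comp β) c' := by
  have h1 : Follows c (α.map F.continuous) c' := h
  exact h1.congr ((SimplyConnectedSpace.paths_homotopic α β).map F)

/-- The map `q` is compatible with appending the image under `p` of any path. -/
def IsTransport {Z : Type*} [TopologicalSpace Z] (p : C(Z, Y)) (q : Z → Based y₀) : Prop :=
  ∀ δ : C(I, Z), Follows (q (δ 0)) (p.comp δ) (q (δ 1))

variable {Z W : Type*} [TopologicalSpace Z] [TopologicalSpace W] {p : C(Z, Y)} {q : Z → Based y₀}

theorem IsTransport.fst (h : IsTransport p q) (z : Z) : (q z).1 = p z :=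
  (h (.const I z)).fst_left

theorem IsTransport.comp (h : IsTransport p q) (f : C(W, Z)) : IsTransport (p.comp f) (q ∘ f) :=
  fun δ => h (f.comp δ)

theorem IsTransport.path (h : IsTransport p q) {z z' : Z} (γ : Path z z') :
    Follows (q z) (p.comp γ) (q z') := by
  obtain ⟨γ, rfl, rfl⟩ := γ
  exact h γ

/-- Appending a path is deterministic, so this is uniqueness of lifts. It reduces a gluing condition
along a path connected piece to one point. -/
theorem IsTransport.eq_of_joined {q' : Z → Based y₀} (h : IsTransport p q) (h' : IsTransport p q')
    {z z' : Z} (hz : q z = q' z) (γ : Path z z') : q z' = q' z' :=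
  (h.path γ).unique (hz ▸ h'.path γ)

/-- Paths in a discrete space are constant. -/
theorem isTransport_of_discrete [DiscreteTopology Z] (h : ∀ z, (q z).1 = p z) :
    IsTransport p q := by
  intro δ
  have hδ : δ = .const I (δ 0) := by
    ext t
    exact PreconnectedSpace.constant inferInstance δ.continuous
  rw [hδ]
  have : p.comp (.const I (δ 0)) = .const I (q (δ 0)).1 := by
    rw [h]; rfl
  rw [this]
  exact follows_const _

/-- Transport only has to be checked on the paths inside the members of an open cover. -/
theorem isTransport_of_openCover {ι : Type*} (U : ι → Set Z) (hU : ∀ i, IsOpen (U i))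
    (hc : ∀ z, ∃ i, z ∈ U i)
    (h : ∀ i (δ : C(I, Z)), (∀ t, δ t ∈ U i) → Follows (q (δ 0)) (p.comp δ) (q (δ 1))) :
    IsTransport p q := by
  intro δ
  -- A Lebesgue subdivision: each piece of `δ` stays in one member of the cover.
  obtain ⟨t, h0, hm, ⟨n, hn⟩, ht⟩ := exists_monotone_Icc_subset_open_cover_unitInterval
    (c := fun i => δ ⁻¹' U i) (fun i => (hU i).preimage δ.continuous)
    (fun s _ => by simpa using hc (δ s))
  let γ : Path (δ 0) (δ 1) := ⟨δ, rfl, rfl⟩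
  -- Needed to start the induction, where the subpath is constant.
  have hp : (q (δ 0)).1 = p (δ 0) := by
    obtain ⟨i, hi⟩ := hc (δ 0)
    exact (h i (.const I (δ 0)) fun _ => hi).fst_left
  have key : ∀ k, Follows (q (δ (t 0))) (p.comp (γ.subpath (t 0) (t k))) (q (δ (t k))) := by
    intro k
    induction k with
    | zero =>
      rw [Path.subpath_self, h0]
      have := follows_const (q (δ 0))
      rw [hp] at this
      exact this
    | succ k ih =>
      have h1 : Follows (q (δ (t k))) (p.comp (γ.subpath (t k) (t (k + 1))))
          (q (δ (t (k + 1)))) := by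
        obtain ⟨i, hi⟩ := ht k
        have := h i (γ.subpath (t k) (t (k + 1))) fun s => by
          have : γ.subpath (t k) (t (k + 1)) s ∈ range (γ.subpath (t k) (t (k + 1))) := ⟨s, rfl⟩
          rw [Path.range_subpath_of_le _ _ _ (hm (Nat.le_succ k))] at this
          obtain ⟨s', hs', e⟩ := this
          change γ.subpath (t k) (t (k + 1)) s ∈ U i
          rw [← e]
          exact hi hs'
        have e0 : (γ.subpath (t k) (t (k + 1)) : C(I, Z)) 0 = δ (t k) := Path.source _
        have e1 : (γ.subpath (t k) (t (k + 1)) : C(I, Z)) 1 = δ (t (k + 1)) := Path.target _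
        rwa [e0, e1] at this
      have ih' : Follows (q (δ (t 0))) ((γ.subpath (t 0) (t k)).map p.continuous) (q (δ (t k))) :=
        ih
      have h1' : Follows (q (δ (t k))) ((γ.subpath (t k) (t (k + 1))).map p.continuous)
        (q (δ (t (k + 1)))) := h1
      have h2 := ih'.trans h1'
      rw [← Path.map_trans] at h2
      exact h2.congr (.map ⟨Path.Homotopy.subpathTransSubpath γ _ _ _⟩ p)
  have := key n
  rw [h0, hn n le_rfl, Path.subpath_zero_one] at this
  exact this

/-- The square is simply connected, so its top side is homotopic to the path around the other three
sides. -/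
theorem follows_square {F : C(I × I, Y)} {a b c d : Based y₀}
    (left : Follows a (F.comp ⟨fun s => (0, s), by fun_prop⟩) b)
    (bottom : Follows a (F.comp ⟨fun s => (s, 0), by fun_prop⟩) c)
    (right : Follows c (F.comp ⟨fun s => (1, s), by fun_prop⟩) d) :
    Follows b (F.comp ⟨fun s => (s, 1), by fun_prop⟩) d := by
  let l : Path ((0, 0) : I × I) (0, 1) := ⟨⟨fun s => (0, s), by fun_prop⟩, rfl, rfl⟩
  let m : Path ((0, 0) : I × I) (1, 0) := ⟨⟨fun s => (s, 0), by fun_prop⟩, rfl, rfl⟩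
  let r : Path ((1, 0) : I × I) (1, 1) := ⟨⟨fun s => (1, s), by fun_prop⟩, rfl, rfl⟩
  let t : Path ((0, 1) : I × I) (1, 1) := ⟨⟨fun s => (s, 1), by fun_prop⟩, rfl, rfl⟩
  have hl : Follows a (l.map F.continuous) b := left
  have hm : Follows a (m.map F.continuous) c := bottom
  have hr : Follows c (r.map F.continuous) d := right
  have h1 := (hl.symm.trans hm).trans hr
  rw [Path.map_symm, ← Path.map_trans, ← Path.map_trans] at h1
  have h2 : Follows b (F.comp ((l.symm.trans m).trans r)) d := h1
  exact h2.of_simplyConnected t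

/-- Transport extends over a product with a space that contracts to a point. -/
theorem exists_isTransport_prod {M : Type*} [TopologicalSpace M] (m₀ : M) (K : C(M × I, M))
    (K0 : ∀ m, K (m, 0) = m₀) (K1 : ∀ m, K (m, 1) = m) (Km : ∀ t, K (m₀, t) = m₀)
    (p : C(Z × M, Y)) (q₀ : Z → Based y₀)
    (hq : IsTransport (p.comp ⟨fun z => (z, m₀), by fun_prop⟩) q₀) :
    ∃ q : Z × M → Based y₀, IsTransport p q ∧ ∀ z, q (z, m₀) = q₀ z := by
  -- The class at `(z, m)` is that at `(z, m₀)` followed along the track of `m` under the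
  -- contraction; the tracks over a path form a square.
  have ex : ∀ x : Z × M, ∃ c, Follows (q₀ x.1) (p.comp ⟨fun t => (x.1, K (x.2, t)), by fun_prop⟩) c :=
    fun x => exists_follows (by simpa [K0] using hq.fst x.1)
  choose q hq' using ex
  refine ⟨q, fun δ => ?_, fun z => ?_⟩
  · let F : C(I × I, Y) := p.comp ⟨fun x => ((δ x.1).1, K ((δ x.1).2, x.2)), by fun_prop⟩
    have hl := hq' (δ 0)
    have hr := hq' (δ 1)
    have hb := hq ⟨fun s => (δ s).1, by fun_prop⟩
    have := follows_square (F := F) hl (c := q₀ (δ 1).1) (by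
      convert! hb using 1
      ext s; simp [F, K0]) hr
    convert this using 1
    ext s; simp [F, K1]
  · refine (hq' (z, m₀)).unique ?_
    have := hq (.const I z)
    convert! this using 1
    ext s; simp [Km]

end Follows

/-! ### Adjunction spaces along collared subspaces -/

/-- A map `i : D → M` onto a closed subset with a neighbourhood that can be pushed into it. -/
structure Collar (D M : Type) [TopologicalSpace D] [TopologicalSpace M] where
  /-- the inclusion -/
  i : C(D, M)
  /-- the collar -/
  N : Set M
  /-- the retraction of the collar -/
  r : M → D
  /-- the deformation that pushes the collar into the subspace -/
  push : C(M × I, M)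
  isOpen_N : IsOpen N
  isClosed_range : IsClosed (range i)
  continuousOn_r : ContinuousOn r N
  i_mem_N : ∀ d, i d ∈ N
  r_i : ∀ d, r (i d) = d
  push_zero : ∀ m, push (m, 0) = m
  push_i : ∀ d t, push (i d, t) = i d
  push_one : ∀ m ∈ N, push (m, 1) = i (r m)

section Adj

variable {D M E : Type} [TopologicalSpace D] [TopologicalSpace M] [TopologicalSpace E]

/-- The gluing relation of an adjunction space. -/
inductive AdjRel (c : Collar D M) (f : C(D, E)) : E ⊕ M → E ⊕ M → Prop
  | glue (d : D) : AdjRel c f (Sum.inr (c.i d)) (Sum.inl (f d))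

/-- The space obtained from `E` by attaching `M` along `f : D → E`. -/
def Adj (c : Collar D M) (f : C(D, E)) : Type := Quot (AdjRel c f)

instance (c : Collar D M) (f : C(D, E)) : TopologicalSpace (Adj c f) :=
  inferInstanceAs (TopologicalSpace (Quot (AdjRel c f)))

namespace Adj

variable {c : Collar D M} {f : C(D, E)} {T : Type*}

variable (c f) in
/-- The inclusion of the base. -/
def inl : C(E, Adj c f) where
  toFun e := Quot.mk _ (Sum.inl e)
  continuous_toFun := continuous_quot_mk.comp continuous_inl

variable (c f) in
/-- The characteristic map of the attached piece. -/
def inr : C(M, Adj c f) where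
  toFun m := Quot.mk _ (Sum.inr m)
  continuous_toFun := continuous_quot_mk.comp continuous_inr

theorem glue (d : D) : inr c f (c.i d) = inl c f (f d) := Quot.sound (.glue d)

theorem ind {motive : Adj c f → Prop} (hl : ∀ e, motive (inl c f e)) (hr : ∀ m, motive (inr c f m))
    (x : Adj c f) : motive x := by
  obtain ⟨e | m⟩ := x
  exacts [hl e, hr m]

/-- Functions on an adjunction space. -/
def desc (g : E → T) (h : M → T) (hgh : ∀ d, h (c.i d) = g (f d)) : Adj c f → T :=
  Quot.lift (Sum.elim g h) (by rintro _ _ ⟨d⟩; exact hgh d)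

theorem continuous_desc [TopologicalSpace T] {g : E → T} {h : M → T}
    (hgh : ∀ d, h (c.i d) = g (f d)) (hg : Continuous g) (hh : Continuous h) :
    Continuous (desc (f := f) g h hgh) :=
  continuous_quot_lift _ (hg.sumElim hh)

/-- Continuous maps on an adjunction space. -/
def descC [TopologicalSpace T] (g : C(E, T)) (h : C(M, T)) (hgh : ∀ d, h (c.i d) = g (f d)) :
    C(Adj c f, T) := ⟨desc g h hgh, continuous_desc hgh g.continuous h.continuous⟩

theorem isOpen_iff {U : Set (Adj c f)} :
    IsOpen U ↔ IsOpen (inl c f ⁻¹' U) ∧ IsOpen (inr c f ⁻¹' U) :=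
  isQuotientMap_quot_mk.isOpen_preimage.symm.trans isOpen_sum_iff

/-- The subset of an adjunction space given by compatible subsets of the pieces. -/
def glueSet (c : Collar D M) (f : C(D, E)) (A : Set E) (B : Set M)
    (h : ∀ d, c.i d ∈ B ↔ f d ∈ A) : Set (Adj c f) :=
  {x | desc (f := f) (fun e => e ∈ A) (fun m => m ∈ B) (fun d => propext (h d)) x}

theorem isOpen_glueSet {A : Set E} {B : Set M} (h : ∀ d, c.i d ∈ B ↔ f d ∈ A) (hA : IsOpen A)
    (hB : IsOpen B) : IsOpen (glueSet c f A B h) :=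
  isOpen_iff.2 ⟨hA, hB⟩

variable (c f) in
/-- The retraction of the collar onto the base (with arbitrary values off the collar). -/
def retract : Adj c f → E := desc id (fun m => f (c.r m)) fun d => by simp [c.r_i]

theorem isOpen_collar_inter {O : Set E} (hO : IsOpen O) : IsOpen (c.N ∩ {m | f (c.r m) ∈ O}) :=
  (f.continuous.comp_continuousOn c.continuousOn_r).isOpen_inter_preimage c.isOpen_N hO

variable (c f) in
/-- The base thickened over an open subset by the collar. -/
def thick (O : Set E) : Set (Adj c f) :=
  glueSet c f O (c.N ∩ {m | f (c.r m) ∈ O}) fun d => by simp [c.r_i, c.i_mem_N]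

theorem isOpen_thick {O : Set E} (hO : IsOpen O) : IsOpen (thick c f O) :=
  isOpen_glueSet _ hO (isOpen_collar_inter hO)

variable (c f) in
/-- An open subset of the attached piece off the base. -/
def inner (O : Set M) : Set (Adj c f) :=
  glueSet c f ∅ (O \ range c.i) fun d => by simp

theorem isOpen_inner {O : Set M} (hO : IsOpen O) : IsOpen (inner c f O) :=
  isOpen_glueSet _ isOpen_empty (hO.sdiff c.isClosed_range)

theorem exists_of_mem_inner {O : Set M} {x : Adj c f} (hx : x ∈ inner c f O) :
    ∃ m ∈ O, m ∉ range c.i ∧ inr c f m = x := by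
  induction x using ind with
  | hl e => exact hx.elim
  | hr m => exact ⟨m, hx.1, hx.2, rfl⟩

/-- The basic open cover of an adjunction space: the base with its collar, and the attached piece
off the base. -/
theorem mem_inner_or_thick (x : Adj c f) : x ∈ thick c f univ ∨ x ∈ inner c f univ := by
  induction x using ind with
  | hl e => exact .inl trivial
  | hr m =>
    by_cases hm : m ∈ range c.i
    · obtain ⟨d, rfl⟩ := hm
      exact .inl ⟨c.i_mem_N d, trivial⟩
    · exact .inr ⟨trivial, hm⟩

/-! #### Group actions -/

end Adj

/-- Every point has a neighbourhood that is disjoint from its translates. -/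
def Wandering {G Z : Type} [Group G] [TopologicalSpace Z] (act : G → Z → Z) : Prop :=
  ∀ z, ∃ U, IsOpen U ∧ z ∈ U ∧ ∀ g, ∀ x ∈ U, act g x ∈ U → g = 1

theorem wandering_of_map {G Z W : Type} [Group G] [TopologicalSpace Z] [TopologicalSpace W]
    {a : G → Z → Z} {b : G → W → W} (hb : Wandering b) (φ : C(Z, W))
    (h : ∀ g z, φ (a g z) = b g (φ z)) : Wandering a := by
  intro z
  obtain ⟨U, hU, hz, hg⟩ := hb (φ z)
  exact ⟨φ ⁻¹' U, hU.preimage φ.continuous, hz, fun g x hx hgx => hg g _ hx (by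
    rw [← h]; exact hgx)⟩

theorem wandering_mul {G Z : Type} [Group G] [TopologicalSpace Z] [DiscreteTopology Z]
    {a : G → Z → Z} (h : ∀ g z, a g z = z → g = 1) : Wandering a :=
  fun z => ⟨{z}, isOpen_discrete _, rfl, fun g x hx hgx => by
    obtain rfl : x = z := hx
    exact h g x hgx⟩

namespace Adj

variable {c : Collar D M} {f : C(D, E)}

/-- Maps between adjunction spaces. -/
def map {D' M' E' : Type} [TopologicalSpace D'] [TopologicalSpace M'] [TopologicalSpace E']
    {c' : Collar D' M'} {f' : C(D', E')} (aE : C(E, E')) (aM : C(M, M')) (aD : D → D')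
    (hi : ∀ d, aM (c.i d) = c'.i (aD d)) (hf : ∀ d, aE (f d) = f' (aD d)) :
    C(Adj c f, Adj c' f') :=
  descC ((inl c' f').comp aE) ((inr c' f').comp aM) fun d => by
    simp [hi, hf, glue]

/-- Near the base, a good neighbourhood in `E` is thickened by the collar, whose retraction is
equivariant by `hr`; off the base, a good neighbourhood in `M` serves. -/
theorem wandering {G : Type} [Group G] {aE : G → C(E, E)} {aM : G → C(M, M)} {aD : G → D → D}
    (hi : ∀ g d, aM g (c.i d) = c.i (aD g d)) (hf : ∀ g d, aE g (f d) = f (aD g d))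
    (hr : ∀ g, ∀ m ∈ c.N, c.r (aM g m) = aD g (c.r m))
    (hE : Wandering fun g e => aE g e) (hM : Wandering fun g m => aM g m) :
    Wandering fun g (x : Adj c f) => map (aE g) (aM g) (aD g) (hi g) (hf g) x := by
  have key : ∀ e : E, ∀ x, x ∈ thick c f univ → retract c f x = e → ∃ U, IsOpen U ∧ x ∈ U ∧
      ∀ g, ∀ y ∈ U, map (aE g) (aM g) (aD g) (hi g) (hf g) y ∈ U → g = 1 := by
    rintro e x hx rfl
    obtain ⟨O, hO, he, hg⟩ := hE (retract c f x)
    refine ⟨thick c f O, isOpen_thick hO, ?_, fun g y hy hgy => ?_⟩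
    · induction x using ind with
      | hl e => exact he
      | hr m => exact ⟨hx.1, he⟩
    · induction y using ind with
      | hl e => exact hg g e hy hgy
      | hr m =>
        refine hg g (f (c.r m)) hy.2 ?_
        have : f (c.r (aM g m)) ∈ O := hgy.2
        rwa [hr g m hy.1, ← hf] at this
  intro x
  obtain hx | hx := mem_inner_or_thick x
  · exact key _ x hx rfl
  · obtain ⟨m, -, hm, rfl⟩ := exists_of_mem_inner hx
    obtain ⟨O, hO, hmO, hg⟩ := hM m
    refine ⟨inner c f O, isOpen_inner hO, ⟨hmO, hm⟩, fun g y hy hgy => ?_⟩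
    obtain ⟨m', hm', h', rfl⟩ := exists_of_mem_inner hy
    exact hg g m' hm' hgy.1

/-! #### Transport -/

variable (c f) in
/-- The deformation that pushes the collar into the base. -/
def pushTrack : C(Adj c f, C(I, Adj c f)) :=
  descC (ContinuousMap.curry ⟨fun x : E × I => inl c f x.1, by fun_prop⟩)
    (ContinuousMap.curry ⟨fun x : M × I => inr c f (c.push x), by fun_prop⟩)
    fun d => by
      ext t
      simp [c.push_i, glue]

theorem pushTrack_inr (m : M) (t : I) : pushTrack c f (inr c f m) t = inr c f (c.push (m, t)) := rfl

/-- `retract` has arbitrary values off the collar, so continuity is available only along paths in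
the thickened base. -/
theorem continuous_retract_comp {δ : C(I, Adj c f)} (hδ : ∀ t, δ t ∈ thick c f univ) :
    Continuous fun t => retract c f (δ t) := by
  rw [continuous_def]
  intro O hO
  convert (isOpen_thick (c := c) (f := f) hO).preimage δ.continuous
  ext t
  have := hδ t
  simp only [mem_preimage]
  generalize δ t = x at this ⊢
  induction x using ind with
  | hl e => rfl
  | hr m => exact ⟨fun h => ⟨this.1, h⟩, fun h => h.2⟩

theorem exists_lift_of_inner {δ : C(I, Adj c f)} (hδ : ∀ t, δ t ∈ inner c f univ) :
    ∃ δ' : C(I, M), ∀ t, inr c f (δ' t) = δ t := by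
  choose δ' _ h1 h2 using fun t => exists_of_mem_inner (hδ t)
  refine ⟨⟨δ', ?_⟩, h2⟩
  rw [continuous_def]
  intro O hO
  convert (isOpen_inner (c := c) (f := f) hO).preimage δ.continuous
  ext t
  simp only [mem_preimage, ← h2]
  exact ⟨fun h => ⟨h, h1 t⟩, fun h => h.1⟩

variable {Y : Type*} [TopologicalSpace Y] {y₀ : Y}

/-- A path off the base lifts to `M`. A path in the thickened base is compared with its retraction
to `E` by the square that the collar deformation sweeps out. -/
theorem isTransport {p : C(Adj c f, Y)} {q : Adj c f → Based y₀}
    (hE : IsTransport (p.comp (inl c f)) (q ∘ inl c f))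
    (hM : IsTransport (p.comp (inr c f)) (q ∘ inr c f)) : IsTransport p q := by
  refine isTransport_of_openCover (fun b : Bool => if b then thick c f univ else inner c f univ)
    (fun b => ?_) (fun x => ?_) fun b δ hδ => ?_
  · cases b
    exacts [isOpen_inner isOpen_univ, isOpen_thick isOpen_univ]
  · obtain h | h := mem_inner_or_thick x
    exacts [⟨true, h⟩, ⟨false, h⟩]
  cases b with
  | false =>
    obtain ⟨δ', h⟩ := exists_lift_of_inner (f := f) hδ
    obtain rfl : (inr c f).comp δ' = δ := by ext t; exact h t
    exact hM δ'
  | true =>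
    -- The class at `x` arises from that at its retraction by running the collar track backwards,
    -- within `M`.
    have track : ∀ x ∈ thick c f univ, Follows (q (inl c f (retract c f x)))
        (p.comp ((pushTrack c f x).comp ⟨unitInterval.symm, by fun_prop⟩)) (q x) := by
      intro x hx
      induction x using ind with
      | hl e => exact hE (.const I e)
      | hr m =>
        have := hM ⟨fun t => c.push (m, unitInterval.symm t), by fun_prop⟩
        simp only [Function.comp_apply, ContinuousMap.coe_mk, unitInterval.symm_zero,
          unitInterval.symm_one, c.push_zero, c.push_one m hx.1, glue] at this
        exact this
    let F : C(I × I, Y) :=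
      ⟨fun x => p (pushTrack c f (δ x.1) (unitInterval.symm x.2)), by fun_prop⟩
    have h1 : ∀ x ∈ thick c f univ, pushTrack c f x 1 = inl c f (retract c f x) := by
      intro x hx
      induction x using ind with
      | hl e => rfl
      | hr m => rw [pushTrack_inr, c.push_one m hx.1, glue]; rfl
    have h0 : ∀ x, pushTrack c f x 0 = x := by
      intro x
      induction x using ind with
      | hl e => rfl
      | hr m => rw [pushTrack_inr, c.push_zero]
    have := follows_square (F := F) (track (δ 0) (hδ 0)) (c := q (inl c f (retract c f (δ 1)))) (by
      convert! hE ⟨fun t => retract c f (δ t), continuous_retract_comp hδ⟩ using 1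
      ext t
      simp [F, h1 _ (hδ t)]) (track (δ 1) (hδ 1))
    convert this using 1
    ext t
    simp [F, h0]

end Adj

end Adj

/-! ### Collars -/

section Collars

open unitInterval

/-- Multiplying a collar with a space. -/
def Collar.prod {D M : Type} [TopologicalSpace D] [TopologicalSpace M] (Z : Type)
    [TopologicalSpace Z] (c : Collar D M) : Collar (Z × D) (Z × M) where
  i := ⟨fun x => (x.1, c.i x.2), by fun_prop⟩
  N := univ ×ˢ c.N
  r x := (x.1, c.r x.2)
  push := ⟨fun x => (x.1.1, c.push (x.1.2, x.2)), by fun_prop⟩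
  isOpen_N := isOpen_univ.prod c.isOpen_N
  isClosed_range := by
    convert! isClosed_univ (X := Z) |>.prod c.isClosed_range
    ext ⟨z, m⟩
    simp
  continuousOn_r := by
    refine continuousOn_fst.prodMk (c.continuousOn_r.comp continuousOn_snd ?_)
    intro x hx
    exact hx.2
  i_mem_N d := ⟨trivial, c.i_mem_N _⟩
  r_i d := by simp [c.r_i]
  push_zero m := by simp [c.push_zero]
  push_i d t := by simp [c.push_i]
  push_one m hm := by simp [c.push_one _ hm.2]

/-- The end of the interval with the given index. -/
def boolEnd (b : Bool) : I := if b then 1 else 0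

/-- The ends of the unit interval. -/
def Collar.interval : Collar Bool I where
  i := ⟨boolEnd, continuous_of_discreteTopology⟩
  N := {t | (t : ℝ) < 1 / 4} ∪ {t | 3 / 4 < (t : ℝ)}
  r t := decide (1 / 2 < (t : ℝ))
  -- Stretching about the midpoint by the factor `1 + t` and clipping; at `t = 1` all points within
  -- `1 / 4` of an end have reached it.
  push := ⟨fun x => projIcc 0 1 zero_le_one (1 / 2 + (1 + x.2) * (x.1 - 1 / 2)), by fun_prop⟩
  isOpen_N := (isOpen_lt (by fun_prop) (by fun_prop)).union (isOpen_lt (by fun_prop) (by fun_prop))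
  isClosed_range := (finite_range _).isClosed
  continuousOn_r := by
    refine ContinuousOn.union_of_isOpen ?_ ?_ (isOpen_lt (by fun_prop) (by fun_prop))
      (isOpen_lt (by fun_prop) (by fun_prop))
    · refine (continuousOn_const (c := false)).congr fun t ht => ?_
      have ht : (t : ℝ) < 1 / 4 := ht
      simp; linarith
    · refine (continuousOn_const (c := true)).congr fun t ht => ?_
      have ht : 3 / 4 < (t : ℝ) := ht
      simp; linarith
  i_mem_N d := by cases d <;> simp [boolEnd]; norm_num
  r_i d := by cases d <;> simp [boolEnd]; norm_num
  push_zero t := by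
    simp
  push_i d t := by
    have := t.2.1
    cases d
    · refine projIcc_of_le_left zero_le_one ?_
      simp [boolEnd]; linarith
    · refine projIcc_of_right_le zero_le_one ?_
      simp [boolEnd]; linarith
  push_one t ht := by
    obtain h | h := ht
    · have h : (t : ℝ) < 1 / 4 := h
      have h' : decide (1 / 2 < (t : ℝ)) = false := by simp; linarith
      simp only [h', boolEnd, ContinuousMap.coe_mk]
      refine projIcc_of_le_left zero_le_one ?_
      simp; linarith
    · have h : 3 / 4 < (t : ℝ) := h
      have h' : decide (1 / 2 < (t : ℝ)) = true := by simp; linarith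
      simp only [h', boolEnd, ContinuousMap.coe_mk]
      refine projIcc_of_right_le zero_le_one ?_
      simp; linarith

/-- The radial retraction of the plane onto the unit disc. -/
def Disc.proj (z : ℂ) : Disc := ⟨((max 1 ‖z‖)⁻¹ : ℝ) • z, by
  have : 0 < max 1 ‖z‖ := by positivity
  rw [mem_closedBall_zero_iff, norm_smul, norm_inv, Real.norm_of_nonneg this.le,
    inv_mul_le_one₀ this]
  exact le_max_right _ _⟩

theorem Disc.continuous_proj : Continuous Disc.proj := by
  have h : Continuous fun z : ℂ => (max 1 ‖z‖)⁻¹ :=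
    Continuous.inv₀ (by fun_prop) fun z => by positivity
  exact Continuous.subtype_mk (h.smul continuous_id) _

theorem Disc.proj_of_norm_le {z : ℂ} (h : ‖z‖ ≤ 1) : (Disc.proj z : ℂ) = z := by
  simp [Disc.proj, max_eq_left h]

/-- The direction of a nonzero complex number (with an arbitrary value at zero). -/
def direction (z : ℂ) : Circle :=
  if h : z = 0 then 1 else ⟨(‖z‖⁻¹ : ℝ) • z, by
    simp [Submonoid.unitSphere, inv_mul_cancel₀ (norm_ne_zero_iff.2 h)]⟩

theorem coe_direction {z : ℂ} (h : z ≠ 0) : (direction z : ℂ) = (‖z‖⁻¹ : ℝ) • z := by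
  simp [direction, h]

theorem continuousOn_direction : ContinuousOn direction {0}ᶜ := by
  refine (Topology.IsInducing.induced (fun z : Circle => (z : ℂ))).continuousOn_iff.2 ?_
  refine ContinuousOn.congr (f := fun z : ℂ => (‖z‖⁻¹ : ℝ) • z) ?_ fun z hz => coe_direction hz
  have h : ContinuousOn (fun z : ℂ => ‖z‖⁻¹) {0}ᶜ :=
    ContinuousOn.inv₀ (by fun_prop) fun z hz => norm_ne_zero_iff.2 hz
  exact h.smul continuousOn_id

theorem direction_coe (z : Circle) : direction z = z := by
  ext
  rw [coe_direction (Circle.coe_ne_zero z), Circle.norm_coe]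
  simp

theorem Disc.proj_of_one_le {z : ℂ} (h : 1 ≤ ‖z‖) : (Disc.proj z : ℂ) = direction z := by
  rw [coe_direction (norm_ne_zero_iff.1 (by linarith))]
  simp [Disc.proj, max_eq_right h]

/-- The boundary of the disc. -/
def Collar.disc : Collar Circle Disc where
  i := ⟨fun z => ⟨z, by rw [mem_closedBall_zero_iff, Circle.norm_coe]⟩, by fun_prop⟩
  N := {z | 1 / 2 < ‖(z : ℂ)‖}
  r z := direction z
  -- Radial stretching by `1 + t`, clipped to the disc; at `t = 1` it carries norms above `1 / 2` to
  -- the boundary.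
  push := ⟨fun x => Disc.proj ((1 + x.2 : ℝ) • (x.1 : ℂ)),
    Disc.continuous_proj.comp (by fun_prop)⟩
  isOpen_N := isOpen_lt (by fun_prop) (by fun_prop)
  isClosed_range := (isCompact_range (by fun_prop)).isClosed
  continuousOn_r := continuousOn_direction.comp (by fun_prop) fun z hz => by
    have hz : 1 / 2 < ‖(z : ℂ)‖ := hz
    exact norm_ne_zero_iff.1 (by linarith)
  i_mem_N d := by
    change 1 / 2 < ‖(d : ℂ)‖
    rw [Circle.norm_coe]; norm_num
  r_i d := direction_coe d
  push_zero z := by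
    ext
    have : ‖(z : ℂ)‖ ≤ 1 := mem_closedBall_zero_iff.1 z.2
    simp [Disc.proj_of_norm_le this]
  push_i d t := by
    ext
    have ht : 0 ≤ (t : ℝ) := t.2.1
    have : 0 < (1 + t : ℝ) := by linarith
    have h1 : ‖(1 + t : ℝ) • (d : ℂ)‖ = 1 + t := by
      rw [norm_smul, Real.norm_of_nonneg this.le, Circle.norm_coe, mul_one]
    change (Disc.proj ((1 + t : ℝ) • (d : ℂ)) : ℂ) = d
    rw [Disc.proj_of_one_le (by linarith), coe_direction (norm_ne_zero_iff.1 (by linarith)), h1,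
      smul_smul, inv_mul_cancel₀ this.ne', one_smul]
  push_one z hz := by
    have hz : 1 / 2 < ‖(z : ℂ)‖ := hz
    ext
    have h1 : ‖(1 + (1 : I) : ℝ) • (z : ℂ)‖ = 2 * ‖(z : ℂ)‖ := by
      rw [norm_smul]; norm_num
    have h0 : (z : ℂ) ≠ 0 := norm_ne_zero_iff.1 (by linarith)
    simp only [ContinuousMap.coe_mk]
    rw [Disc.proj_of_one_le (by linarith), coe_direction (norm_ne_zero_iff.1 (by linarith)), h1,
      coe_direction h0, smul_smul]
    congr 1
    have : ‖(z : ℂ)‖ ≠ 0 := by linarith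
    simp only [Icc.coe_one]
    field_simp
    norm_num

end Collars

/-! ### The circle as a quotient of the interval -/

/-- The parametrization of the circle. -/
def circleParam : C(I, Circle) := ⟨fun t => Circle.exp (2 * Real.pi * t), by fun_prop⟩

theorem circleParam_apply (t : I) : circleParam t = Circle.exp (2 * Real.pi * t) := rfl

theorem circleParam_zero : circleParam 0 = 1 := by simp [circleParam_apply]

theorem circleParam_one : circleParam 1 = 1 := by simp [circleParam_apply]

theorem surjective_circleParam : Function.Surjective circleParam := by
  intro z
  have hpi := Real.pi_pos
  obtain h | h := le_or_gt 0 (Complex.arg z)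
  · refine ⟨⟨Complex.arg z / (2 * Real.pi), by positivity, ?_⟩, ?_⟩
    · rw [div_le_one (by positivity)]
      linarith [Complex.arg_le_pi z]
    · rw [circleParam_apply]
      convert! Circle.exp_arg z using 2
      field_simp
  · refine ⟨⟨Complex.arg z / (2 * Real.pi) + 1, ?_, ?_⟩, ?_⟩
    · have := Complex.neg_pi_lt_arg z
      rw [div_add_one (by positivity)]
      apply div_nonneg <;> linarith
    · have : Complex.arg z / (2 * Real.pi) ≤ 0 := div_nonpos_of_nonpos_of_nonneg h.le (by positivity)
      linarith
    · rw [circleParam_apply]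
      have : (2 * Real.pi * (Complex.arg z / (2 * Real.pi) + 1)) = Complex.arg z + 2 * Real.pi := by
        field_simp
      simp only [this, Circle.exp_add_two_pi, Circle.exp_arg]

theorem isQuotientMap_circleParam : Topology.IsQuotientMap circleParam :=
  circleParam.continuous.isClosedMap.isQuotientMap circleParam.continuous surjective_circleParam

/-- Equal values differ by an integer in the parameter, and on `[0, 1]` this integer is `0`, `1` or
`-1`. -/
theorem circleParam_eq {s t : I} (h : circleParam s = circleParam t) :
    s = t ∨ (s = 0 ∧ t = 1) ∨ (s = 1 ∧ t = 0) := by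
  rw [circleParam_apply, circleParam_apply, Circle.exp_eq_exp] at h
  obtain ⟨m, hm⟩ := h
  have hpi := Real.pi_pos
  have h1 : (s : ℝ) = t + m := by
    have : 2 * Real.pi * s = 2 * Real.pi * (t + m) := by linarith
    exact mul_left_cancel₀ (by positivity) this
  have hs := s.2
  have ht := t.2
  simp only [mem_Icc] at hs ht
  have hm1 : (m : ℝ) ≤ 1 := by linarith
  have hm2 : (-1 : ℝ) ≤ m := by linarith
  have hm1' : m ≤ 1 := by exact_mod_cast hm1
  have hm2' : -1 ≤ m := by exact_mod_cast hm2
  obtain rfl | rfl | rfl : m = 0 ∨ m = 1 ∨ m = -1 := by omega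
  · left; ext; simpa using h1
  · right; right
    push_cast at h1
    exact ⟨Subtype.ext (show (s : ℝ) = 1 by linarith), Subtype.ext (show (t : ℝ) = 0 by linarith)⟩
  · right; left
    push_cast at h1
    exact ⟨Subtype.ext (show (s : ℝ) = 0 by linarith), Subtype.ext (show (t : ℝ) = 1 by linarith)⟩

theorem eq_of_circleParam_eq {T : Sort*} (γ : I → T) (h : γ 0 = γ 1) {s t : I}
    (hst : circleParam s = circleParam t) : γ s = γ t := by
  obtain rfl | ⟨rfl, rfl⟩ | ⟨rfl, rfl⟩ := circleParam_eq hst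
  exacts [rfl, h, h.symm]

/-- A loop as a function on the circle. -/
def circleMap {Z : Type*} [TopologicalSpace Z] (γ : C(I, Z)) (h : γ 0 = γ 1) : C(Circle, Z) where
  toFun z := γ (surjective_circleParam z).choose
  continuous_toFun := by
    rw [isQuotientMap_circleParam.continuous_iff]
    convert γ.continuous
    ext t
    exact eq_of_circleParam_eq γ h (surjective_circleParam (circleParam t)).choose_spec

theorem circleMap_param {Z : Type*} [TopologicalSpace Z] (γ : C(I, Z)) (h : γ 0 = γ 1) (t : I) :
    circleMap γ h (circleParam t) = γ t :=
  eq_of_circleParam_eq γ h (surjective_circleParam (circleParam t)).choose_spec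

theorem isQuotientMap_of_isOpen {X Y : Type*} [TopologicalSpace X] [TopologicalSpace Y] (f : C(X, Y))
    (hf : Function.Surjective f) (h : ∀ U, IsOpen (f ⁻¹' U) → IsOpen U) :
    Topology.IsQuotientMap f :=
  ⟨Topology.isCoinducing_iff.2 fun U => ⟨h U, fun hU => hU.preimage f.continuous⟩, hf⟩

/-! ### Coverings of roses -/

section RoseCover

variable {G A : Type} [Group G] [TopologicalSpace G] [DiscreteTopology G]
  [TopologicalSpace A] [DiscreteTopology A] (φ : A → G)

/-- The ends of the edges of the covering of a rose. -/
def roseAttach : C((G × A) × Bool, G) where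
  toFun x := if x.2 then x.1.1 * φ x.1.2 else x.1.1
  continuous_toFun := continuous_of_discreteTopology

/-- The covering of the rose on `A` with group `G` and holonomy `φ`. -/
abbrev RoseCover : Type := Adj (Collar.interval.prod (G × A)) (roseAttach φ)

namespace RoseCover

/-- The vertices of the covering. -/
def vertex : C(G, RoseCover φ) := Adj.inl _ _

/-- The edges of the covering. -/
def edgePt : C((G × A) × I, RoseCover φ) := Adj.inr _ _

theorem edgePt_zero (g : G) (a : A) : edgePt φ ((g, a), 0) = vertex φ g :=
  Adj.glue (c := Collar.interval.prod (G × A)) (f := roseAttach φ) ((g, a), false)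

theorem edgePt_one (g : G) (a : A) : edgePt φ ((g, a), 1) = vertex φ (g * φ a) :=
  Adj.glue (c := Collar.interval.prod (G × A)) (f := roseAttach φ) ((g, a), true)

/-- The translation action. -/
def act (h : G) : C(RoseCover φ, RoseCover φ) :=
  Adj.map ⟨fun g => h * g, continuous_of_discreteTopology⟩
    ⟨fun x => ((h * x.1.1, x.1.2), x.2), by
      have : Continuous fun g : G => h * g := continuous_of_discreteTopology
      fun_prop⟩
    (fun d => ((h * d.1.1, d.1.2), d.2)) (fun d => rfl) fun d => by
      simp only [roseAttach, ContinuousMap.coe_mk]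
      split_ifs <;> simp [mul_assoc]

@[simp] theorem act_vertex (h g : G) : act φ h (vertex φ g) = vertex φ (h * g) := rfl

@[simp] theorem act_edgePt (h g : G) (a : A) (t : I) :
    act φ h (edgePt φ ((g, a), t)) = edgePt φ ((h * g, a), t) := rfl

variable {φ} in
theorem ind {motive : RoseCover φ → Prop} (hv : ∀ g, motive (vertex φ g))
    (he : ∀ g a t, motive (edgePt φ ((g, a), t))) (x : RoseCover φ) : motive x :=
  Adj.ind hv (fun ⟨⟨g, a⟩, t⟩ => he g a t) x

theorem act_one (x : RoseCover φ) : act φ 1 x = x := by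
  induction x using ind <;> simp

theorem act_mul (g h : G) (x : RoseCover φ) : act φ (g * h) x = act φ g (act φ h x) := by
  induction x using ind <;> simp [mul_assoc]

theorem wandering : Wandering fun g x => act φ g x := by
  refine Adj.wandering (c := Collar.interval.prod (G × A)) (fun _ _ => rfl) _
    (fun _ _ _ => rfl) ?_ ?_
  · exact wandering_mul fun g z h => by simpa using h
  · refine wandering_of_map (b := fun (g : G) (h : G) => g * h)
      (wandering_mul fun g z h => by simpa using h) ⟨fun x => x.1.1, by fun_prop⟩ fun _ _ => rfl

/-- The covering map. -/
def proj : C(RoseCover φ, Rose A) :=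
  Adj.descC (.const G (Rose.vertex A))
    ⟨fun x => Rose.edge x.1.2 x.2, continuous_prod_of_discrete_left.2 fun x => by fun_prop⟩
    fun d => by
      obtain ⟨⟨g, a⟩, _ | _⟩ := d
      exacts [(Rose.edge a).source, (Rose.edge a).target]

@[simp] theorem proj_vertex (g : G) : proj φ (vertex φ g) = Rose.vertex A := rfl

@[simp] theorem proj_edgePt (g : G) (a : A) (t : I) :
    proj φ (edgePt φ ((g, a), t)) = Rose.edge a t := rfl

@[simp] theorem proj_act (g : G) (x : RoseCover φ) : proj φ (act φ g x) = proj φ x := by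
  induction x using ind <;> simp

end RoseCover

/-- The holonomy of a letter. -/
def letterVal (x : A × Bool) : G := cond x.2 (φ x.1) (φ x.1)⁻¹

/-- The holonomy of a word. -/
def wordVal (w : List (A × Bool)) : G := (w.map (letterVal φ)).prod

omit [TopologicalSpace G] [DiscreteTopology G] [TopologicalSpace A] [DiscreteTopology A] in
theorem wordVal_eq (w : List (A × Bool)) : wordVal φ w = FreeGroup.lift φ (FreeGroup.mk w) := by
  rw [FreeGroup.lift_mk]
  rfl

namespace RoseCover

/-- An edge of the covering as a path. -/
def edge (g : G) (a : A) : Path (vertex φ g) (vertex φ (g * φ a)) where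
  toFun t := edgePt φ ((g, a), t)
  source' := edgePt_zero φ g a
  target' := edgePt_one φ g a

/-- The lift of the loop of a letter. -/
def liftLetter (g : G) : (x : A × Bool) → Path (vertex φ g) (vertex φ (g * letterVal φ x))
  | (a, true) => edge φ g a
  | (a, false) => (edge φ (g * (φ a)⁻¹) a).symm.cast (by simp) rfl

/-- The lift of the loop of a word. -/
def liftLoop : (g : G) → (w : List (A × Bool)) → Path (vertex φ g) (vertex φ (g * wordVal φ w))
  | g, [] => (Path.refl _).cast rfl (by simp [wordVal])
  | g, [x] => (liftLetter φ g x).cast rfl (by simp [wordVal])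
  | g, x :: y :: w => ((liftLetter φ g x).trans
      (liftLoop (g * letterVal φ x) (y :: w))).cast rfl (by simp [wordVal, mul_assoc])

theorem proj_liftLetter (g : G) (x : A × Bool) (t : I) :
    proj φ (liftLetter φ g x t) = Rose.letter x t := by
  obtain ⟨a, _ | _⟩ := x
  exacts [proj_edgePt φ _ a _, proj_edgePt φ _ a _]

theorem proj_liftLoop (g : G) (w : List (A × Bool)) (t : I) :
    proj φ (liftLoop φ g w t) = Rose.loop w t := by
  induction w using List.twoStepInduction generalizing g t with
  | nil => simp [liftLoop, Rose.loop]
  | singleton x => simp [liftLoop, Rose.loop, proj_liftLetter]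
  | cons_cons x y w _ ih =>
    simp only [liftLoop, Rose.loop, Path.cast_coe, Path.trans_apply]
    split_ifs
    exacts [proj_liftLetter φ _ _ _, ih y _ _]

theorem act_liftLetter (h g : G) (x : A × Bool) (t : I) :
    act φ h (liftLetter φ g x t) = liftLetter φ (h * g) x t := by
  obtain ⟨a, _ | _⟩ := x
  · change edgePt φ ((h * (g * (φ a)⁻¹), a), _) = edgePt φ ((h * g * (φ a)⁻¹, a), _)
    rw [mul_assoc]
  · rfl

theorem liftLoop_congr {g g' : G} (h : g = g') (w : List (A × Bool)) (t : I) :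
    liftLoop φ g w t = liftLoop φ g' w t := by
  subst h; rfl

theorem act_liftLoop (h g : G) (w : List (A × Bool)) (t : I) :
    act φ h (liftLoop φ g w t) = liftLoop φ (h * g) w t := by
  induction w using List.twoStepInduction generalizing g t with
  | nil => simp [liftLoop]
  | singleton x => simp [liftLoop, act_liftLetter]
  | cons_cons x y w _ ih =>
    simp only [liftLoop, Path.cast_coe, Path.trans_apply]
    split_ifs
    · exact act_liftLetter φ _ _ _ _
    · rw [ih y]
      exact liftLoop_congr φ (mul_assoc _ _ _).symm _ _

/-- The map from the covering of a circle along a word. -/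
def lineMap (w : List (A × Bool)) {c : G} (hc : wordVal φ w = c) :
    C(RoseCover (fun _ : Unit => c), RoseCover φ) :=
  Adj.descC (vertex φ)
    ⟨fun x => liftLoop φ x.1.1 w x.2,
      continuous_prod_of_discrete_left.2 fun x => (liftLoop φ x.1 w).continuous⟩
    fun d => by
      obtain ⟨⟨g, a⟩, _ | _⟩ := d
      · exact (liftLoop φ g w).source
      · subst hc
        exact (liftLoop φ g w).target

@[simp] theorem lineMap_vertex (w : List (A × Bool)) {c : G} (hc : wordVal φ w = c) (g : G) :
    lineMap φ w hc (vertex _ g) = vertex φ g := rfl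

@[simp] theorem lineMap_edgePt (w : List (A × Bool)) {c : G} (hc : wordVal φ w = c) (g : G)
    (u : Unit) (t : I) : lineMap φ w hc (edgePt _ ((g, u), t)) = liftLoop φ g w t := rfl

theorem act_lineMap (w : List (A × Bool)) {c : G} (hc : wordVal φ w = c) (h : G)
    (x : RoseCover (fun _ : Unit => c)) :
    act φ h (lineMap φ w hc x) = lineMap φ w hc (act _ h x) := by
  induction x using ind <;> simp [act_liftLoop]

/-- Openness in the rose is tested on each edge, and every edge lifts continuously to the sheet of
`1`. -/
theorem isQuotientMap_proj : Topology.IsQuotientMap (proj φ) := by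
  refine isQuotientMap_of_isOpen _ ?_ fun U h => ?_
  · rintro ⟨⟨⟩ | ⟨a, t⟩⟩
    exacts [⟨vertex φ 1, rfl⟩, ⟨edgePt φ ((1, a), t), rfl⟩]
  · refine isQuotientMap_quot_mk.isOpen_preimage.1 (isOpen_sum_iff.2 ⟨isOpen_discrete _, ?_⟩)
    refine isOpen_sigma_iff.2 fun a => ?_
    exact h.preimage (f := fun t => edgePt φ ((1, a), t)) (by fun_prop)

end RoseCover

/-! #### Orbits -/

/-- The orbits of an action. -/
def Orb {Z : Type} (act : G → Z → Z) : Type := Quot fun x y => ∃ h, act h x = y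

omit [TopologicalSpace G] [DiscreteTopology G] in
theorem Orb.exact {Z : Type} {act : G → Z → Z} (h1 : ∀ x, act 1 x = x)
    (hm : ∀ g h x, act (g * h) x = act g (act h x)) {x y : Z}
    (h : (Quot.mk _ x : Orb act) = Quot.mk _ y) : ∃ h, act h x = y := by
  have : Equivalence fun x y => ∃ h, act h x = y :=
    ⟨fun x => ⟨1, h1 x⟩, fun ⟨h, e⟩ => ⟨h⁻¹, by rw [← e, ← hm, inv_mul_cancel, h1]⟩,
      fun ⟨h, e⟩ ⟨k, e'⟩ => ⟨k * h, by rw [hm, e, e']⟩⟩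
  exact (Equivalence.quot_mk_eq_iff this x y).1 h

/-- The map on orbits induced by an equivariant map. -/
def Orb.map {Z W : Type} {a : G → Z → Z} {b : G → W → W} (f : Z → W)
    (h : ∀ g z, f (a g z) = b g (f z)) : Orb a → Orb b :=
  Quot.map f fun x y ⟨g, e⟩ => ⟨g, by rw [← h, e]⟩

namespace RoseCover

/-- The point of the rose as an orbit. -/
def orb : Rose A → Orb (fun g x => act φ g x) :=
  Quot.lift (Sum.elim (fun _ => Quot.mk _ (vertex φ 1))
    (fun x => Quot.mk _ (edgePt φ ((1, x.1), x.2)))) (by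
      rintro _ _ (⟨a⟩ | ⟨a⟩)
      · exact congrArg (Quot.mk _) (edgePt_zero φ 1 a)
      · exact (Quot.sound ⟨φ a, by simp [edgePt_one]⟩).symm)

/-- This shows that a fibre lies in a single orbit; the converse is `proj_act`. -/
theorem orb_proj (x : RoseCover φ) : orb φ (proj φ x) = Quot.mk _ x := by
  induction x using ind with
  | hv g => exact Quot.sound ⟨g, by simp⟩
  | he g a t => exact Quot.sound ⟨g, by simp⟩

end RoseCover

end RoseCover

/-! ### Coverings of standard complexes -/

/-- The discs of the standard complex. -/
def StdComplex.disc {A R : Type} (r : R → List (A × Bool)) (k : R) : C(Disc, StdComplex r) where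
  toFun z := Quot.mk _ (Sum.inr ⟨k, z⟩)
  continuous_toFun := by
    have h : Continuous fun z : Disc => (⟨k, z⟩ : Σ _ : R, Disc) :=
      @continuous_sigmaMk R (fun _ => Disc) _ k
    exact continuous_quot_mk.comp (continuous_inr.comp h)

section StdCover

variable {G B S : Type} [Group G] [TopologicalSpace G] [DiscreteTopology G]
  [TopologicalSpace B] [DiscreteTopology B] [TopologicalSpace S] [DiscreteTopology S]
  (φ : B → G) (s : S → List (B × Bool)) (hs : ∀ k, wordVal φ (s k) = 1)

omit [TopologicalSpace S] [DiscreteTopology S] in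
theorem RoseCover.liftLoop_closed (g : G) {w : List (B × Bool)} (h : wordVal φ w = 1) :
    (liftLoop φ g w : C(I, RoseCover φ)) 0 = (liftLoop φ g w : C(I, RoseCover φ)) 1 := by
  change liftLoop φ g w 0 = liftLoop φ g w 1
  rw [Path.source, Path.target, h, mul_one]

/-- The boundary of a disc of the covering of a standard complex. -/
def discLoop (g : G) (k : S) : C(Circle, RoseCover φ) :=
  circleMap (RoseCover.liftLoop φ g (s k)).toContinuousMap
    (RoseCover.liftLoop_closed φ g (hs k))

/-- The boundaries of the discs of the covering of a standard complex. -/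
def discAttach : C((G × S) × Circle, RoseCover φ) where
  toFun x := discLoop φ s hs x.1.1 x.1.2 x.2
  continuous_toFun := continuous_prod_of_discrete_left.2 fun x =>
    (discLoop φ s hs x.1 x.2).continuous

theorem discAttach_param (g : G) (k : S) (t : I) :
    discAttach φ s hs ((g, k), circleParam t) = RoseCover.liftLoop φ g (s k) t :=
  circleMap_param _ (RoseCover.liftLoop_closed φ g (hs k)) t

/-- The covering of the standard complex of `s` with group `G` and holonomy `φ`. -/
abbrev StdCover : Type := Adj (Collar.disc.prod (G × S)) (discAttach φ s hs)

namespace StdCover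

/-- The inclusion of the 1-skeleton. -/
def ofRose : C(RoseCover φ, StdCover φ s hs) := Adj.inl _ _

/-- The discs of the covering. -/
def discPt : C((G × S) × Disc, StdCover φ s hs) := Adj.inr _ _

theorem discPt_boundary (g : G) (k : S) (t : I) :
    discPt φ s hs ((g, k), Disc.boundary t) = ofRose φ s hs (RoseCover.liftLoop φ g (s k) t) := by
  rw [← discAttach_param φ s hs]
  exact Adj.glue (c := Collar.disc.prod (G × S)) (f := discAttach φ s hs) ((g, k), circleParam t)

variable {φ s hs} in
theorem ind {motive : StdCover φ s hs → Prop} (hl : ∀ x, motive (ofRose φ s hs x))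
    (hd : ∀ g k z, motive (discPt φ s hs ((g, k), z))) (x : StdCover φ s hs) : motive x :=
  Adj.ind hl (fun ⟨⟨g, k⟩, z⟩ => hd g k z) x

/-- The translation action. -/
def act (h : G) : C(StdCover φ s hs, StdCover φ s hs) :=
  Adj.map (RoseCover.act φ h)
    ⟨fun x => ((h * x.1.1, x.1.2), x.2), by
      have : Continuous fun g : G => h * g := continuous_of_discreteTopology
      fun_prop⟩
    (fun d => ((h * d.1.1, d.1.2), d.2)) (fun d => rfl) fun d => by
      obtain ⟨⟨g, k⟩, z⟩ := d
      obtain ⟨t, rfl⟩ := surjective_circleParam z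
      simp only [discAttach_param, RoseCover.act_liftLoop]

@[simp] theorem act_ofRose (h : G) (x : RoseCover φ) :
    act φ s hs h (ofRose φ s hs x) = ofRose φ s hs (RoseCover.act φ h x) := rfl

@[simp] theorem act_discPt (h g : G) (k : S) (z : Disc) :
    act φ s hs h (discPt φ s hs ((g, k), z)) = discPt φ s hs ((h * g, k), z) := rfl

theorem act_one (x : StdCover φ s hs) : act φ s hs 1 x = x := by
  induction x using ind <;> simp [RoseCover.act_one]

theorem act_mul (g h : G) (x : StdCover φ s hs) :
    act φ s hs (g * h) x = act φ s hs g (act φ s hs h x) := by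
  induction x using ind <;> simp [mul_assoc, RoseCover.act_mul]

theorem wandering : Wandering fun g x => act φ s hs g x := by
  refine Adj.wandering (c := Collar.disc.prod (G × S)) (fun _ _ => rfl) _ (fun _ _ _ => rfl)
    (RoseCover.wandering φ) ?_
  refine wandering_of_map (b := fun (g : G) (h : G) => g * h)
    (wandering_mul fun g z h => by simpa using h) ⟨fun x => x.1.1, by fun_prop⟩ fun _ _ => rfl

/-- The covering map. -/
def proj : C(StdCover φ s hs, StdComplex s) :=
  Adj.descC ((StdComplex.ofRose s).comp (RoseCover.proj φ))
    ⟨fun x => StdComplex.disc s x.1.2 x.2, continuous_prod_of_discrete_left.2 fun x =>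
      (StdComplex.disc s x.2).continuous⟩
    fun d => by
      obtain ⟨⟨g, k⟩, z⟩ := d
      obtain ⟨t, rfl⟩ := surjective_circleParam z
      simp only [discAttach_param, ContinuousMap.comp_apply, RoseCover.proj_liftLoop]
      exact Quot.sound (StdRel.attach k t)

@[simp] theorem proj_ofRose (x : RoseCover φ) :
    proj φ s hs (ofRose φ s hs x) = StdComplex.ofRose s (RoseCover.proj φ x) := rfl

@[simp] theorem proj_discPt (g : G) (k : S) (z : Disc) :
    proj φ s hs (discPt φ s hs ((g, k), z)) = StdComplex.disc s k z := rfl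

@[simp] theorem proj_act (g : G) (x : StdCover φ s hs) :
    proj φ s hs (act φ s hs g x) = proj φ s hs x := by
  induction x using ind <;> simp

theorem isQuotientMap_proj : Topology.IsQuotientMap (proj φ s hs) := by
  refine isQuotientMap_of_isOpen _ ?_ fun U h => ?_
  · rintro ⟨x | ⟨k, z⟩⟩
    · obtain ⟨x, rfl⟩ := (RoseCover.isQuotientMap_proj φ).surjective x
      exact ⟨ofRose φ s hs x, rfl⟩
    · exact ⟨discPt φ s hs ((1, k), z), rfl⟩
  · refine isQuotientMap_quot_mk.isOpen_preimage.1 (isOpen_sum_iff.2 ⟨?_, ?_⟩)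
    · rw [← (RoseCover.isQuotientMap_proj φ).isOpen_preimage]
      exact h.preimage (ofRose φ s hs).continuous
    · refine isOpen_sigma_iff.2 fun k => ?_
      exact h.preimage (f := fun z => discPt φ s hs ((1, k), z)) (by fun_prop)

/-- The point of the standard complex as an orbit. -/
def orb : StdComplex s → Orb (fun g x => act φ s hs g x) :=
  Quot.lift (Sum.elim (fun x => Orb.map (ofRose φ s hs) (fun _ _ => rfl) (RoseCover.orb φ x))
    (fun x => Quot.mk _ (discPt φ s hs ((1, x.1), x.2)))) (by
      rintro _ _ ⟨k, t⟩
      change (Quot.mk _ (discPt φ s hs ((1, k), Disc.boundary t)) : Orb _) =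
        Orb.map (ofRose φ s hs) (fun _ _ => rfl) (RoseCover.orb φ (Rose.loop (s k) t))
      rw [discPt_boundary, ← RoseCover.proj_liftLoop φ 1, RoseCover.orb_proj]
      rfl)

theorem orb_proj (x : StdCover φ s hs) : orb φ s hs (proj φ s hs x) = Quot.mk _ x := by
  induction x using ind with
  | hl x =>
    have := RoseCover.orb_proj φ x
    exact congrArg (Orb.map (ofRose φ s hs) (fun _ _ => rfl)) this
  | hd g a t => exact Quot.sound ⟨g, by simp⟩

end StdCover

end StdCover

/-! ### Coverings of `𝒥(𝒫)` -/

/-- Holonomy data for a covering of `𝒥(𝒫)` with group `G`. -/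
structure Holonomy {A R B S : Type} (r : R → List (A × Bool)) (s : S → List (B × Bool)) (α : B)
    (G : Type) [Group G] where
  /-- the holonomy of the generators of `𝒫` -/
  a : A → G
  /-- the holonomy of the generators of the copies of `J` -/
  b : R → B → G
  hs : ∀ i k, wordVal (b i) (s k) = 1
  hr : ∀ i, wordVal a (r i) = b i α

section JCover

variable {G A R B S : Type} [Group G] [TopologicalSpace G] [DiscreteTopology G]
  [TopologicalSpace A] [DiscreteTopology A] [TopologicalSpace B] [DiscreteTopology B]
  [TopologicalSpace S] [DiscreteTopology S]
  {r : R → List (A × Bool)} {s : S → List (B × Bool)} {α : B} (H : Holonomy r s α G)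

/-- The preimage of the rose and of the copies of the standard complex. -/
abbrev JBase : Type := RoseCover H.a ⊕ Σ i, StdCover (H.b i) s (H.hs i)

/-- The preimages of the cores of the annuli. -/
abbrev JStrip : Type := Σ i : R, RoseCover (fun _ : Unit => H.b i α)

theorem wordVal_singleton {G B : Type} [Group G] (φ : B → G) (α : B) :
    wordVal φ [(α, true)] = φ α := by simp [wordVal, letterVal]

/-- The lower end of a strip. -/
def jLower : C(JStrip H, JBase H) :=
  ⟨fun x => Sum.inl (RoseCover.lineMap H.a (r x.1) (H.hr x.1) x.2),
    continuous_inl.comp (continuous_sigma fun i =>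
      (RoseCover.lineMap H.a (r i) (H.hr i)).continuous)⟩

/-- The upper end of a strip. -/
def jUpper : C(JStrip H, JBase H) :=
  ⟨fun x => Sum.inr ⟨x.1, StdCover.ofRose _ s (H.hs x.1)
    (RoseCover.lineMap (H.b x.1) [(α, true)] (wordVal_singleton _ _) x.2)⟩,
    continuous_inr.comp (continuous_sigma fun i => continuous_sigmaMk.comp
      ((StdCover.ofRose _ s (H.hs i)).comp
        (RoseCover.lineMap (H.b i) [(α, true)] (wordVal_singleton _ _))).continuous)⟩

/-- The ends of the strips. -/
def jAttach : C(JStrip H × Bool, JBase H) where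
  toFun x := if x.2 then jUpper H x.1 else jLower H x.1
  continuous_toFun := continuous_prod_of_discrete_right.2 fun b => by
    cases b
    exacts [(jLower H).continuous, (jUpper H).continuous]

/-- The covering of `𝒥(𝒫)`. -/
abbrev JCover : Type := Adj (Collar.interval.prod (JStrip H)) (jAttach H)

namespace JCover

/-- The inclusion of the covering of the rose. -/
def ofRose : C(RoseCover H.a, JCover H) := (Adj.inl _ _).comp ⟨Sum.inl, continuous_inl⟩

/-- The inclusion of the covering of the copy with index `i`. -/
def ofCopy (i : R) : C(StdCover (H.b i) s (H.hs i), JCover H) :=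
  (Adj.inl _ _).comp ⟨fun x => Sum.inr ⟨i, x⟩, continuous_inr.comp continuous_sigmaMk⟩

/-- The strips. -/
def strip : C(JStrip H × I, JCover H) := Adj.inr _ _

theorem strip_zero (x : JStrip H) : strip H (x, 0) = Adj.inl _ _ (jLower H x) :=
  Adj.glue (c := Collar.interval.prod (JStrip H)) (f := jAttach H) (x, false)

theorem strip_one (x : JStrip H) : strip H (x, 1) = Adj.inl _ _ (jUpper H x) :=
  Adj.glue (c := Collar.interval.prod (JStrip H)) (f := jAttach H) (x, true)

variable {H} in
theorem ind {motive : JCover H → Prop} (hr : ∀ x, motive (ofRose H x))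
    (hc : ∀ i x, motive (ofCopy H i x)) (hs : ∀ x u, motive (strip H (x, u)))
    (x : JCover H) : motive x := by
  refine Adj.ind ?_ (fun ⟨x, u⟩ => hs x u) x
  rintro (x | ⟨i, x⟩)
  exacts [hr x, hc i x]

/-- The translation action on the strips. -/
def actStrip (h : G) : C(JStrip H, JStrip H) :=
  ⟨fun x => ⟨x.1, RoseCover.act _ h x.2⟩, continuous_sigma fun i =>
    continuous_sigmaMk.comp (RoseCover.act (fun _ : Unit => H.b i α) h).continuous⟩

/-- The translation action on the base. -/
def actBase (h : G) : C(JBase H, JBase H) :=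
  ⟨Sum.map (RoseCover.act _ h) fun x => ⟨x.1, StdCover.act _ s (H.hs x.1) h x.2⟩,
    (RoseCover.act H.a h).continuous.sumMap (continuous_sigma fun i =>
      continuous_sigmaMk.comp (StdCover.act _ s (H.hs i) h).continuous)⟩

/-- The translation action. -/
def act (h : G) : C(JCover H, JCover H) :=
  Adj.map (actBase H h) ⟨fun x => (actStrip H h x.1, x.2), by fun_prop⟩
    (fun d => (actStrip H h d.1, d.2)) (fun d => rfl) fun d => by
      obtain ⟨⟨i, x⟩, b⟩ := d
      cases b
      · exact congrArg Sum.inl (RoseCover.act_lineMap _ _ (H.hr i) h x)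
      · exact congrArg (fun y => (Sum.inr ⟨i, StdCover.ofRose _ s (H.hs i) y⟩ : JBase H))
          (RoseCover.act_lineMap _ _ (wordVal_singleton _ _) h x)

@[simp] theorem act_ofRose (h : G) (x : RoseCover H.a) :
    act H h (ofRose H x) = ofRose H (RoseCover.act _ h x) := rfl

@[simp] theorem act_ofCopy (h : G) (i : R) (x : StdCover (H.b i) s (H.hs i)) :
    act H h (ofCopy H i x) = ofCopy H i (StdCover.act _ s (H.hs i) h x) := rfl

@[simp] theorem act_strip (h : G) (x : JStrip H) (u : I) :
    act H h (strip H (x, u)) = strip H (⟨x.1, RoseCover.act _ h x.2⟩, u) := rfl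

theorem act_one (x : JCover H) : act H 1 x = x := by
  induction x using ind <;> simp [RoseCover.act_one, StdCover.act_one]

theorem act_mul (g h : G) (x : JCover H) : act H (g * h) x = act H g (act H h x) := by
  induction x using ind <;> simp [RoseCover.act_mul, StdCover.act_mul]

omit [TopologicalSpace G] [DiscreteTopology G] in
theorem wandering_sigma {ι : Type} {Z : ι → Type} [∀ i, TopologicalSpace (Z i)]
    {a : ∀ i, G → Z i → Z i} (h : ∀ i, Wandering (a i)) :
    Wandering fun g (x : Σ i, Z i) => (⟨x.1, a x.1 g x.2⟩ : Σ i, Z i) := by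
  rintro ⟨i, z⟩
  obtain ⟨U, hU, hz, hg⟩ := h i z
  refine ⟨Sigma.mk i '' U, isOpenMap_sigmaMk _ hU, ⟨z, hz, rfl⟩, ?_⟩
  rintro g _ ⟨x, hx, rfl⟩ ⟨y, hy, e⟩
  obtain rfl : y = a i g x := by simpa using e
  exact hg g x hx hy

omit [TopologicalSpace G] [DiscreteTopology G] in
theorem wandering_sum {Z W : Type} [TopologicalSpace Z] [TopologicalSpace W]
    {a : G → Z → Z} {b : G → W → W} (ha : Wandering a) (hb : Wandering b) :
    Wandering fun g => Sum.map (a g) (b g) := by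
  rintro (z | z)
  · obtain ⟨U, hU, hz, hg⟩ := ha z
    refine ⟨Sum.inl '' U, isOpenMap_inl _ hU, ⟨z, hz, rfl⟩, ?_⟩
    rintro g _ ⟨x, hx, rfl⟩ ⟨y, hy, e⟩
    obtain rfl : y = a g x := by simpa using e
    exact hg g x hx hy
  · obtain ⟨U, hU, hz, hg⟩ := hb z
    refine ⟨Sum.inr '' U, isOpenMap_inr _ hU, ⟨z, hz, rfl⟩, ?_⟩
    rintro g _ ⟨x, hx, rfl⟩ ⟨y, hy, e⟩
    obtain rfl : y = b g x := by simpa using e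
    exact hg g x hx hy

theorem wandering : Wandering fun g x => act H g x := by
  refine Adj.wandering (c := Collar.interval.prod (JStrip H)) (fun _ _ => rfl) _ (fun _ _ _ => rfl)
    ?_ ?_
  · exact wandering_sum (RoseCover.wandering H.a)
      (wandering_sigma fun i => StdCover.wandering (H.b i) s (H.hs i))
  · refine wandering_of_map (b := fun g x => actStrip H g x) ?_ ⟨fun x => x.1, by fun_prop⟩
      fun _ _ => rfl
    exact wandering_sigma fun i => RoseCover.wandering (fun _ : Unit => H.b i α)

/-- The projection of the covering of a circle. -/
def circleProj (c : G) : C(RoseCover (fun _ : Unit => c), Circle) :=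
  Adj.descC (.const G 1) ⟨fun x => circleParam x.2, by fun_prop⟩ fun d => by
    obtain ⟨⟨g, a⟩, _ | _⟩ := d
    exacts [circleParam_zero, circleParam_one]

/-- Over a circle every vertex is the start of an edge, so vertices need no separate case. -/
theorem RoseCover_unit_ind {c : G} {motive : RoseCover (fun _ : Unit => c) → Prop}
    (he : ∀ g t, motive (RoseCover.edgePt _ ((g, ()), t))) (x : RoseCover (fun _ : Unit => c)) :
    motive x := by
  induction x using RoseCover.ind with
  | hv g => rw [← RoseCover.edgePt_zero _ g ()]; exact he g 0
  | he g a t => exact he g t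

/-- The covering map. -/
def proj : C(JCover H, JComplex r s α) :=
  Adj.descC
    ⟨Sum.elim (fun x => JComplex.ofRose r s α (RoseCover.proj H.a x))
      fun x => JComplex.ofCopy r s α x.1 (StdCover.proj _ s (H.hs x.1) x.2),
      Continuous.sumElim (by fun_prop) (continuous_sigma fun i =>
        ((JComplex.ofCopy r s α i).comp (StdCover.proj _ s (H.hs i))).continuous)⟩
    ⟨fun x => Quot.mk _ (Sum.inr (Sum.inr ⟨x.1.1, (circleProj _ x.1.2, x.2)⟩)),
      continuous_quot_mk.comp (continuous_inr.comp (continuous_inr.comp (by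
        have h : Continuous fun x : JStrip H => (⟨x.1, circleProj _ x.2⟩ : Σ _ : R, Circle) :=
          continuous_sigma fun i => continuous_sigmaMk.comp (circleProj (H.b i α)).continuous
        have h2 : Continuous fun x : (Σ _ : R, Circle) × I =>
            (⟨x.1.1, (x.1.2, x.2)⟩ : Σ _ : R, Circle × I) := by
          rw [← Homeomorph.sigmaProdDistrib.symm.comp_continuous_iff']
          refine continuous_sigma fun i => ?_
          have h3 : Continuous fun x : Circle × I => (⟨i, x⟩ : Σ _ : R, Circle × I) :=
            @continuous_sigmaMk R (fun _ => Circle × I) _ i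
          exact h3
        exact h2.comp (h.prodMap continuous_id))))⟩
    fun d => by
      obtain ⟨⟨i, x⟩, b⟩ := d
      induction x using RoseCover_unit_ind with
      | he g t =>
        cases b
        · refine (Quot.sound (.rose i t)).trans ?_
          simp [jAttach, jLower, RoseCover.proj_liftLoop]
          rfl
        · refine (Quot.sound (.copy i t)).trans ?_
          rfl

@[simp] theorem proj_ofRose (x : RoseCover H.a) :
    proj H (ofRose H x) = JComplex.ofRose r s α (RoseCover.proj H.a x) := rfl

@[simp] theorem proj_ofCopy (i : R) (x : StdCover (H.b i) s (H.hs i)) :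
    proj H (ofCopy H i x) = JComplex.ofCopy r s α i (StdCover.proj _ s (H.hs i) x) := rfl

@[simp] theorem circleProj_act (c : G) (g : G) (x : RoseCover (fun _ : Unit => c)) :
    circleProj c (RoseCover.act _ g x) = circleProj c x := by
  induction x using RoseCover_unit_ind with
  | he h t => rfl

@[simp] theorem proj_act (g : G) (x : JCover H) : proj H (act H g x) = proj H x := by
  induction x using ind with
  | hr x => simp
  | hc i x => simp
  | hs x u =>
    exact congrArg (fun z => (Quot.mk _ (Sum.inr (Sum.inr ⟨x.1, (z, u)⟩)) : JComplex r s α))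
      (circleProj_act _ g x.2)

/-- The edge of a strip over which a point of the annulus lies. -/
def stripEdge (i : R) (g : G) (t : I) : JStrip H := ⟨i, RoseCover.edgePt _ ((g, ()), t)⟩

omit [TopologicalSpace A] [DiscreteTopology A] [TopologicalSpace B] [DiscreteTopology B]
  [TopologicalSpace S] [DiscreteTopology S] in
theorem continuous_stripEdge (i : R) (g : G) : Continuous (stripEdge H i g) :=
  (@continuous_sigmaMk R (fun i => RoseCover (fun _ : Unit => H.b i α)) _ i).comp (by fun_prop)

/-- On an annulus, openness is tested after pulling back to the square, which is a quotient map by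
compactness and lifts to the strip in the sheet of `1`. -/
theorem isQuotientMap_proj : Topology.IsQuotientMap (proj H) := by
  refine isQuotientMap_of_isOpen _ ?_ fun U h => ?_
  · rintro ⟨x | ⟨i, x⟩ | ⟨i, z, u⟩⟩
    · obtain ⟨x, rfl⟩ := (RoseCover.isQuotientMap_proj H.a).surjective x
      exact ⟨ofRose H x, rfl⟩
    · obtain ⟨x, rfl⟩ := (StdCover.isQuotientMap_proj (H.b i) s (H.hs i)).surjective x
      exact ⟨ofCopy H i x, rfl⟩
    · obtain ⟨t, rfl⟩ := surjective_circleParam z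
      exact ⟨strip H (stripEdge H i 1 t, u), rfl⟩
  · refine isQuotientMap_quot_mk.isOpen_preimage.1
      (isOpen_sum_iff.2 ⟨?_, isOpen_sum_iff.2 ⟨?_, ?_⟩⟩)
    · rw [← (RoseCover.isQuotientMap_proj H.a).isOpen_preimage]
      exact h.preimage (ofRose H).continuous
    · refine isOpen_sigma_iff.2 fun i => ?_
      rw [← (StdCover.isQuotientMap_proj (H.b i) s (H.hs i)).isOpen_preimage]
      exact h.preimage (ofCopy H i).continuous
    · refine isOpen_sigma_iff.2 fun i => ?_
      have hq : Topology.IsQuotientMap (Prod.map circleParam (id : I → I)) :=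
        (circleParam.continuous.prodMap continuous_id).isClosedMap.isQuotientMap
          (circleParam.continuous.prodMap continuous_id)
          (surjective_circleParam.prodMap Function.surjective_id)
      rw [← hq.isOpen_preimage]
      exact h.preimage (f := fun x : I × I => strip H (stripEdge H i 1 x.1, x.2))
        ((strip H).continuous.comp
          (((continuous_stripEdge H i 1).comp continuous_fst).prodMk continuous_snd))

/-- Going once around the annulus translates by the holonomy of `α`, so the orbit depends only on
the point of the annulus. -/
theorem strip_orbit (i : R) (u : I) :
    (Quot.mk _ (strip H (stripEdge H i 1 0, u)) : Orb (fun g x => act H g x)) =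
      Quot.mk _ (strip H (stripEdge H i 1 1, u)) := by
  refine Quot.sound ⟨H.b i α, ?_⟩
  simp [stripEdge, RoseCover.edgePt_zero, RoseCover.edgePt_one]

theorem strip_orbit_eq (i : R) (u : I) {t t' : I} (h : circleParam t = circleParam t') :
    (Quot.mk _ (strip H (stripEdge H i 1 t, u)) : Orb (fun g x => act H g x)) =
      Quot.mk _ (strip H (stripEdge H i 1 t', u)) :=
  eq_of_circleParam_eq (fun t => (Quot.mk _ (strip H (stripEdge H i 1 t, u)) :
    Orb (fun g x => act H g x))) (strip_orbit H i u) h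

/-- The point of `𝒥(𝒫)` as an orbit. -/
def orb : JComplex r s α → Orb (fun g x => act H g x) :=
  Quot.lift (Sum.elim (fun x => Orb.map (ofRose H) (fun _ _ => rfl) (RoseCover.orb H.a x))
    (Sum.elim (fun x => Orb.map (ofCopy H x.1) (fun _ _ => rfl)
        (StdCover.orb (H.b x.1) s (H.hs x.1) x.2))
      fun x => Quot.mk _ (strip H (stripEdge H x.1 1 (surjective_circleParam x.2.1).choose, x.2.2))))
    (by
      rintro _ _ (⟨i, t⟩ | ⟨i, t⟩)
      · refine (strip_orbit_eq H i 0 (surjective_circleParam (circleParam t)).choose_spec).trans ?_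
        change _ = Orb.map (ofRose H) (fun _ _ => rfl) (RoseCover.orb H.a (Rose.loop (r i) t))
        rw [strip_zero, ← RoseCover.proj_liftLoop H.a 1, RoseCover.orb_proj]
        rfl
      · refine (strip_orbit_eq H i 1 (surjective_circleParam (circleParam t)).choose_spec).trans ?_
        change _ = Orb.map (ofCopy H i) (fun _ _ => rfl) (StdCover.orb (H.b i) s (H.hs i)
          (StdComplex.edge s α t))
        rw [strip_one]
        have : StdComplex.edge s α t = StdCover.proj (H.b i) s (H.hs i)
          (StdCover.ofRose _ s (H.hs i) (RoseCover.edgePt _ ((1, α), t))) := rfl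
        rw [this, StdCover.orb_proj]
        rfl)

theorem orb_proj (x : JCover H) : orb H (proj H x) = Quot.mk _ x := by
  induction x using ind with
  | hr x => exact congrArg (Orb.map (b := fun g x => act H g x) (ofRose H) (fun _ _ => rfl)) (RoseCover.orb_proj H.a x)
  | hc i x =>
    exact congrArg (Orb.map (b := fun g x => act H g x) (ofCopy H i) (fun _ _ => rfl))
      (StdCover.orb_proj (H.b i) s (H.hs i) x)
  | hs x u =>
    obtain ⟨i, x⟩ := x
    induction x using RoseCover_unit_ind with
    | he g t =>
      refine (strip_orbit_eq H i u (surjective_circleParam (circleParam t)).choose_spec).trans ?_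
      exact Quot.sound ⟨g, by simp [stripEdge]⟩

instance : MulAction G (JCover H) where
  smul g x := act H g x
  one_smul := act_one H
  mul_smul := act_mul H

/-- Fibres are orbits by `orb_proj` and `proj_act`; `wandering` supplies the neighbourhoods disjoint
from their translates. -/
theorem isQuotientCoveringMap_proj : IsQuotientCoveringMap (proj H) G where
  toIsQuotientMap := isQuotientMap_proj H
  continuous_const_smul g := (act H g).continuous
  apply_eq_iff_mem_orbit {x y} := by
    constructor
    · intro h
      obtain ⟨g, hg⟩ := Orb.exact (act_one H) (act_mul H) (x := y) (y := x)
        (by rw [← orb_proj, ← orb_proj, h])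
      exact ⟨g, hg⟩
    · rintro ⟨g, rfl⟩
      exact proj_act H g y
  disjoint x := by
    obtain ⟨U, hU, hx, hg⟩ := wandering H x
    refine ⟨U, hU.mem_nhds hx, ?_⟩
    rintro g ⟨_, ⟨y, hy, rfl⟩, h⟩
    exact hg g y hy h

end JCover

end JCover

/-! ### Classes of loops -/

section Pi1

variable {Y : Type} [TopologicalSpace Y] {y₀ : Y}

/-- An element of the fundamental group as a homotopy class of loops. -/
def Pi1.cls (x : Pi1 Y y₀) : Path.Homotopic.Quotient y₀ y₀ := FundamentalGroup.toPath x.unop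

@[simp] theorem Pi1.cls_mk (γ : Path y₀ y₀) : (Pi1.mk γ).cls = .mk γ := rfl

@[simp] theorem Pi1.cls_one : (1 : Pi1 Y y₀).cls = .refl y₀ := rfl

@[simp] theorem Pi1.cls_mul (x x' : Pi1 Y y₀) : (x * x').cls = x.cls.trans x'.cls := rfl

@[simp] theorem Pi1.cls_inv (x : Pi1 Y y₀) : (x⁻¹).cls = x.cls.symm := rfl

theorem Pi1.cls_injective : Function.Injective (Pi1.cls : Pi1 Y y₀ → _) := fun _ _ h =>
  MulOpposite.unop_injective h

theorem Pi1.exists_mk (x : Pi1 Y y₀) : ∃ γ, x = Pi1.mk γ := by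
  obtain ⟨γ, h⟩ := Path.Homotopic.Quotient.mk_surjective x.cls
  exact ⟨γ, Pi1.cls_injective h.symm⟩

theorem Pi1.mk_eq_one {γ : Path y₀ y₀} (h : γ.Homotopic (.refl y₀)) : Pi1.mk γ = 1 := by
  apply Pi1.cls_injective
  rw [Pi1.cls_mk, Path.Homotopic.Quotient.eq.2 h]
  rfl

/-- The class of the image of an edge loop. -/
theorem cls_wordVal {A : Type} (F : C(Rose A, Y)) {y₁ : Y} (τ : Path.Homotopic.Quotient y₀ y₁)
    (x : A → Pi1 Y y₀) (ε : A → Path y₁ y₁) (hε : ∀ a t, ε a t = F (Rose.edge a t))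
    (hx : ∀ a, (x a).cls.trans τ = τ.trans (.mk (ε a))) (w : List (A × Bool)) (γ : Path y₁ y₁)
    (hγ : ∀ t, γ t = F (Rose.loop w t)) : (wordVal x w).cls.trans τ = τ.trans (.mk γ) := by
  obtain rfl : F (Rose.vertex A) = y₁ := by
    rw [← γ.source, hγ, (Rose.loop w).source]
  have hl : ∀ a, (letterVal x a).cls.trans τ = τ.trans (.mk ((Rose.letter a).map F.continuous)) := by
    rintro ⟨a, _ | _⟩
    · have e : (Rose.letter (a, false)).map F.continuous = (ε a).symm := by
        ext t; exact (hε a _).symm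
      rw [e, Path.Homotopic.Quotient.mk_symm]
      calc _ = ((x a).cls.symm.trans ((τ.trans (.mk (ε a))).trans
            (Path.Homotopic.Quotient.mk (ε a)).symm)) := by simp [letterVal]
        _ = _ := by
          rw [← hx, Path.Homotopic.Quotient.trans_assoc, ← Path.Homotopic.Quotient.trans_assoc]
          simp
    · have e : (Rose.letter (a, true)).map F.continuous = ε a := by
        ext t; exact (hε a _).symm
      rw [e, ← hx]
      rfl
  obtain rfl : (Rose.loop w).map F.continuous = γ := by
    ext t; exact (hγ t).symm
  clear hγ
  induction w using List.twoStepInduction with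
  | nil =>
    have : (Rose.loop ([] : List (A × Bool))).map F.continuous = .refl _ := rfl
    rw [this]
    simp [wordVal]
  | singleton a => simpa [wordVal, Rose.loop] using hl a
  | cons_cons a b w _ ih =>
    have : wordVal x (a :: b :: w) = letterVal x a * wordVal x (b :: w) := by simp [wordVal]
    rw [this, Pi1.cls_mul, Path.Homotopic.Quotient.trans_assoc, ih b, ←
      Path.Homotopic.Quotient.trans_assoc, hl]
    simp [Rose.loop, Path.map_trans]

end Pi1

/-! ### Transport over the covers -/

section Transport

variable {Y : Type} [TopologicalSpace Y] {y₀ : Y}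

theorem isTransport_sigma {ι : Type} {Z : ι → Type} [∀ i, TopologicalSpace (Z i)]
    {p : C(Σ i, Z i, Y)} {q : (Σ i, Z i) → Based y₀}
    (h : ∀ i, IsTransport (p.comp (ContinuousMap.sigmaMk i)) fun z => q ⟨i, z⟩) :
    IsTransport p q := by
  intro δ
  obtain ⟨i, δ', rfl⟩ := δ.exists_lift_sigma
  exact h i δ'

/-- The interval is connected, so a path stays in one summand. -/
theorem isTransport_sum {Z W : Type} [TopologicalSpace Z] [TopologicalSpace W]
    {p : C(Z ⊕ W, Y)} {q : Z ⊕ W → Based y₀}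
    (h : IsTransport (p.comp ⟨Sum.inl, continuous_inl⟩) (q ∘ Sum.inl))
    (h' : IsTransport (p.comp ⟨Sum.inr, continuous_inr⟩) (q ∘ Sum.inr)) : IsTransport p q := by
  intro δ
  obtain h0 | h0 := isClopen_iff.1 ((isClopen_range_inl (X := Z) (Y := W)).preimage δ.continuous)
  · have : ∀ t, ∃ w, Sum.inr w = δ t := fun t => by
      rcases e : δ t with z | w
      · exact (h0.subset (show t ∈ δ ⁻¹' range Sum.inl from ⟨z, e.symm⟩)).elim
      · exact ⟨w, rfl⟩
    choose δ' hδ using this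
    have hc : Continuous δ' := Topology.IsEmbedding.inr.continuous_iff.2 (by
      convert δ.continuous using 1
      exact funext hδ)
    obtain rfl : (⟨Sum.inr, continuous_inr⟩ : C(W, Z ⊕ W)).comp ⟨δ', hc⟩ = δ := by
      ext t; exact hδ t
    exact h' ⟨δ', hc⟩
  · have : ∀ t, ∃ z, Sum.inl z = δ t := fun t => h0.superset (mem_univ t)
    choose δ' hδ using this
    have hc : Continuous δ' := Topology.IsEmbedding.inl.continuous_iff.2 (by
      convert δ.continuous using 1
      exact funext hδ)
    obtain rfl : (⟨Sum.inl, continuous_inl⟩ : C(Z, Z ⊕ W)).comp ⟨δ', hc⟩ = δ := by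
      ext t; exact hδ t
    exact h ⟨δ', hc⟩

variable {G A B S : Type} [Group G] [TopologicalSpace G] [DiscreteTopology G]
  [TopologicalSpace A] [DiscreteTopology A] [TopologicalSpace B] [DiscreteTopology B]
  [TopologicalSpace S] [DiscreteTopology S]

theorem exists_isTransport_prod_interval {Z : Type} [TopologicalSpace Z]
    (p : C(Z × I, Y)) (q₀ : Z → Based y₀)
    (hq : IsTransport (p.comp ⟨fun z => (z, 0), by fun_prop⟩) q₀) :
    ∃ q : Z × I → Based y₀, IsTransport p q ∧ ∀ z, q (z, 0) = q₀ z :=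
  exists_isTransport_prod 0 ⟨fun x => x.1 * x.2, by fun_prop⟩ (by simp) (by simp) (by simp) p q₀ hq

/-- Transport along an edge from its start is forced; `h` says that it arrives at the prescribed
class. -/
theorem RoseCover.exists_isTransport (φ : A → G) (P : C(RoseCover φ, Y)) (q₀ : G → Based y₀)
    (h₀ : ∀ g, (q₀ g).1 = P (vertex φ g))
    (h : ∀ g a, Follows (q₀ g) (P.comp (edge φ g a)) (q₀ (g * φ a))) :
    ∃ q : RoseCover φ → Based y₀, IsTransport P q ∧ ∀ g, q (vertex φ g) = q₀ g := by
  obtain ⟨q, hq, hq0⟩ := exists_isTransport_prod_interval (P.comp (edgePt φ)) (fun x => q₀ x.1)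
    (isTransport_of_discrete fun x => by
      rw [h₀, ← edgePt_zero φ x.1 x.2]
      rfl)
  have hq1 : ∀ g a, q ((g, a), 1) = q₀ (g * φ a) := by
    intro g a
    have h1 := hq ⟨fun t => ((g, a), t), by fun_prop⟩
    simp only [ContinuousMap.coe_mk, hq0] at h1
    exact h1.unique (h g a)
  have hg : ∀ d, q ((Collar.interval.prod (G × A)).i d) = q₀ (roseAttach φ d) := by
    rintro ⟨⟨g, a⟩, _ | _⟩
    exacts [hq0 _, hq1 g a]
  refine ⟨Adj.desc q₀ q hg, Adj.isTransport ?_ hq, fun g => rfl⟩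
  exact isTransport_of_discrete h₀

/-- Discs impose no condition: contract each one linearly to the boundary point `1`. On the boundary
circle the result agrees with the given transport, because both are transports and they agree at
`1`. -/
theorem StdCover.exists_isTransport (φ : B → G) (s : S → List (B × Bool))
    (hs : ∀ k, wordVal φ (s k) = 1) (P : C(StdCover φ s hs, Y)) (q₀ : RoseCover φ → Based y₀)
    (h : IsTransport (P.comp (ofRose φ s hs)) q₀) :
    ∃ q : StdCover φ s hs → Based y₀, IsTransport P q ∧ ∀ x, q (ofRose φ s hs x) = q₀ x := by
  have hP : ∀ d, P.comp (discPt φ s hs) (d.1, Collar.disc.i d.2) =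
      P.comp (ofRose φ s hs) (discAttach φ s hs d) := fun d =>
    congrArg P (Adj.glue (c := Collar.disc.prod (G × S)) (f := discAttach φ s hs) d)
  obtain ⟨q, hq, hq0⟩ := exists_isTransport_prod (Collar.disc.i 1 : Disc)
    ⟨fun x => ⟨(x.2 : ℝ) • (x.1 : ℂ) + (1 - x.2 : ℝ) • 1, by
        refine (convex_closedBall (0 : ℂ) 1) x.1.2 ?_ x.2.2.1 (by linarith [x.2.2.2]) (by ring)
        simp⟩, by fun_prop⟩
    (fun m => Subtype.ext (by simp [Collar.disc])) (fun m => Subtype.ext (by simp))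
    (fun t => Subtype.ext (by simp [Collar.disc])) (P.comp (discPt φ s hs))
    (fun x => q₀ (discAttach φ s hs (x, 1))) (isTransport_of_discrete fun x => by
      rw [h.fst]
      exact (hP (x, 1)).symm)
  have hg : ∀ d, q ((Collar.disc.prod (G × S)).i d) = q₀ (discAttach φ s hs d) := by
    rintro ⟨x, z⟩
    obtain ⟨t, rfl⟩ := surjective_circleParam z
    have h1 := hq.comp (⟨fun t => (x, Collar.disc.i (circleParam t)), by fun_prop⟩ :
      C(I, (G × S) × Disc))
    have h2 := h.comp (⟨fun t => discAttach φ s hs (x, circleParam t), by fun_prop⟩ :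
      C(I, RoseCover φ))
    have e : (P.comp (discPt φ s hs)).comp (⟨fun t => (x, Collar.disc.i (circleParam t)),
        by fun_prop⟩ : C(I, (G × S) × Disc)) = (P.comp (ofRose φ s hs)).comp
        (⟨fun t => discAttach φ s hs (x, circleParam t), by fun_prop⟩ : C(I, RoseCover φ)) := by
      ext t
      exact hP (x, circleParam t)
    rw [e] at h1
    refine h1.eq_of_joined h2 (z := 0) ?_ (PathConnectedSpace.somePath 0 t)
    simp only [Function.comp_apply, ContinuousMap.coe_mk, circleParam_zero, hq0]
  exact ⟨Adj.desc q₀ q hg, Adj.isTransport h hq, fun x => rfl⟩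

variable {R : Type} {r : R → List (A × Bool)} {s : S → List (B × Bool)} {α : B}

/-- Transport spreads over a strip from its lower end. At the upper end it need only match at the
vertices, since every point of the line is joined to one. -/
theorem JCover.exists_isTransport (H : Holonomy r s α G) (P : C(JCover H, Y))
    (q₀ : JBase H → Based y₀) (h : IsTransport (P.comp (Adj.inl _ _)) q₀)
    (hv : ∀ i g, Follows (q₀ (jLower H ⟨i, RoseCover.vertex _ g⟩))
      (P.comp ((strip H).comp ⟨fun u => (⟨i, RoseCover.vertex _ g⟩, u), by fun_prop⟩))
      (q₀ (jUpper H ⟨i, RoseCover.vertex _ g⟩))) :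
    ∃ q : JCover H → Based y₀, IsTransport P q ∧ ∀ x, q (Adj.inl _ _ x) = q₀ x := by
  obtain ⟨q, hq, hq0⟩ := exists_isTransport_prod_interval (P.comp (strip H))
    (fun x => q₀ (jLower H x)) (by
      have e : (P.comp (strip H)).comp ⟨fun z => (z, 0), by fun_prop⟩ =
          (P.comp (Adj.inl _ _)).comp (jLower H) := by
        ext x
        exact congrArg P (strip_zero H x)
      rw [e]
      exact h.comp _)
  have h1 : ∀ x, q (x, 1) = q₀ (jUpper H x) := by
    have t1 := hq.comp (⟨fun x => (x, 1), by fun_prop⟩ : C(JStrip H, JStrip H × I))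
    have t2 := h.comp (jUpper H)
    have e : (P.comp (strip H)).comp (⟨fun x => (x, 1), by fun_prop⟩ : C(JStrip H, JStrip H × I)) =
        (P.comp (Adj.inl _ _)).comp (jUpper H) := by
      ext x
      exact congrArg P (strip_one H x)
    rw [e] at t1
    rintro ⟨i, x⟩
    induction x using RoseCover_unit_ind with
    | he g t =>
      refine t1.eq_of_joined t2 (z := ⟨i, RoseCover.vertex _ g⟩) ?_
        (((PathConnectedSpace.somePath 0 t).map (continuous_stripEdge H i g)).cast ?_ rfl)
      · have h3 := hq ⟨fun u => (⟨i, RoseCover.vertex _ g⟩, u), by fun_prop⟩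
        simp only [ContinuousMap.coe_mk, hq0] at h3
        exact h3.unique (hv i g)
      · simp [stripEdge, RoseCover.edgePt_zero]
  have hg : ∀ d, q ((Collar.interval.prod (JStrip H)).i d) = q₀ (jAttach H d) := by
    rintro ⟨x, _ | _⟩
    exacts [hq0 x, h1 x]
  exact ⟨Adj.desc q₀ q hg, Adj.isTransport h hq, fun x => rfl⟩

/-- A homomorphism from the group of a cover of `𝒥(𝒫)` to `𝒥_G` that is compatible with the
holonomy defines transport on the cover. -/
theorem JCover.exists_isTransport_proj (H : Holonomy r s α G) (ψ : G →* JGroup r s α)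
    (ha : ∀ a, ψ (H.a a) = Pi1.mk (JComplex.genLoop r s α a))
    (hb : ∀ i b, ψ (H.b i b) = Pi1.mk (JComplex.copyLoop r s α i b)) :
    ∃ q : JCover H → Based (JComplex.vertex r s α), IsTransport (proj H) q ∧
      (∀ g, q (ofRose H (RoseCover.vertex _ g)) = ⟨_, (ψ g).cls⟩) ∧
      ∀ i g, q (ofCopy H i (StdCover.ofRose _ _ (H.hs i) (RoseCover.vertex _ g))) =
        ⟨_, (ψ g).cls.trans (.mk (JComplex.tail r s α i))⟩ := by
  obtain ⟨qa, hqa, hqa0⟩ := RoseCover.exists_isTransport H.a ((proj H).comp (ofRose H))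
    (fun g => ⟨JComplex.vertex r s α, (ψ g).cls⟩) (fun g => rfl) (fun g a => by
      refine (follows_path_iff (JComplex.genLoop r s α a)).2 ⟨_, rfl, ?_⟩
      rw [map_mul, ha]
      rfl)
  have hc : ∀ i, ∃ q : StdCover (H.b i) s (H.hs i) → Based (JComplex.vertex r s α),
      IsTransport ((proj H).comp (ofCopy H i)) q ∧
      ∀ g, q (StdCover.ofRose _ _ (H.hs i) (RoseCover.vertex _ g)) =
        ⟨_, (ψ g).cls.trans (.mk (JComplex.tail r s α i))⟩ := by
    intro i
    obtain ⟨q, hq, hq0⟩ := RoseCover.exists_isTransport (H.b i)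
      (((proj H).comp (ofCopy H i)).comp (StdCover.ofRose _ _ (H.hs i)))
      (fun g => ⟨_, (ψ g).cls.trans (.mk (JComplex.tail r s α i))⟩) (fun g => rfl) (fun g b => by
        refine (follows_path_iff ((StdComplex.edge s b).map
          (JComplex.ofCopy r s α i).continuous)).2 ⟨_, rfl, ?_⟩
        rw [map_mul, hb]
        simp [JComplex.copyLoop])
    obtain ⟨q', hq', hq0'⟩ := StdCover.exists_isTransport (H.b i) s (H.hs i)
      ((proj H).comp (ofCopy H i)) q hq
    exact ⟨q', hq', fun g => (hq0' _).trans (hq0 g)⟩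
  choose qc hqc hqc0 using hc
  obtain ⟨q, hq, hq0⟩ := JCover.exists_isTransport H (proj H)
    (Sum.elim qa fun x => qc x.1 x.2) (isTransport_sum hqa (isTransport_sigma hqc)) (fun i g => by
      change Follows (qa (RoseCover.vertex _ g)) _
        (qc i (StdCover.ofRose _ _ (H.hs i) (RoseCover.vertex _ g)))
      rw [hqa0, hqc0]
      exact (follows_path_iff (JComplex.tail r s α i)).2 ⟨_, rfl, rfl⟩)
  exact ⟨q, hq, fun g => (hq0 _).trans (hqa0 g), fun i g => (hq0 _).trans (hqc0 i g)⟩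

end Transport

/-! ### The fundamental group of `𝒥(𝒫)` -/

section Presentation

variable {A R B S : Type} (r : R → List (A × Bool)) (s : S → List (B × Bool)) (α : B)

/-- The relators of the presentation of `𝒥_G`. -/
def jRels : Set (FreeGroup (A ⊕ R × B)) :=
  (range fun x : R × S => FreeGroup.map (fun b => Sum.inr (x.1, b)) (FreeGroup.mk (s x.2))) ∪
    range fun i : R => FreeGroup.map Sum.inl (FreeGroup.mk (r i)) *
      (FreeGroup.of (Sum.inr (i, α)))⁻¹

/-- The group presented by the generators of `𝒫`, the generators of the copies of `J`, the relators
of the copies of `J`, and the relations `rᵢ = αᵢ`. -/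
def JPres : Type := PresentedGroup (jRels r s α)

instance : Group (JPres r s α) := inferInstanceAs (Group (PresentedGroup (jRels r s α)))

instance : TopologicalSpace (JPres r s α) := ⊥

instance : DiscreteTopology (JPres r s α) := ⟨rfl⟩

/-- The generators of `𝒫`. -/
def JPres.gen (a : A) : JPres r s α := PresentedGroup.of (Sum.inl a)

/-- The generators of the copies of `J`. -/
def JPres.copy (i : R) (b : B) : JPres r s α := PresentedGroup.of (Sum.inr (i, b))

variable {r s α}

theorem JPres.hom_ext {K : Type*} [Monoid K] {f g : JPres r s α →* K}
    (ha : ∀ a, f (gen r s α a) = g (gen r s α a)) (hb : ∀ i b, f (copy r s α i b) = g (copy r s α i b)) :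
    f = g := by
  refine MonoidHom.eq_of_eqOn_dense (PresentedGroup.closure_range_of (jRels r s α)) ?_
  rintro _ ⟨a | ⟨i, b⟩, rfl⟩
  exacts [ha a, hb i b]

/-- Homomorphisms from the presented group. -/
def JPres.lift {K : Type} [Group K] (H : Holonomy r s α K) : JPres r s α →* K :=
  PresentedGroup.toGroup (f := Sum.elim H.a fun x : R × B => H.b x.1 x.2) (by
    rintro _ (⟨x, rfl⟩ | ⟨i, rfl⟩)
    · have : (FreeGroup.lift (Sum.elim H.a fun x : R × B => H.b x.1 x.2)).comp
          (FreeGroup.map (fun b => Sum.inr (x.1, b))) = FreeGroup.lift (H.b x.1) := by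
        ext b; simp
      exact (DFunLike.congr_fun this _).trans (by rw [← wordVal_eq, H.hs x.1 x.2])
    · have : (FreeGroup.lift (Sum.elim H.a fun x : R × B => H.b x.1 x.2)).comp
          (FreeGroup.map Sum.inl) = FreeGroup.lift H.a := by
        ext b; simp
      have h := DFunLike.congr_fun this (FreeGroup.mk (r i))
      rw [MonoidHom.comp_apply] at h
      rw [map_mul, map_inv, h, ← wordVal_eq, H.hr]
      simp)

@[simp] theorem JPres.lift_gen {K : Type} [Group K] (H : Holonomy r s α K) (a : A) :
    lift H (gen r s α a) = H.a a := PresentedGroup.toGroup.of _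

@[simp] theorem JPres.lift_copy {K : Type} [Group K] (H : Holonomy r s α K) (i : R) (b : B) :
    lift H (copy r s α i b) = H.b i b := PresentedGroup.toGroup.of _

theorem wordVal_comp {A K L : Type} [Group K] [Group L] (f : K →* L) (x : A → K)
    (w : List (A × Bool)) : wordVal (fun a => f (x a)) w = f (wordVal x w) := by
  rw [wordVal_eq, wordVal_eq]
  change _ = (f.comp (FreeGroup.lift x)) _
  congr 1
  ext a
  simp

variable (r s α) in
/-- The universal holonomy. -/
def JPres.holonomy : Holonomy r s α (JPres r s α) where
  a := gen r s α
  b := copy r s α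
  hs i k := by
    have h := PresentedGroup.one_of_mem (rels := jRels r s α) (.inl ⟨(i, k), rfl⟩)
    rw [wordVal_eq]
    refine Eq.trans ?_ h
    have : (PresentedGroup.mk (jRels r s α)).comp (FreeGroup.map fun b => Sum.inr (i, b)) =
        FreeGroup.lift (copy r s α i) := by
      ext b
      simp
      rfl
    exact (DFunLike.congr_fun this _).symm
  hr i := by
    have h := PresentedGroup.one_of_mem (rels := jRels r s α) (.inr ⟨i, rfl⟩)
    rw [map_mul, map_inv, mul_inv_eq_one] at h
    refine Eq.trans ?_ h
    rw [wordVal_eq]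
    have : (PresentedGroup.mk (jRels r s α)).comp (FreeGroup.map Sum.inl) =
        FreeGroup.lift (gen r s α) := by
      ext b
      simp
      rfl
    exact (DFunLike.congr_fun this _).symm

/-- The disc is contractible, so its boundary loop is null-homotopic there. -/
theorem homotopic_of_disc {Y : Type} [TopologicalSpace Y] (D : C(Disc, Y)) {y : Y} (γ : Path y y)
    (h : ∀ t, γ t = D (Disc.boundary t)) : γ.Homotopic (.refl y) := by
  have : ContractibleSpace Disc := (convex_closedBall (0 : ℂ) 1).contractibleSpace ⟨0, by simp⟩
  let β : Path (Disc.boundary 0) (Disc.boundary 0) :=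
    ⟨⟨fun t => Disc.boundary t, by unfold Disc.boundary; fun_prop⟩, rfl, by simp [Disc.boundary]⟩
  have hβ := (SimplyConnectedSpace.paths_homotopic β (.refl _)).map D
  have e : D (Disc.boundary 0) = y := by rw [← h, γ.source]
  subst e
  obtain rfl : β.map D.continuous = γ := by
    ext t; exact (h t).symm
  exact hβ

variable (r s α) in
/-- The edge loop of a word, in `𝒥(𝒫)`. -/
def JComplex.roseLoop (w : List (A × Bool)) :
    Path (JComplex.vertex r s α) (JComplex.vertex r s α) :=
  (Rose.loop w).map (JComplex.ofRose r s α).continuous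

variable (r s α) in
/-- The edge loop of a word, in a copy of the standard complex. -/
def JComplex.copyWord (i : R) (w : List (B × Bool)) :
    Path (JComplex.ofCopy r s α i (StdComplex.vertex s))
      (JComplex.ofCopy r s α i (StdComplex.vertex s)) :=
  (Rose.loop w).map ((JComplex.ofCopy r s α i).comp (StdComplex.ofRose s)).continuous

variable (r s α) in
theorem JGroup.wordVal_gen (w : List (A × Bool)) :
    (wordVal (fun a => Pi1.mk (JComplex.genLoop r s α a)) w).cls =
      .mk (JComplex.roseLoop r s α w) := by
  have := cls_wordVal (JComplex.ofRose r s α) (.refl (JComplex.vertex r s α))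
    (fun a => Pi1.mk (JComplex.genLoop r s α a)) (JComplex.genLoop r s α) (fun _ _ => rfl)
    (fun a => by simp) w (JComplex.roseLoop r s α w) fun _ => rfl
  simpa using this

variable (r s α) in
theorem JGroup.wordVal_copy (i : R) (w : List (B × Bool)) :
    (wordVal (fun b => Pi1.mk (JComplex.copyLoop r s α i b)) w).cls.trans
      (.mk (JComplex.tail r s α i)) = .trans (.mk (JComplex.tail r s α i))
      (.mk (JComplex.copyWord r s α i w)) := by
  refine cls_wordVal ((JComplex.ofCopy r s α i).comp (StdComplex.ofRose s)) _
    (fun b => Pi1.mk (JComplex.copyLoop r s α i b))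
    (fun b => (StdComplex.edge s b).map (JComplex.ofCopy r s α i).continuous) (fun _ _ => rfl)
    (fun b => ?_) w (JComplex.copyWord r s α i w) fun _ => rfl
  simp [JComplex.copyLoop]

/-- The annulus as a square. -/
def JComplex.square (i : R) : C(I × I, JComplex r s α) :=
  ⟨fun x => Quot.mk _ (Sum.inr (Sum.inr ⟨i, (circleParam x.1, x.2)⟩)),
    continuous_quot_mk.comp (continuous_inr.comp (continuous_inr.comp
      ((@continuous_sigmaMk R (fun _ => Circle × I) _ i).comp (by fun_prop))))⟩

variable (r s α) in
/-- The holonomy of the fundamental group. -/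
def JGroup.holonomy : Holonomy r s α (JGroup r s α) where
  a a := Pi1.mk (JComplex.genLoop r s α a)
  b i b := Pi1.mk (JComplex.copyLoop r s α i b)
  hs i k := by
    have h := JGroup.wordVal_copy r s α i (s k)
    have h2 : (JComplex.copyWord r s α i (s k)).Homotopic (.refl _) :=
      homotopic_of_disc ((JComplex.ofCopy r s α i).comp (StdComplex.disc s k)) _ fun t =>
        congrArg (JComplex.ofCopy r s α i) (Quot.sound (StdRel.attach k t)).symm
    rw [Path.Homotopic.Quotient.eq.2 h2] at h
    apply Pi1.cls_injective
    have h3 := congrArg (fun x => Path.Homotopic.Quotient.trans x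
      (Path.Homotopic.Quotient.mk (JComplex.tail r s α i)).symm) h
    simpa using h3
  hr i := by
    apply Pi1.cls_injective
    rw [JGroup.wordVal_gen, Pi1.cls_mk]
    -- Cut open along the tail, the annulus is a square with `r i` at the bottom, `α` at the top and
    -- the tail on both sides; `follows_square` then gives `r_i · tail = tail · α`.
    have hl : Follows (y₀ := JComplex.vertex r s α) ⟨_, .refl _⟩
        ((JComplex.square i).comp ⟨fun t => (0, t), by fun_prop⟩)
        ⟨_, .mk (JComplex.tail r s α i)⟩ := by
      have e : (JComplex.square i).comp ⟨fun t => (0, t), by fun_prop⟩ =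
          (JComplex.tail r s α i : C(I, JComplex r s α)) := by
        ext t
        exact congrArg (fun z => (Quot.mk _ (Sum.inr (Sum.inr ⟨i, (z, t)⟩)) : JComplex r s α))
          circleParam_zero
      rw [e]
      exact (follows_path_iff _).2 ⟨_, rfl, by simp⟩
    have hb : Follows (y₀ := JComplex.vertex r s α) ⟨_, .refl _⟩
        ((JComplex.square i).comp ⟨fun t => (t, 0), by fun_prop⟩)
        ⟨_, .mk (JComplex.roseLoop r s α (r i))⟩ := by
      have e : (JComplex.square i).comp ⟨fun t => (t, 0), by fun_prop⟩ =
          (JComplex.roseLoop r s α (r i) : C(I, JComplex r s α)) := by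
        ext t
        exact Quot.sound (JRel.rose i t)
      rw [e]
      exact (follows_path_iff (JComplex.roseLoop r s α (r i))).2
        ⟨_, rfl, by simp⟩
    have hr : Follows (y₀ := JComplex.vertex r s α)
        ⟨_, .mk (JComplex.roseLoop r s α (r i))⟩
        ((JComplex.square i).comp ⟨fun t => (1, t), by fun_prop⟩)
        ⟨_, .trans (.mk (JComplex.roseLoop r s α (r i)))
          (.mk (JComplex.tail r s α i))⟩ := by
      have e : (JComplex.square i).comp ⟨fun t => (1, t), by fun_prop⟩ =
          (JComplex.tail r s α i : C(I, JComplex r s α)) := by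
        ext t
        exact congrArg (fun z => (Quot.mk _ (Sum.inr (Sum.inr ⟨i, (z, t)⟩)) : JComplex r s α))
          circleParam_one
      rw [e]
      exact (follows_path_iff _).2 ⟨_, rfl, rfl⟩
    have ht := follows_square hl hb hr
    have e : (JComplex.square i).comp ⟨fun t => (t, 1), by fun_prop⟩ =
        ((StdComplex.edge s α).map (JComplex.ofCopy r s α i).continuous : C(I, JComplex r s α)) := by
      ext t
      exact Quot.sound (JRel.copy i t)
    rw [e] at ht
    obtain ⟨a, ha, hb⟩ := (follows_path_iff ((StdComplex.edge s α).map
      (JComplex.ofCopy r s α i).continuous)).1 ht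
    obtain rfl : Path.Homotopic.Quotient.mk (JComplex.tail r s α i) = a := by simpa using ha
    have hb' : Path.Homotopic.Quotient.trans
        (.mk (JComplex.roseLoop r s α (r i)))
          (.mk (JComplex.tail r s α i)) = .trans (.mk (JComplex.tail r s α i))
          (.mk ((StdComplex.edge s α).map (JComplex.ofCopy r s α i).continuous)) := by
      simpa using hb
    have h3 := congrArg (fun x => Path.Homotopic.Quotient.trans x
      (Path.Homotopic.Quotient.mk (JComplex.tail r s α i)).symm) hb'
    simpa [JComplex.copyLoop] using h3

end Presentation

/-! ### Monodromy as a homomorphism to the group of a covering -/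

section Deck

variable {E Y G : Type} [TopologicalSpace E] [TopologicalSpace Y] [Group G] [MulAction G E]
  {p : C(E, Y)} (hp : IsQuotientCoveringMap p G) (e : E)

/-- The homomorphism from the fundamental group to the group of a covering. -/
def deckHom : Pi1 Y (p e) →* G :=
  -- Monodromy takes `FundamentalGroup` to `Gᵐᵒᵖ`; as `Pi1` is also an opposite, the two reversals
  -- cancel.
  (MulEquiv.opOp G).symm.toMonoidHom.comp
    (MonoidHom.op (hp.fundamentalGroupToMulOpposite (⟨e, rfl⟩ : p ⁻¹' {p e})))

omit [Group G] [MulAction G E] in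
theorem map_trans_apply (p : C(E, Y)) {e e' e'' : E} (γ : Path e e') (δ : Path e' e'')
    {y y' y'' : Y} (γ' : Path y y') (δ' : Path y' y'') (h : ∀ t, p (γ t) = γ' t)
    (h' : ∀ t, p (δ t) = δ' t) (t : I) : p (γ.trans δ t) = γ'.trans δ' t := by
  simp only [Path.trans_apply]
  split_ifs
  exacts [h _, h' _]

theorem deckHom_mk {γ : Path (p e) (p e)} {g : G} (δ : Path e (g • e))
    (h : ∀ t, p (δ t) = γ t) : deckHom hp e (Pi1.mk γ) = g := by
  have hge : p (g • e) = p e := by rw [← δ.target, h, γ.target]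
  have key : hp.fundamentalGroupToMulOpposite (⟨e, rfl⟩ : p ⁻¹' {p e})
      (FundamentalGroup.fromPath (.mk γ)) = MulOpposite.op g := by
    rw [hp.fundamentalGroupToMulOpposite_apply_eq_Iff]
    have := hp.isCoveringMap.monodromy_eq_of_map_eq (γ := .mk γ) (ex := ⟨e, rfl⟩)
      (ey := ⟨g • e, hge⟩) (.mk δ) (by
        have e : δ.map p.continuous = γ.cast rfl hge := by
          ext t
          exact h t
        exact congrArg Path.Homotopic.Quotient.mk e)
    exact (congrArg Subtype.val this).symm
  exact congrArg MulOpposite.unop key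

/-- The lift of `γ` from `e` ends at the translate of `e` by the monodromy, which is `e` itself. -/
theorem exists_lift_of_deckHom_eq_one {γ : Path (p e) (p e)} (h : deckHom hp e (Pi1.mk γ) = 1) :
    ∃ δ : Path e e, ∀ t, p (δ t) = γ t := by
  obtain ⟨δ, hδ, h0⟩ := hp.isCoveringMap.exists_path_lifts γ e γ.source
  have h1 : ∃ g : G, g • e = δ 1 := hp.apply_eq_iff_mem_orbit.1 (by
    rw [← Function.comp_apply (f := p), hδ]
    exact γ.target)
  obtain ⟨g, hg⟩ := h1
  have := deckHom_mk hp e (g := g) (γ := γ) ⟨δ, h0, hg.symm⟩ fun t => congrFun hδ t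
  rw [h] at this
  subst this
  exact ⟨⟨δ, h0, by rw [← one_smul G e, hg]; rfl⟩, fun t => congrFun hδ t⟩

end Deck

/-! ### The presentation of the fundamental group -/

section Equiv

variable {A R B S : Type} [TopologicalSpace A] [DiscreteTopology A] [TopologicalSpace B]
  [DiscreteTopology B] [TopologicalSpace S] [DiscreteTopology S]
  (r : R → List (A × Bool)) (s : S → List (B × Bool)) (α : B)

/-- The presentation of `𝒥_G`. -/
theorem JGroup.bijective_lift : Function.Bijective (JPres.lift (JGroup.holonomy r s α)) := by
  let H := JPres.holonomy r s α
  let e : JCover H := JCover.ofRose H (RoseCover.vertex _ 1)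
  let θ : JGroup r s α →* JPres r s α := deckHom (JCover.isQuotientCoveringMap_proj H) e
  -- A loop with trivial monodromy has a closed lift, along which transport returns to the initial
  -- class; by cancellation the loop is null-homotopic.
  have hθ : Function.Injective θ := by
    refine (injective_iff_map_eq_one _).2 fun x hx => ?_
    obtain ⟨γ, rfl⟩ := Pi1.exists_mk x
    obtain ⟨δ, hδ⟩ := exists_lift_of_deckHom_eq_one (JCover.isQuotientCoveringMap_proj H) e hx
    obtain ⟨q, hq, -, -⟩ := JCover.exists_isTransport_proj H (JPres.lift (JGroup.holonomy r s α))
      (JPres.lift_gen _) (JPres.lift_copy _)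
    have h1 := hq.path δ
    have h2 : Follows (q e) (γ : C(I, _)) (q e) := by
      convert h1 using 1
      ext t
      exact (hδ t).symm
    exact Pi1.mk_eq_one h2.homotopic_refl
  -- Checked on generators: `a` lifts to an edge, and `b_i` to a path up a strip, across an edge and
  -- down another strip.
  have hl : θ.comp (JPres.lift (JGroup.holonomy r s α)) = MonoidHom.id _ := by
    refine JPres.hom_ext (fun a => ?_) fun i b => ?_
    · simp only [MonoidHom.comp_apply, JPres.lift_gen, MonoidHom.id_apply]
      refine deckHom_mk (JCover.isQuotientCoveringMap_proj H) e
        (((RoseCover.edge H.a 1 a).map (JCover.ofRose H).continuous).cast rfl ?_) fun t => rfl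
      change JCover.ofRose H (RoseCover.vertex _ (_ * 1)) = _
      rw [mul_one, one_mul]
      rfl
    · simp only [MonoidHom.comp_apply, JPres.lift_copy, MonoidHom.id_apply]
      let up : ∀ g, Path (JCover.ofRose H (RoseCover.vertex _ g))
          (JCover.ofCopy H i (StdCover.ofRose _ s (H.hs i) (RoseCover.vertex _ g))) := fun g =>
        ⟨⟨fun u => JCover.strip H (⟨i, RoseCover.vertex _ g⟩, u), by fun_prop⟩,
          JCover.strip_zero H _, JCover.strip_one H _⟩
      have hup : ∀ g u, JCover.proj H (up g u) = JComplex.tail r s α i u := fun g u => rfl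
      let across : Path _ _ := (RoseCover.edge (H.b i) 1 b).map
        ((JCover.ofCopy H i).comp (StdCover.ofRose _ s (H.hs i))).continuous
      refine deckHom_mk (JCover.isQuotientCoveringMap_proj H) e
        (((up 1).trans (across.trans (up _).symm)).cast rfl ?_) fun t => ?_
      · change JCover.ofRose H (RoseCover.vertex _ (_ * 1)) = _
        rw [mul_one, one_mul]
        rfl
      · rw [Path.cast_coe]
        exact map_trans_apply _ _ _ (JComplex.tail r s α i) _ (fun _ => hup 1 _)
          (map_trans_apply _ across (up _).symm
            ((StdComplex.edge s b).map (JComplex.ofCopy r s α i).continuous)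
            (JComplex.tail r s α i).symm (fun _ => rfl) fun _ => hup _ _) t
  have hb : Function.LeftInverse θ (JPres.lift (JGroup.holonomy r s α)) := DFunLike.congr_fun hl
  exact ⟨hb.injective, (hb.rightInverse_of_injective hθ).surjective⟩

end Equiv

/-! ### Homology and profinite completions of quotients -/

/-- First homology only depends on the abelianization. -/
theorem nonempty_h1_iso {G K : Type} [Group G] [Group K] (e : Abelianization G ≃* Abelianization K) :
    Nonempty (H1Z G ≅ H1Z K) := by
  let t : TensorProduct ℤ (Additive (Abelianization G)) ℤ ≃ₗ[ℤ]
      TensorProduct ℤ (Additive (Abelianization K)) ℤ :=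
    TensorProduct.congr (MulEquiv.toAdditive e).toIntLinearEquiv (LinearEquiv.refl ℤ ℤ)
  let f : H1Z G ≃+ H1Z K := ((groupHomology.H1AddEquivOfIsTrivial (Rep.trivial ℤ G ℤ)).trans
    t.toAddEquiv).trans (groupHomology.H1AddEquivOfIsTrivial (Rep.trivial ℤ K ℤ)).symm
  exact ⟨f.toIntLinearEquiv.toModuleIso⟩

/-- By surjectivity the commutator subgroup of `K` is the image of that of `G`, so an element mapped
into it differs from a product of commutators by an element of the kernel, again in the commutator
subgroup. -/
theorem nonempty_h1_iso_of_ker_le {G K : Type} [Group G] [Group K] (f : G →* K)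
    (hf : Function.Surjective f) (hk : f.ker ≤ commutator G) : Nonempty (H1Z G ≅ H1Z K) := by
  refine nonempty_h1_iso (MulEquiv.ofBijective (Abelianization.map f) ⟨?_, ?_⟩)
  · refine (injective_iff_map_eq_one _).2 fun x hx => ?_
    obtain ⟨x, rfl⟩ := QuotientGroup.mk_surjective x
    have h1 : f x ∈ commutator K := (QuotientGroup.eq_one_iff (N := commutator K) (f x)).1 hx
    have h2 : commutator K = (commutator G).map f := by
      rw [commutator_def, commutator_def, Subgroup.map_commutator,
        Subgroup.map_top_of_surjective f hf]
    rw [h2] at h1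
    obtain ⟨y, hy, hxy⟩ := h1
    have h3 : y⁻¹ * x ∈ commutator G := hk (by
      rw [MonoidHom.mem_ker, map_mul, map_inv, hxy, inv_mul_cancel])
    refine (QuotientGroup.eq_one_iff x).2 ?_
    simpa using mul_mem hy h3
  · intro y
    obtain ⟨y, rfl⟩ := QuotientGroup.mk_surjective y
    obtain ⟨x, rfl⟩ := hf y
    exact ⟨Abelianization.of x, rfl⟩

-- Under `hk` the map from `G` to its completion kills `f.ker`, so it factors through `K`. The
-- universal property extends this factor to the completion of `K`, and uniqueness makes it inverse
-- to the induced map.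
open ProfiniteGrp ProfiniteCompletion in
theorem isIso_profCompletion_map {G K : Type} [Group G] [Group K] (f : G →* K)
    (hf : Function.Surjective f) (hk : ∀ N : Subgroup G, N.Normal → N.FiniteIndex → f.ker ≤ N) :
    IsIso (ProfCompletion.map f) := by
  have hker : f.ker ≤ (eta (GrpCat.of G)).hom.ker := by
    intro x hx
    refine Subtype.ext (funext fun N => ?_)
    exact (QuotientGroup.eq_one_iff x).2 (hk N.toSubgroup inferInstance inferInstance hx)
  let φ : {g : G →* completion (GrpCat.of G) // f.ker ≤ g.ker} :=
    ⟨(eta (GrpCat.of G)).hom, hker⟩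
  let η' : GrpCat.of K ⟶ GrpCat.of (completion (GrpCat.of G)) :=
    GrpCat.ofHom (f.liftOfSurjective hf φ)
  have h1 : GrpCat.ofHom f ≫ η' = eta (GrpCat.of G) := by
    ext x
    exact f.liftOfRightInverse_comp_apply _ (Function.rightInverse_surjInv hf) φ x
  let F : completion (GrpCat.of G) ⟶ completion (GrpCat.of K) := ProfCompletion.map f
  let L : completion (GrpCat.of K) ⟶ completion (GrpCat.of G) := lift η'
  have h2 : eta (GrpCat.of G) ≫ (forget₂ _ _).map F =
      GrpCat.ofHom f ≫ eta (GrpCat.of K) := lift_eta _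
  have h3 : eta (GrpCat.of K) ≫ (forget₂ _ _).map L = η' := lift_eta _
  have hepi : Epi (GrpCat.ofHom f) := (GrpCat.epi_iff_surjective _).2 hf
  have h4 : F ≫ L = 𝟙 _ := by
    refine lift_unique _ _ ?_
    rw [Functor.map_comp, reassoc_of% h2, h3, h1]
    rfl
  have h5 : L ≫ F = 𝟙 _ := by
    refine lift_unique _ _ ?_
    rw [← cancel_epi (GrpCat.ofHom f), Functor.map_comp, reassoc_of% h3, reassoc_of% h1, h2]
    rfl
  exact ⟨L, h4, h5⟩

-- The coordinate at `N` of the image of `x` in the completion is its class modulo `N`.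
open ProfiniteGrp ProfiniteCompletion in
theorem eq_top_of_subsingleton_profCompletion {J : Type} [Group J]
    (h : Subsingleton (ProfCompletion J)) (N : Subgroup J) [hn : N.Normal] [hi : N.FiniteIndex] :
    N = ⊤ := by
  refine (Subgroup.eq_top_iff' N).2 fun x => ?_
  have h1 : etaFn (GrpCat.of J) x = etaFn (GrpCat.of J) 1 := h.elim _ _
  have h2 := congrFun (congrArg Subtype.val h1) (FiniteIndexNormalSubgroup.ofSubgroup N)
  exact (QuotientGroup.eq_one_iff (N := N) x).1 h2

/-! ### The canonical map -/

section Canonical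

variable {A R B S : Type} (r : R → List (A × Bool)) (s : S → List (B × Bool)) (α : B)

/-- The quotient of the presented group by the copies of `J`. -/
def JPres.toGrp : JPres r s α →* Grp r := JPres.lift
  { a := PresentedGroup.of
    b := fun _ _ => 1
    hs := fun i k => by
      have := wordVal_comp (1 : FreeGroup B →* Grp r) FreeGroup.of (s k)
      simpa using this
    hr := fun i => by
      have h : PresentedGroup.mk (range fun i => FreeGroup.mk (r i)) =
          FreeGroup.lift PresentedGroup.of := by
        ext a
        simp
        rfl
      rw [wordVal_eq, ← h]
      exact PresentedGroup.one_of_mem (mem_range_self i) }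

@[simp] theorem JPres.toGrp_gen (a : A) : toGrp r s α (gen r s α a) = PresentedGroup.of a :=
  lift_gen _ a

@[simp] theorem JPres.toGrp_copy (i : R) (b : B) : toGrp r s α (copy r s α i b) = 1 :=
  lift_copy _ i b

/-- Modulo the copies of `J` the relation `r_i = α_i` becomes `r_i = 1`, so `Grp r` maps back to the
quotient, through which the quotient map factors. -/
theorem JPres.ker_toGrp : (toGrp r s α).ker =
    Subgroup.normalClosure (range fun ib : R × B => copy r s α ib.1 ib.2) := by
  refine le_antisymm (fun x hx => ?_) (Subgroup.normalClosure_le_normal ?_)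
  · set N := Subgroup.normalClosure (range fun ib : R × B => copy r s α ib.1 ib.2)
    have hN : ∀ i b, (QuotientGroup.mk' N) (copy r s α i b) = 1 := fun i b =>
      (QuotientGroup.eq_one_iff _).2 (Subgroup.subset_normalClosure ⟨(i, b), rfl⟩)
    let f : Grp r →* JPres r s α ⧸ N :=
      PresentedGroup.toGroup (f := fun a => QuotientGroup.mk' N (gen r s α a)) (by
        rintro _ ⟨i, rfl⟩
        rw [← wordVal_eq, wordVal_comp]
        refine (congrArg _ ((holonomy r s α).hr i)).trans ?_
        exact hN i α)
    have hf : f.comp (toGrp r s α) = QuotientGroup.mk' N := by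
      refine JPres.hom_ext (fun a => ?_) fun i b => ?_
      · simp only [MonoidHom.comp_apply, toGrp_gen]
        exact PresentedGroup.toGroup.of _
      · simp only [MonoidHom.comp_apply, toGrp_copy, map_one, hN]
    have h := DFunLike.congr_fun hf x
    rw [MonoidHom.comp_apply, (MonoidHom.mem_ker).1 hx, map_one] at h
    exact (QuotientGroup.eq_one_iff x).1 h.symm
  · rintro _ ⟨ib, rfl⟩
    exact toGrp_copy r s α _ _

theorem JPres.surjective_toGrp : Function.Surjective (toGrp r s α) := by
  rw [← MonoidHom.range_eq_top, eq_top_iff, ← PresentedGroup.closure_range_of,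
    Subgroup.closure_le]
  rintro _ ⟨a, rfl⟩
  exact ⟨_, toGrp_gen r s α a⟩

/-- The map from `J` onto a copy of `J`. -/
def JPres.ofJ (i : R) : Grp s →* JPres r s α :=
  PresentedGroup.toGroup (f := copy r s α i) (by
    rintro _ ⟨k, rfl⟩
    rw [← wordVal_eq]
    exact (holonomy r s α).hs i k)

@[simp] theorem JPres.ofJ_of (i : R) (b : B) :
    ofJ r s α i (PresentedGroup.of b) = copy r s α i b := PresentedGroup.toGroup.of _

variable [TopologicalSpace A] [DiscreteTopology A] [TopologicalSpace B]
  [DiscreteTopology B] [TopologicalSpace S] [DiscreteTopology S]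

/-- The presentation of `𝒥_G`. -/
def JGroup.equiv : JPres r s α ≃* JGroup r s α :=
  MulEquiv.ofBijective _ (JGroup.bijective_lift r s α)

@[simp] theorem JGroup.equiv_gen (a : A) :
    equiv r s α (JPres.gen r s α a) = Pi1.mk (JComplex.genLoop r s α a) := JPres.lift_gen _ a

@[simp] theorem JGroup.equiv_copy (i : R) (b : B) :
    equiv r s α (JPres.copy r s α i b) = Pi1.mk (JComplex.copyLoop r s α i b) :=
  JPres.lift_copy _ i b

/-- The canonical map. -/
def canonicalMap : JGroup r s α →* Grp r :=
  (JPres.toGrp r s α).comp (JGroup.equiv r s α).symm.toMonoidHom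

theorem canonicalMap_equiv (x : JPres r s α) :
    canonicalMap r s α (JGroup.equiv r s α x) = JPres.toGrp r s α x := by
  simp [canonicalMap]

theorem surjective_canonicalMap : Function.Surjective (canonicalMap r s α) :=
  (JPres.surjective_toGrp r s α).comp (JGroup.equiv r s α).symm.surjective

theorem isCanonicalMap_canonicalMap : IsCanonicalMap r s α (canonicalMap r s α) := by
  refine ⟨fun a => ?_, ?_⟩
  · rw [← JGroup.equiv_gen, canonicalMap_equiv, JPres.toGrp_gen]
  · have h1 := Subgroup.map_normalClosure (range fun ib : R × B => JPres.copy r s α ib.1 ib.2)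
      (JGroup.equiv r s α).toMonoidHom (JGroup.equiv r s α).surjective
    rw [← JPres.ker_toGrp, ← range_comp] at h1
    have h2 : (⇑(JGroup.equiv r s α).toMonoidHom ∘ fun ib : R × B => JPres.copy r s α ib.1 ib.2) =
        fun ib : R × B => Pi1.mk (JComplex.copyLoop r s α ib.1 ib.2) := by
      ext ib
      exact JGroup.equiv_copy r s α _ _
    rw [← h2, ← h1]
    ext x
    obtain ⟨x, rfl⟩ := (JGroup.equiv r s α).surjective x
    rw [MonoidHom.mem_ker, canonicalMap_equiv]
    constructor
    · exact fun h => ⟨x, h, rfl⟩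
    · rintro ⟨y, hy, h⟩
      obtain rfl := (JGroup.equiv r s α).injective h
      exact hy

/-- The kernel condition fixes the value `1` on every `b_i`, and the `a_j` and `b_i` generate. -/
theorem IsCanonicalMap.eq {κ κ' : JGroup r s α →* Grp r} (h : IsCanonicalMap r s α κ)
    (h' : IsCanonicalMap r s α κ') : κ = κ' := by
  have hk : ∀ {κ : JGroup r s α →* Grp r}, IsCanonicalMap r s α κ → ∀ i b,
      κ (Pi1.mk (JComplex.copyLoop r s α i b)) = 1 := fun h i b => by
    rw [← MonoidHom.mem_ker, h.2]
    exact Subgroup.subset_normalClosure ⟨(i, b), rfl⟩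
  have e : κ.comp (JGroup.equiv r s α).toMonoidHom = κ'.comp (JGroup.equiv r s α).toMonoidHom := by
    refine JPres.hom_ext (fun a => ?_) fun i b => ?_
    · change κ (JGroup.equiv r s α _) = κ' (JGroup.equiv r s α _)
      rw [JGroup.equiv_gen, h.1, h'.1]
    · change κ (JGroup.equiv r s α _) = κ' (JGroup.equiv r s α _)
      rw [JGroup.equiv_copy, hk h, hk h']
  ext x
  obtain ⟨x, rfl⟩ := (JGroup.equiv r s α).surjective x
  exact DFunLike.congr_fun e x

/-- The homomorphism of `J` onto the copy with index `i`. -/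
def JGroup.ofJ (i : R) : Grp s →* JGroup r s α :=
  (JGroup.equiv r s α).toMonoidHom.comp (JPres.ofJ r s α i)

/-- The common source of the homological and profinite assertions: the kernel is normally generated
by images of `J`. -/
theorem ker_canonicalMap_le {N : Subgroup (JGroup r s α)} (hN : N.Normal)
    (h : ∀ i, N.comap (JGroup.ofJ r s α i) = ⊤) : (canonicalMap r s α).ker ≤ N := by
  rw [(isCanonicalMap_canonicalMap r s α).2]
  refine Subgroup.normalClosure_le_normal ?_
  rintro _ ⟨⟨i, b⟩, rfl⟩
  have : (PresentedGroup.of b : Grp s) ∈ N.comap (JGroup.ofJ r s α i) := h i ▸ Subgroup.mem_top _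
  simpa [JGroup.ofJ] using this

/-- The image of a perfect group lies in the commutator subgroup. -/
theorem nonempty_h1_iso_jGroup (h : Group.IsPerfect (Grp s)) :
    Nonempty (H1Z (JGroup r s α) ≅ H1Z (Grp r)) := by
  refine nonempty_h1_iso_of_ker_le (canonicalMap r s α) (surjective_canonicalMap r s α)
    (ker_canonicalMap_le r s α inferInstance fun i => ?_)
  rw [eq_top_iff, ← h.commutator_eq_top, ← Subgroup.map_le_iff_le_comap, commutator_def,
    commutator_def, Subgroup.map_commutator]
  exact Subgroup.commutator_mono le_top le_top

/-- A normal subgroup of finite index pulls back to one of `J`, and `J` has no proper ones. -/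
theorem isIso_profCompletion_canonicalMap (h : Subsingleton (ProfCompletion (Grp s))) :
    IsIso (ProfCompletion.map (canonicalMap r s α)) :=
  isIso_profCompletion_map _ (surjective_canonicalMap r s α) fun N hN _ =>
    ker_canonicalMap_le r s α hN fun i =>
      have : (N.comap (JGroup.ofJ r s α i)).FiniteIndex :=
        inferInstanceAs (((FiniteIndexNormalSubgroup.ofSubgroup N).comap
          (JGroup.ofJ r s α i)).toSubgroup.FiniteIndex)
      eq_top_of_subsingleton_profCompletion h _

end Canonical

/-! ### The copies of `J` embed -/

section Amalgam

/-- The factors of an amalgam of two groups. -/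
def AmalgamFactor (F J : Type) : Bool → Type
  | false => F
  | true => J

instance {F J : Type} [iF : Group F] [iJ : Group J] : ∀ b, Group (AmalgamFactor F J b)
  | false => iF
  | true => iJ

/-- Two groups embed into a group in which given elements of infinite order become equal. -/
theorem exists_amalgam {F J : Type} [Group F] [Group J] {u : F} {v : J} (hu : orderOf u = 0)
    (hv : orderOf v = 0) : ∃ (D : Type) (_ : Group D) (f : F →* D) (g : J →* D),
      Function.Injective f ∧ Function.Injective g ∧ f u = g v := by
  -- The amalgam is over `ℤ`, with generator sent to `u` and `v`; infinite order makes both maps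
  -- injective, so both factors embed.
  let φ : ∀ b, Multiplicative ℤ →* AmalgamFactor F J b := fun b => match b with
    | false => zpowersHom F u
    | true => zpowersHom J v
  have hφ : ∀ b, Function.Injective (φ b) := by
    rintro (_ | _)
    · exact injective_zpow_iff_not_isOfFinOrder.2 (orderOf_eq_zero_iff.1 hu)
    · exact injective_zpow_iff_not_isOfFinOrder.2 (orderOf_eq_zero_iff.1 hv)
  refine ⟨Monoid.PushoutI φ, inferInstance, Monoid.PushoutI.of (φ := φ) false,
    Monoid.PushoutI.of (φ := φ) true, Monoid.PushoutI.of_injective hφ false,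
    Monoid.PushoutI.of_injective hφ true, ?_⟩
  have h0 := Monoid.PushoutI.of_apply_eq_base φ false (.ofAdd 1)
  have h1 := Monoid.PushoutI.of_apply_eq_base φ true (.ofAdd 1)
  have e0 : φ false (.ofAdd 1) = u := zpow_one u
  have e1 : φ true (.ofAdd 1) = v := zpow_one v
  exact ((congrArg (Monoid.PushoutI.of (φ := φ) false) e0.symm).trans h0).trans
    (h1.symm.trans (congrArg (Monoid.PushoutI.of (φ := φ) true) e1))

variable {A R B S : Type} (r : R → List (A × Bool)) (s : S → List (B × Bool)) (α : B)

/-- Nontrivial `r_i` have infinite order in the torsion-free group `F` on the `a_j`. Amalgamating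
`F` with `J` along `r_i = α` gives `D i`, and amalgamating all `D i` along `F` gives a group in
which each copy of `J` embeds; it satisfies the relations of `JPres`, so the embedding factors
through `ofJ`. -/
theorem JPres.injective_ofJ (hα : orderOf (PresentedGroup.of α : Grp s) = 0)
    (hr : ∀ i, FreeGroup.mk (r i) ≠ 1) (i : R) : Function.Injective (ofJ r s α i) := by
  have hr' : ∀ i, orderOf (FreeGroup.mk (r i)) = 0 := fun i =>
    orderOf_eq_zero_iff.2 (not_isOfFinOrder_of_isMulTorsionFree (hr i))
  choose D inst f g hf hg hfg using fun i => exists_amalgam (hr' i) hα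
  let H : Holonomy r s α (Monoid.PushoutI f) :=
    { a := fun a => Monoid.PushoutI.base f (.of a)
      b := fun i b => Monoid.PushoutI.of (φ := f) i (g i (.of b))
      hs := fun i k => by
        have h : FreeGroup.lift (fun b => Monoid.PushoutI.of (φ := f) i (g i (.of b))) =
            ((Monoid.PushoutI.of (φ := f) i).comp (g i)).comp
              (PresentedGroup.mk (range fun i => FreeGroup.mk (s i))) := by
          ext b
          simp
          rfl
        rw [wordVal_eq, h, MonoidHom.comp_apply, PresentedGroup.one_of_mem (mem_range_self k),
          map_one]
      hr := fun i => by
        have h : FreeGroup.lift (fun a => Monoid.PushoutI.base f (FreeGroup.of a)) =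
            Monoid.PushoutI.base f := by
          ext a
          simp
        rw [wordVal_eq, h, ← hfg, Monoid.PushoutI.of_apply_eq_base] }
  have h : (lift H).comp (ofJ r s α i) = (Monoid.PushoutI.of (φ := f) i).comp (g i) := by
    ext b
    change lift H (ofJ r s α i (.of b)) = _
    rw [ofJ_of, lift_copy]
    rfl
  refine Function.Injective.of_comp (f := lift H) ?_
  rw [← MonoidHom.coe_comp, h, MonoidHom.coe_comp]
  exact (Monoid.PushoutI.of_injective hf i).comp (hg i)

theorem JPres.orderOf_copy (hα : orderOf (PresentedGroup.of α : Grp s) = 0)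
    (hr : ∀ i, FreeGroup.mk (r i) ≠ 1) (i : R) : orderOf (copy r s α i α) = 0 := by
  rw [← ofJ_of, orderOf_injective _ (injective_ofJ r s α hα hr i), hα]

/-- A section of the cosets of the copy of `J`. -/
theorem JPres.exists_retraction (hα : orderOf (PresentedGroup.of α : Grp s) = 0)
    (hr : ∀ i, FreeGroup.mk (r i) ≠ 1) (i : R) : ∃ j : JPres r s α → Grp s,
      ∀ g x, j (g * ofJ r s α i x) = j g * x := by
  -- Fix a representative of every left coset of the copy of `J`; then `g` is its representative
  -- times the image of a unique element of `J`, which is `j g`.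
  let rep : JPres r s α → JPres r s α := fun g =>
    (QuotientGroup.mk g : JPres r s α ⧸ (ofJ r s α i).range).out
  have hrep : ∀ g, ∃ x, ofJ r s α i x = (rep g)⁻¹ * g := fun g =>
    QuotientGroup.eq.1 (QuotientGroup.out_eq' (QuotientGroup.mk g : _ ⧸ (ofJ r s α i).range))
  choose j hj using hrep
  refine ⟨j, fun g x => injective_ofJ r s α hα hr i ?_⟩
  have : rep (g * ofJ r s α i x) = rep g :=
    congrArg Quotient.out (QuotientGroup.eq.2 (by simp))
  rw [map_mul, hj, hj, this, mul_assoc]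

end Amalgam

/-! ### Homotopy groups and coverings -/

section Cube

variable {k : ℕ}

/-- Stretching the cube from its centre. -/
def cubeStretch (t : I) (x : Fin k → I) (i : Fin k) : I :=
  projIcc 0 1 zero_le_one (1 / 2 + (1 + t) * (x i - 1 / 2) : ℝ)

theorem continuous_cubeStretch : Continuous fun x : I × (Fin k → I) => cubeStretch x.1 x.2 := by
  unfold cubeStretch
  fun_prop

theorem cubeStretch_zero (x : Fin k → I) : cubeStretch 0 x = x := by
  ext i
  simp [cubeStretch]

theorem cubeStretch_eq_zero {t : I} {x : Fin k → I} {i : Fin k}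
    (h : (1 / 2 + (1 + t) * (x i - 1 / 2) : ℝ) ≤ 0) : cubeStretch t x i = 0 :=
  projIcc_of_le_left _ h

theorem cubeStretch_eq_one {t : I} {x : Fin k → I} {i : Fin k}
    (h : 1 ≤ (1 / 2 + (1 + t) * (x i - 1 / 2) : ℝ)) : cubeStretch t x i = 1 :=
  projIcc_of_right_le _ h

theorem cubeStretch_mem_boundary (t : I) {x : Fin k → I} (hx : x ∈ Cube.boundary (Fin k)) :
    cubeStretch t x ∈ Cube.boundary (Fin k) := by
  obtain ⟨i, h | h⟩ := hx
  · refine ⟨i, .inl (cubeStretch_eq_zero ?_)⟩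
    have := t.2.1
    simp [h]
    linarith
  · refine ⟨i, .inr (cubeStretch_eq_one ?_)⟩
    have := t.2.1
    simp [h]
    linarith

/-- A function that vanishes on the boundary of the cube and is `1` in the middle. -/
def cubeBump (x : Fin k → I) : I :=
  ∏ i, (projIcc 0 1 zero_le_one (4 * x i : ℝ) * projIcc 0 1 zero_le_one (4 * (1 - x i) : ℝ))

theorem continuous_cubeBump : Continuous (cubeBump : (Fin k → I) → I) := by
  unfold cubeBump
  fun_prop

theorem cubeBump_of_mem_boundary {x : Fin k → I} (hx : x ∈ Cube.boundary (Fin k)) :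
    cubeBump x = 0 := by
  obtain ⟨i, h | h⟩ := hx
  · refine Finset.prod_eq_zero (Finset.mem_univ i) ?_
    rw [projIcc_of_le_left zero_le_one (by simp [h])]
    exact zero_mul _
  · refine Finset.prod_eq_zero (Finset.mem_univ i) ?_
    rw [projIcc_of_le_left (x := (4 * (1 - x i) : ℝ)) zero_le_one (by simp [h])]
    exact mul_zero _

/-- The constants match: the bump is `1` when all coordinates lie in `[1/4, 3/4]`, and doubling
about the centre sends any other coordinate to an end. -/
theorem cubeBump_eq_one_or (x : Fin k → I) :
    cubeBump x = 1 ∨ cubeStretch 1 x ∈ Cube.boundary (Fin k) := by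
  by_cases h : ∀ i, 1 / 4 ≤ (x i : ℝ) ∧ (x i : ℝ) ≤ 3 / 4
  · left
    refine Finset.prod_eq_one fun i _ => ?_
    rw [projIcc_of_right_le zero_le_one (by linarith [(h i).1]),
      projIcc_of_right_le zero_le_one (by linarith [(h i).2])]
    exact one_mul _
  · right
    push Not at h
    obtain ⟨i, hi⟩ := h
    by_cases h1 : 1 / 4 ≤ (x i : ℝ)
    · refine ⟨i, .inr (cubeStretch_eq_one ?_)⟩
      have := hi h1
      simp
      linarith
    · refine ⟨i, .inl (cubeStretch_eq_zero ?_)⟩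
      simp
      linarith

/-- The boundary of a cube of dimension at least `2` is connected. -/
theorem joinedIn_boundary (hk : 2 ≤ k) {x : Fin k → I} (hx : x ∈ Cube.boundary (Fin k)) :
    JoinedIn (Cube.boundary (Fin k)) 0 x := by
  obtain ⟨i, hi⟩ := hx
  have : Nontrivial (Fin k) := Fin.nontrivial_iff_two_le.2 hk
  obtain ⟨j, hj⟩ := exists_ne i
  -- `y` keeps only the extreme coordinate of `x`. On the way from `0` to `y` the coordinate `j`
  -- stays `0`; from `y` to `x` the coordinate `i` stays fixed.
  let y : Fin k → I := fun l => if l = i then x i else 0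
  have h1 : JoinedIn (Cube.boundary (Fin k)) 0 y := by
    refine ⟨⟨⟨fun t l => t * y l, by fun_prop⟩, ?_, ?_⟩, fun t => ⟨j, .inl ?_⟩⟩
    · ext; simp
    · ext; simp
    · simp [y, hj]
  refine h1.trans ⟨⟨⟨fun t l => if l = i then x i else t * x l, ?_⟩, ?_, ?_⟩, fun t => ⟨i, ?_⟩⟩
  · refine continuous_pi fun l => ?_
    split_ifs <;> fun_prop
  · ext l; simp [y]
  · ext l
    by_cases h : l = i
    · subst h; simp
    · simp [h]
  · simpa using hi

end Cube

/-! ### Vanishing of higher homotopy groups from a null-homotopic covering map -/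

section Cover

variable {E Y : Type} [TopologicalSpace E] [TopologicalSpace Y] {k : ℕ}

/-- A free null-homotopy that is independent of the boundary point defines a null-homotopy relative
to the boundary. -/
theorem homotopic_const_of_free {y : Y} (f : GenLoop (Fin k) Y y) {y₁ : Y}
    (F : C((Fin k → I) × I, Y)) (F0 : ∀ x, F (x, 0) = f x) (F1 : ∀ x, F (x, 1) = y₁)
    (δ : C(I, Y)) (hδ : ∀ x ∈ Cube.boundary (Fin k), ∀ t, F (x, t) = δ t)
    (hδ0 : δ 0 = y) (hδ1 : δ 1 = y₁) : GenLoop.Homotopic f GenLoop.const := by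
  have hc1 : Continuous fun x : Fin k → I => cubeStretch 1 x :=
    continuous_cubeStretch.comp (Continuous.prodMk_right (1 : I))
  have hb := continuous_cubeBump (k := k)
  let g₁ : C(Fin k → I, Y) := ⟨fun x => f (cubeStretch 1 x), f.1.continuous.comp hc1⟩
  let g₂ : C(Fin k → I, Y) := ⟨fun x => δ (cubeBump x), by fun_prop⟩
  have h1 : f.1.HomotopicRel g₁ (Cube.boundary (Fin k)) := ⟨
    { toFun := fun x => f (cubeStretch x.1 x.2)
      continuous_toFun := f.1.continuous.comp continuous_cubeStretch
      map_zero_left := fun x => congrArg f (cubeStretch_zero x)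
      map_one_left := fun x => rfl
      prop' := fun t x hx => (f.2 _ (cubeStretch_mem_boundary t hx)).trans (f.2 x hx).symm }⟩
  -- Run `F` on the stretched cube for a time limited by the bump. Where the bump is below `1`, the
  -- stretched point is on the boundary and `F` follows `δ`; elsewhere `F` runs to its end, the
  -- constant `δ 1`.
  have h2 : g₁.HomotopicRel g₂ (Cube.boundary (Fin k)) := ⟨
    { toFun := fun x => F (cubeStretch 1 x.2, x.1 * cubeBump x.2)
      continuous_toFun := F.continuous.comp ((hc1.comp continuous_snd).prodMk (by fun_prop))
      map_zero_left := fun x => by simp [F0, g₁]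
      map_one_left := fun x => by
        obtain h | h := cubeBump_eq_one_or x
        · simp [g₂, h, F1, hδ1]
        · simp [g₂, hδ _ h]
      prop' := fun t x hx => by
        simp [cubeBump_of_mem_boundary hx, F0, g₁] }⟩
  have h3 : g₂.HomotopicRel (ContinuousMap.const _ y) (Cube.boundary (Fin k)) := ⟨
    { toFun := fun x => δ (unitInterval.symm x.1 * cubeBump x.2)
      continuous_toFun := by fun_prop
      map_zero_left := fun x => by simp [g₂]
      map_one_left := fun x => by simp [hδ0]
      prop' := fun t x hx => by simp [cubeBump_of_mem_boundary hx, g₂] }⟩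
  exact (h1.trans h2).trans h3

/-- If a covering map is null-homotopic, then the higher homotopy groups of its base vanish. -/
theorem subsingleton_pi_of_cover {p : C(E, Y)} (hp : IsCoveringMap p)
    (hs : Function.Surjective p) {y₀ : Y} (K : p.Homotopy (ContinuousMap.const E y₀)) (hk : 2 ≤ k)
    (y : Y) : Subsingleton (HomotopyGroup.Pi k Y y) := by
  have key : ∀ f : GenLoop (Fin k) Y y, GenLoop.Homotopic f GenLoop.const := by
    intro f
    obtain ⟨e, he⟩ := hs (f 0)
    -- Contracting the cube to its corner exhibits `f` as the end of a homotopy from a constant map,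
    -- which lifts.
    let H : C(I × (Fin k → I), Y) := ⟨fun x => f fun i => x.1 * x.2 i, f.1.continuous.comp (by fun_prop)⟩
    have H0 : ∀ x, H (0, x) = p (ContinuousMap.const _ e x) := fun x => by
      simp only [H, ContinuousMap.coe_mk, zero_mul, ContinuousMap.const_apply, he]
      rfl
    let L := hp.liftHomotopy H (ContinuousMap.const _ e) H0
    have hL : ∀ x, p (L (1, x)) = f x := fun x => by
      have := congrFun (hp.liftHomotopy_lifts H (ContinuousMap.const _ e) H0) (1, x)
      refine this.trans (congrArg f ?_)
      ext i
      simp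
    -- The boundary is connected, as `k ≥ 2`, and lies over one point, so its lift is constant.
    have hb : ∀ x ∈ Cube.boundary (Fin k), L (1, x) = L (1, 0) := by
      intro x hx
      obtain ⟨γ, hγ⟩ := joinedIn_boundary hk hx
      have := hp.const_of_comp (g := fun t => L (1, γ t)) (by fun_prop)
        (fun s t => by
          exact ((hL _).trans (f.2 _ (hγ s))).trans ((hL _).trans (f.2 _ (hγ t))).symm) 1 0
      simpa using this
    refine homotopic_const_of_free f (y₁ := y₀) ⟨fun x => K (x.2, L (1, x.1)), by fun_prop⟩
      (fun x => by simp [hL]) (fun x => by simp) ⟨fun t => K (t, L (1, 0)), by fun_prop⟩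
      (fun x hx t => by simp [hb x hx]) ?_ (by simp)
    have h0 : (0 : Fin k → I) ∈ Cube.boundary (Fin k) := ⟨⟨0, by omega⟩, .inl rfl⟩
    simp only [ContinuousMap.coe_mk, ContinuousMap.Homotopy.apply_zero, hL]
    exact f.2 _ h0
  refine ⟨fun a b => ?_⟩
  obtain ⟨f, rfl⟩ := Quotient.exists_rep a
  obtain ⟨g, rfl⟩ := Quotient.exists_rep b
  exact Quotient.sound ((key f).trans (key g).symm)

end Cover

/-! ### Null-homotopies of maps on glued spaces -/

section Glue

variable {X Z W : Type} [TopologicalSpace X] [TopologicalSpace Z] [TopologicalSpace W]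

/-- The tracks of a homotopy. -/
def tracks {P Q : C(Z, X)} (H : P.Homotopy Q) : C(Z, C(I, X)) :=
  (H.toContinuousMap.comp ⟨Prod.swap, continuous_swap⟩).curry

/-- The homotopy with given tracks. -/
def ofTracks {P Q : C(Z, X)} (K : C(Z, C(I, X))) (h0 : ∀ z, K z 0 = P z) (h1 : ∀ z, K z 1 = Q z) :
    P.Homotopy Q where
  toFun x := K x.2 x.1
  continuous_toFun := by fun_prop
  map_zero_left := h0
  map_one_left := h1

/-- Homotopies on an adjunction space. -/
theorem Adj.exists_homotopy {D M E : Type} [TopologicalSpace D] [TopologicalSpace M]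
    [TopologicalSpace E] {c : Collar D M} {f : C(D, E)} {P Q : C(Adj c f, X)}
    (HE : (P.comp (inl c f)).Homotopy (Q.comp (inl c f)))
    (HM : (P.comp (inr c f)).Homotopy (Q.comp (inr c f)))
    (h : ∀ t d, HM (t, c.i d) = HE (t, f d)) :
    ∃ H : P.Homotopy Q, (∀ t e, H (t, inl c f e) = HE (t, e)) ∧
      ∀ t m, H (t, inr c f m) = HM (t, m) := by
  refine ⟨ofTracks (descC (tracks HE) (tracks HM) fun d => ?_) (ind ?_ ?_) (ind ?_ ?_),
    fun t e => rfl, fun t m => rfl⟩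
  · ext t
    exact h t d
  · exact fun e => HE.apply_zero e
  · exact fun m => HM.apply_zero m
  · exact fun e => HE.apply_one e
  · exact fun m => HM.apply_one m

/-- Homotopies on a product with a discrete space. -/
theorem exists_homotopy_prod [DiscreteTopology Z] {P Q : C(Z × W, X)}
    (H : ∀ z, (P.comp ⟨fun w => (z, w), by fun_prop⟩).Homotopy
      (Q.comp ⟨fun w => (z, w), by fun_prop⟩)) :
    ∃ K : P.Homotopy Q, ∀ t z w, K (t, (z, w)) = H z (t, w) :=
  ⟨ofTracks ⟨fun x => tracks (H x.1) x.2, continuous_prod_of_discrete_left.2 fun z =>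
      (tracks (H z)).continuous⟩ (fun x => (H x.1).apply_zero x.2) fun x => (H x.1).apply_one x.2,
    fun _ _ _ => rfl⟩

/-- Homotopies on a disjoint union. -/
theorem exists_homotopy_sum {P Q : C(Z ⊕ W, X)}
    (H : (P.comp ⟨Sum.inl, continuous_inl⟩).Homotopy (Q.comp ⟨Sum.inl, continuous_inl⟩))
    (H' : (P.comp ⟨Sum.inr, continuous_inr⟩).Homotopy (Q.comp ⟨Sum.inr, continuous_inr⟩)) :
    ∃ K : P.Homotopy Q, (∀ t z, K (t, Sum.inl z) = H (t, z)) ∧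
      ∀ t w, K (t, Sum.inr w) = H' (t, w) := by
  refine ⟨ofTracks ⟨Sum.elim (tracks H) (tracks H'), by fun_prop⟩ ?_ ?_,
    fun _ _ => rfl, fun _ _ => rfl⟩
  · rintro (z | w)
    exacts [H.apply_zero z, H'.apply_zero w]
  · rintro (z | w)
    exacts [H.apply_one z, H'.apply_one w]

/-- Homotopies on a disjoint union of a family. -/
theorem exists_homotopy_sigma {ι : Type} {V : ι → Type} [∀ i, TopologicalSpace (V i)]
    {P Q : C(Σ i, V i, X)}
    (H : ∀ i, (P.comp (ContinuousMap.sigmaMk i)).Homotopy (Q.comp (ContinuousMap.sigmaMk i))) :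
    ∃ K : P.Homotopy Q, ∀ t i v, K (t, ⟨i, v⟩) = H i (t, v) :=
  ⟨ofTracks ⟨fun x => tracks (H x.1) x.2, continuous_sigma fun i => (tracks (H i)).continuous⟩
    (fun x => (H x.1).apply_zero x.2) fun x => (H x.1).apply_one x.2, fun _ _ _ => rfl⟩

end Glue

/-! ### Filling edges -/

section Edge

variable {X : Type} [TopologicalSpace X] {x₀ : X}

@[simp] theorem quotient_symm_symm {a b : X} (t : Path.Homotopic.Quotient a b) :
    t.symm.symm = t := by
  induction t using Path.Homotopic.Quotient.ind with | mk t =>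
  rw [← Path.Homotopic.Quotient.mk_symm, ← Path.Homotopic.Quotient.mk_symm, Path.symm_symm]

@[simp] theorem quotient_trans_symm {a b c : X} (t : Path.Homotopic.Quotient a b)
    (u : Path.Homotopic.Quotient b c) : (t.trans u).symm = u.symm.trans t.symm := by
  induction t using Path.Homotopic.Quotient.ind with | mk t =>
  induction u using Path.Homotopic.Quotient.ind with | mk u =>
  rw [← Path.Homotopic.Quotient.mk_trans, ← Path.Homotopic.Quotient.mk_symm, Path.trans_symm]
  rfl

@[simp] theorem quotient_symm_trans_cancel {a b c : X} (t : Path.Homotopic.Quotient a b)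
    (u : Path.Homotopic.Quotient b c) : t.symm.trans (t.trans u) = u := by
  rw [← Path.Homotopic.Quotient.trans_assoc]
  simp

@[simp] theorem quotient_trans_symm_cancel {a b c : X} (t : Path.Homotopic.Quotient b a)
    (u : Path.Homotopic.Quotient b c) : t.trans (t.symm.trans u) = u := by
  rw [← Path.Homotopic.Quotient.trans_assoc]
  simp

theorem eq_symm_trans_symm_symm {a b c : X} {t : Path.Homotopic.Quotient c a}
    {t' : Path.Homotopic.Quotient c b} {u : Path.Homotopic.Quotient a b} (h : t' = t.trans u) :
    u = t.symm.trans t'.symm.symm := by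
  subst h
  simp

/-- A path is null-homotopic with prescribed tracks at its ends, up to waiting. -/
theorem exists_fill_edge {a b : X} (u : Path a b) (p : Path a x₀) (p' : Path b x₀)
    (h : u.Homotopic (p.trans p'.symm)) :
    ∃ H : (u : C(I, X)).Homotopy (ContinuousMap.const I x₀),
      (∀ t, H (t, 0) = (Path.refl a).trans p t) ∧ ∀ t, H (t, 1) = (Path.refl b).trans p' t := by
  obtain ⟨F⟩ := h
  -- At time `t` the parts of `p` and `p'` before the parameter `t` are cut off, so the ends travel
  -- along `p` and `p'` to `x₀`.
  let g : I × I → X := fun x => if (x.2 : ℝ) ≤ 1 / 2 then p.extend (max (2 * x.2) x.1)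
    else p'.extend (max (2 - 2 * x.2) x.1)
  have hg : Continuous g := by
    refine Continuous.if_le ?_ ?_ (by fun_prop) continuous_const fun x hx => ?_
    · exact p.continuous_extend.comp (by fun_prop)
    · exact p'.continuous_extend.comp (by fun_prop)
    · rw [p.extend_of_one_le, p'.extend_of_one_le] <;>
        exact le_max_of_le_left (by linarith)
  let G : (p.trans p'.symm : C(I, X)).Homotopy (ContinuousMap.const I x₀) :=
    { toFun := g
      continuous_toFun := hg
      map_zero_left := fun z => by
        change g (0, z) = p.trans p'.symm z
        rw [Path.trans_apply]
        simp only [g, Icc.coe_zero]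
        split_ifs with h
        · rw [max_eq_left (by linarith [z.2.1])]
          exact p.extend_apply _
        · rw [max_eq_left (by linarith [z.2.2]), Path.symm_apply,
            p'.extend_apply ⟨by linarith [z.2.2], by linarith [z.2.2]⟩]
          congr 1
          ext
          simp
          ring
      map_one_left := fun z => by
        change g (1, z) = x₀
        simp only [g]
        split_ifs
        · exact p.extend_of_one_le (le_max_right _ _)
        · exact p'.extend_of_one_le (le_max_right _ _) }
  have hG0 : ∀ t, G (t, 0) = p t := fun t => by
    change g (t, 0) = _
    simp [g, t.2.1]
  have hG1 : ∀ t, G (t, 1) = p' t := fun t => by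
    change g (t, 1) = _
    simp only [g, Icc.coe_one]
    rw [if_neg (by norm_num), max_eq_right (by linarith [t.2.1])]
    exact p'.extend_apply t.2
  -- `F` fixes the ends, whence the initial `Path.refl` in their tracks.
  refine ⟨F.toHomotopy.trans G, fun t => ?_, fun t => ?_⟩
  · rw [ContinuousMap.Homotopy.trans_apply, Path.trans_apply]
    split_ifs
    · exact F.source _
    · exact hG0 _
  · rw [ContinuousMap.Homotopy.trans_apply, Path.trans_apply]
    split_ifs
    · exact F.target _
    · exact hG1 _

variable {G A : Type} [Group G] [TopologicalSpace G] [DiscreteTopology G]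
  [TopologicalSpace A] [DiscreteTopology A]

/-- A map on the covering of a rose is null-homotopic if the classes of paths to its values at the
vertices can be chosen compatibly. -/
theorem RoseCover.exists_nullHomotopy {φ : A → G} (P : C(RoseCover φ, X))
    (τ : ∀ g, Path.Homotopic.Quotient x₀ (P (vertex φ g)))
    (hτ : ∀ g a, τ (g * φ a) = (τ g).trans (.mk ((edge φ g a).map P.continuous))) :
    ∃ K : P.Homotopy (ContinuousMap.const _ x₀),
      ∀ g, Path.Homotopic.Quotient.mk (K.evalAt (vertex φ g)) = (τ g).symm := by
  choose p hp using fun g => Path.Homotopic.Quotient.mk_surjective (τ g).symm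
  have he : ∀ g a, ((edge φ g a).map P.continuous).Homotopic ((p g).trans (p (g * φ a)).symm) := by
    intro g a
    rw [← Path.Homotopic.Quotient.eq, Path.Homotopic.Quotient.mk_trans,
      Path.Homotopic.Quotient.mk_symm, hp, hp]
    exact eq_symm_trans_symm_symm (hτ g a)
  choose H H0 H1 using fun x : G × A => exists_fill_edge _ _ _ (he x.1 x.2)
  obtain ⟨HM, hHM⟩ := exists_homotopy_prod (P := P.comp (edgePt φ))
    (Q := ContinuousMap.const _ x₀) (fun x => H x)
  let HE : (P.comp (vertex φ)).Homotopy (ContinuousMap.const _ x₀) :=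
    ofTracks ⟨fun g => ((Path.refl _).trans (p g) : C(I, X)), continuous_of_discreteTopology⟩
      (fun g => ((Path.refl _).trans (p g)).source) fun g => ((Path.refl _).trans (p g)).target
  obtain ⟨K, hK, -⟩ := Adj.exists_homotopy (P := P) (Q := ContinuousMap.const _ x₀) HE HM (by
    rintro t ⟨⟨g, a⟩, _ | _⟩
    · exact (hHM t (g, a) 0).trans (H0 (g, a) t)
    · exact (hHM t (g, a) 1).trans (H1 (g, a) t))
  refine ⟨K, fun g => ?_⟩
  rw [← hp]
  have : K.evalAt (vertex φ g) = (Path.refl _).trans (p g) := by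
    ext t
    exact hK t g
  rw [this]
  simp

end Edge

/-! ### Filling discs -/

section Fill

variable {X : Type} [TopologicalSpace X] {x₀ : X}

/-- The square with side length `4` as a cube. -/
def squareCoord (w : ℂ) : Fin 2 → I :=
  ![projIcc 0 1 zero_le_one ((w.re + 2) / 4), projIcc 0 1 zero_le_one ((w.im + 2) / 4)]

theorem continuous_squareCoord : Continuous squareCoord := by
  refine continuous_pi fun i => ?_
  fin_cases i
  · exact (continuous_projIcc (h := zero_le_one)).comp (by fun_prop)
  · exact (continuous_projIcc (h := zero_le_one)).comp (by fun_prop)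

/-- The inverse of `squareCoord` on the square. -/
def squarePoint (y : Fin 2 → I) : ℂ := ⟨4 * y 0 - 2, 4 * y 1 - 2⟩

theorem continuous_squarePoint : Continuous squarePoint := by
  have : squarePoint = fun y : Fin 2 → I =>
      ((4 * y 0 - 2 : ℝ) : ℂ) + ((4 * y 1 - 2 : ℝ) : ℂ) * Complex.I := by
    ext y
    apply Complex.ext <;> simp [squarePoint]
  rw [this]
  fun_prop

theorem one_le_norm_squarePoint {y : Fin 2 → I} (hy : y ∈ Cube.boundary (Fin 2)) :
    1 ≤ ‖squarePoint y‖ := by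
  obtain ⟨i, hi⟩ := hy
  have h0 := Complex.abs_re_le_norm (squarePoint y)
  have h1 := Complex.abs_im_le_norm (squarePoint y)
  fin_cases i
  · refine le_trans ?_ h0
    obtain h | h := hi <;> simp at h <;> simp [squarePoint, h] <;> norm_num
  · refine le_trans ?_ h1
    obtain h | h := hi <;> simp at h <;> simp [squarePoint, h] <;> norm_num

theorem squareCoord_mem_boundary {w : ℂ} (h : 2 ≤ |w.re| ∨ 2 ≤ |w.im|) :
    squareCoord w ∈ Cube.boundary (Fin 2) := by
  rcases h with h | h
  · refine ⟨0, ?_⟩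
    obtain h | h := le_abs.1 h
    · exact .inr (projIcc_of_right_le zero_le_one (by linarith))
    · exact .inl (projIcc_of_le_left zero_le_one (by linarith))
  · refine ⟨1, ?_⟩
    obtain h | h := le_abs.1 h
    · exact .inr (projIcc_of_right_le zero_le_one (by linarith))
    · exact .inl (projIcc_of_le_left zero_le_one (by linarith))

theorem squarePoint_squareCoord {w : ℂ} (h : |w.re| ≤ 2) (h' : |w.im| ≤ 2) :
    squarePoint (squareCoord w) = w := by
  rw [abs_le] at h h'
  have h1 : projIcc (0 : ℝ) 1 zero_le_one ((w.re + 2) / 4) = ⟨(w.re + 2) / 4, by linarith, by linarith⟩ :=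
    projIcc_of_mem _ _
  have h2 : projIcc (0 : ℝ) 1 zero_le_one ((w.im + 2) / 4) = ⟨(w.im + 2) / 4, by linarith, by linarith⟩ :=
    projIcc_of_mem _ _
  apply Complex.ext
  · simp [squarePoint, squareCoord, h1]; ring
  · simp [squarePoint, squareCoord, h2]; ring

/-- If `π₂` vanishes, a compactly supported map on the plane is null-homotopic with compact
support. -/
theorem exists_plane_nullHomotopy [Subsingleton (HomotopyGroup.Pi 2 X x₀)] (v : C(ℂ, X))
    (hv : ∀ w, 1 ≤ ‖w‖ → v w = x₀) :
    ∃ V : C(ℂ × I, X), (∀ w, V (w, 0) = v w) ∧ (∀ w, V (w, 1) = x₀) ∧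
      ∀ w t, 3 ≤ ‖w‖ → V (w, t) = x₀ := by
  let f : GenLoop (Fin 2) X x₀ := ⟨v.comp ⟨squarePoint, continuous_squarePoint⟩,
    fun y hy => hv _ (one_le_norm_squarePoint hy)⟩
  obtain ⟨H⟩ : GenLoop.Homotopic f GenLoop.const := Quotient.exact
    (‹Subsingleton (HomotopyGroup.Pi 2 X x₀)›.elim (Quotient.mk _ f) (Quotient.mk _ GenLoop.const))
  have hc := continuous_squareCoord
  have hb : ∀ t, ∀ y ∈ Cube.boundary (Fin 2), H (t, y) = x₀ := fun t y hy =>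
    (H.eq_fst t hy).trans (f.2 y hy)
  refine ⟨⟨fun x => H (x.2, squareCoord x.1), by fun_prop⟩, fun w => ?_, fun w => ?_,
    fun w t hw => ?_⟩
  · have h0 : H (0, squareCoord w) = v (squarePoint (squareCoord w)) := H.apply_zero _
    refine h0.trans ?_
    by_cases h : |w.re| ≤ 2 ∧ |w.im| ≤ 2
    · rw [squarePoint_squareCoord h.1 h.2]
    · have h1 : 2 ≤ |w.re| ∨ 2 ≤ |w.im| := by
        by_contra h2
        push Not at h2
        exact h ⟨h2.1.le, h2.2.le⟩
      have h2 : 1 ≤ ‖w‖ := by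
        obtain h | h := h1
        · linarith [Complex.abs_re_le_norm w]
        · linarith [Complex.abs_im_le_norm w]
      rw [hv w h2, hv _ (one_le_norm_squarePoint (squareCoord_mem_boundary h1))]
  · exact H.apply_one _
  -- The square `[-2, 2]²` has half-diagonal `2√2 < 3`, so a point of norm at least `3` is not in
  -- its interior.
  · refine hb t _ (squareCoord_mem_boundary ?_)
    by_contra h
    push Not at h
    have h1 := Complex.sq_norm w
    rw [Complex.normSq_apply, ← abs_mul_abs_self w.re, ← abs_mul_abs_self w.im] at h1
    nlinarith [abs_nonneg w.re, abs_nonneg w.im]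

theorem Disc.proj_two_smul_half (z : Disc) : Disc.proj ((2 : ℝ) • ((1 / 2 : ℝ) • (z : ℂ))) = z := by
  ext
  rw [smul_smul]
  norm_num
  exact Disc.proj_of_norm_le (mem_closedBall_zero_iff.1 z.2)

/-- A map on the disc with a null-homotopy on the boundary, as a map on the plane. -/
theorem exists_plane_map (u : C(Disc, X))
    (Λ : (u.comp Collar.disc.i).Homotopy (ContinuousMap.const _ x₀)) :
    ∃ v : C(ℂ, X), (∀ z : Disc, v ((1 / 2 : ℝ) • (z : ℂ)) = u z) ∧
      (∀ (z : Circle) (t : I), v (((1 + t) / 2 : ℝ) • (z : ℂ)) = Λ (t, z)) ∧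
      ∀ w, 1 ≤ ‖w‖ → v w = x₀ := by
  -- The disc of radius `1 / 2` carries `u`, the annulus up to radius `1` carries `Λ` with time
  -- `2‖w‖ - 1`, and the rest is constant.
  let v : ℂ → X := fun w => if ‖w‖ ≤ 1 / 2 then u (Disc.proj ((2 : ℝ) • w))
    else Λ (projIcc 0 1 zero_le_one (2 * ‖w‖ - 1), direction w)
  have hcont : Continuous v := by
    refine continuous_if_le (by fun_prop) continuous_const ?_ ?_ fun w hw => ?_
    · exact (u.continuous.comp (Disc.continuous_proj.comp (by fun_prop))).continuousOn
    · refine Λ.continuous.comp_continuousOn (ContinuousOn.prodMk ?_ ?_)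
      · exact (continuous_projIcc.comp (by fun_prop)).continuousOn
      · refine continuousOn_direction.mono fun w hw => ?_
        have hw : 1 / 2 ≤ ‖w‖ := hw
        exact norm_ne_zero_iff.1 (by linarith)
    · rw [projIcc_of_le_left zero_le_one (by linarith)]
      change _ = Λ (0, direction w)
      rw [Λ.apply_zero, ContinuousMap.comp_apply]
      congr 1
      ext
      have h2 : ‖(2 : ℝ) • w‖ = 1 := by rw [norm_smul, hw]; norm_num
      have h0 : w ≠ 0 := norm_ne_zero_iff.1 (by linarith)
      rw [Disc.proj_of_norm_le h2.le]
      change _ = (direction w : ℂ)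
      rw [coe_direction h0, hw]
      norm_num
  have h1 : ∀ (z : Circle) (t : I), ‖((1 + t) / 2 : ℝ) • (z : ℂ)‖ = (1 + t) / 2 := fun z t => by
    rw [norm_smul, Circle.norm_coe, mul_one, Real.norm_of_nonneg (by linarith [t.2.1])]
  have hdir : ∀ (z : Circle) (t : I), direction (((1 + t) / 2 : ℝ) • (z : ℂ)) = z := fun z t => by
    have ht : (0 : ℝ) < (1 + t) / 2 := by linarith [t.2.1]
    ext
    rw [coe_direction (norm_ne_zero_iff.1 (by rw [h1]; exact ht.ne')), h1, smul_smul,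
      inv_mul_cancel₀ ht.ne', one_smul]
  refine ⟨⟨v, hcont⟩, fun z => ?_, fun z t => ?_, fun w hw => ?_⟩
  · have : ‖(1 / 2 : ℝ) • (z : ℂ)‖ ≤ 1 / 2 := by
      rw [norm_smul]
      have := mem_closedBall_zero_iff.1 z.2
      norm_num
      linarith
    simp only [ContinuousMap.coe_mk, v, if_pos this, Disc.proj_two_smul_half]
  · by_cases h : ((1 + t) / 2 : ℝ) ≤ 1 / 2
    · have ht : t = 0 := Subtype.ext (le_antisymm (show (t : ℝ) ≤ 0 by linarith) t.2.1)
      subst ht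
      simp only [ContinuousMap.coe_mk, v, h1, if_pos h, Λ.apply_zero, ContinuousMap.comp_apply]
      congr 1
      have := Disc.proj_two_smul_half (Collar.disc.i z)
      simpa using! this
    · simp only [ContinuousMap.coe_mk, v, h1, if_neg h, hdir]
      congr 2
      have : (2 * ((1 + t) / 2) - 1 : ℝ) = t := by ring
      rw [this]
      exact projIcc_val _ t
  · have : ¬ ‖w‖ ≤ 1 / 2 := by linarith
    simp only [ContinuousMap.coe_mk, v, if_neg this]
    rw [projIcc_of_right_le zero_le_one (by linarith)]
    exact Λ.apply_one _

/-- If `π₂` vanishes, a null-homotopy on the boundary of the disc extends to the disc. -/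
theorem exists_fill_disc [Subsingleton (HomotopyGroup.Pi 2 X x₀)] (u : C(Disc, X))
    (Λ : (u.comp Collar.disc.i).Homotopy (ContinuousMap.const _ x₀)) :
    ∃ H : u.Homotopy (ContinuousMap.const _ x₀), ∀ t z, H (t, Collar.disc.i z) = Λ (t, z) := by
  obtain ⟨v, hvu, hvΛ, hv⟩ := exists_plane_map u Λ
  obtain ⟨V, hV0, hV1, hV3⟩ := exists_plane_nullHomotopy v hv
  -- The homotopy reads `V` at the position `pos` and time `tim`. For `t = 0` this is `z / 2` at
  -- time `0`, giving `u`; for `‖z‖ = 1`, where `κ = 1`, it is `(1 + t) / 2 • z` at time `0`, giving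
  -- `Λ`. For `t = 1` it gives `x₀`: if `‖z‖ ≤ 1/2`, since the time is `1`; if `1/2 < ‖z‖ ≤ 3/4`,
  -- since the position has norm `3`; and if `‖z‖ > 3/4`, since the time is `0` and the position has
  -- norm at least `1`.
  let κ : ℝ → ℝ := fun s => min 3 (9 - 8 * s) / max s (1 / 2)
  let pos : I × Disc → ℂ := fun x =>
    ((1 - x.1) / 2 + x.1 * κ ‖(x.2 : ℂ)‖ : ℝ) • (x.2 : ℂ)
  let tim : I × Disc → I := fun x =>
    x.1 * projIcc 0 1 zero_le_one (4 * (3 / 4 - ‖(x.2 : ℂ)‖))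
  have hκ : Continuous κ := Continuous.div (by fun_prop) (by fun_prop) fun s => by positivity
  have hpos : Continuous pos := by fun_prop
  have htim : Continuous tim := by
    have : Continuous fun x : I × Disc => projIcc (0 : ℝ) 1 zero_le_one (4 * (3 / 4 - ‖(x.2 : ℂ)‖)) :=
      continuous_projIcc.comp (by fun_prop)
    fun_prop
  refine ⟨⟨⟨fun x => V (pos x, tim x), by fun_prop⟩, fun z => ?_, fun z => ?_⟩, fun t z => ?_⟩
  · change V (pos (0, z), tim (0, z)) = u z
    have h1 : pos (0, z) = (1 / 2 : ℝ) • (z : ℂ) := by simp [pos]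
    have h2 : tim (0, z) = 0 := by simp [tim]
    rw [h1, h2, hV0, hvu]
  · change V (pos (1, z), tim (1, z)) = x₀
    have hz : ‖(z : ℂ)‖ ≤ 1 := mem_closedBall_zero_iff.1 z.2
    have h1 : ‖pos (1, z)‖ = |κ ‖(z : ℂ)‖| * ‖(z : ℂ)‖ := by simp [pos]
    by_cases h2 : ‖(z : ℂ)‖ ≤ 1 / 2
    · have : tim (1, z) = 1 := by
        simp only [tim, one_mul]
        exact projIcc_of_right_le _ (by linarith)
      rw [this, hV1]
    · have h2' : 0 < ‖(z : ℂ)‖ := by linarith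
      have h3 : ‖pos (1, z)‖ = min 3 (9 - 8 * ‖(z : ℂ)‖) := by
        have : 0 ≤ min 3 (9 - 8 * ‖(z : ℂ)‖) := le_min (by norm_num) (by linarith)
        rw [h1]
        simp only [κ]
        rw [max_eq_left (by linarith), abs_of_nonneg (by positivity), div_mul_cancel₀ _ h2'.ne']
      by_cases h4 : ‖(z : ℂ)‖ ≤ 3 / 4
      · refine hV3 _ _ ?_
        rw [h3, min_eq_left (by linarith)]
      · have : tim (1, z) = 0 := by
          simp only [tim, one_mul]
          exact projIcc_of_le_left _ (by linarith)
        rw [this, hV0]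
        refine hv _ ?_
        rw [h3]
        exact le_min (by norm_num) (by linarith)
  · change V (pos (t, Collar.disc.i z), tim (t, Collar.disc.i z)) = Λ (t, z)
    have hz : ‖((Collar.disc.i z : Disc) : ℂ)‖ = 1 := Circle.norm_coe z
    have h1 : pos (t, Collar.disc.i z) = ((1 + t) / 2 : ℝ) • (z : ℂ) := by
      simp only [pos, hz, κ]
      rw [min_eq_right (by norm_num), max_eq_left (by norm_num)]
      congr 1
      ring
    have h2 : tim (t, Collar.disc.i z) = 0 := by
      simp only [tim, hz]
      rw [projIcc_of_le_left zero_le_one (by norm_num)]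
      exact mul_zero _
    rw [h1, h2, hV0, hvΛ]

variable {G B S : Type} [Group G] [TopologicalSpace G] [DiscreteTopology G]
  [TopologicalSpace B] [DiscreteTopology B] [TopologicalSpace S] [DiscreteTopology S]

/-- If `π₂` vanishes, null-homotopies extend from the 1-skeleton to the covering of a standard
complex. -/
theorem StdCover.exists_nullHomotopy [Subsingleton (HomotopyGroup.Pi 2 X x₀)] {φ : B → G}
    {s : S → List (B × Bool)} {hs : ∀ k, wordVal φ (s k) = 1} (P : C(StdCover φ s hs, X))
    (K : (P.comp (ofRose φ s hs)).Homotopy (ContinuousMap.const _ x₀)) :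
    ∃ K' : P.Homotopy (ContinuousMap.const _ x₀), ∀ t x, K' (t, ofRose φ s hs x) = K (t, x) := by
  have hglue : ∀ d, P (discPt φ s hs (d.1, Collar.disc.i d.2)) =
      P (ofRose φ s hs (discAttach φ s hs d)) := fun d =>
    congrArg P (Adj.glue (c := Collar.disc.prod (G × S)) (f := discAttach φ s hs) d)
  have hΛ : ∀ x : G × S, ∃ H : (P.comp ((discPt φ s hs).comp ⟨fun z => (x, z), by fun_prop⟩)).Homotopy
      (ContinuousMap.const _ x₀), ∀ t z, H (t, Collar.disc.i z) = K (t, discAttach φ s hs (x, z)) := by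
    intro x
    let Λ : ((P.comp ((discPt φ s hs).comp ⟨fun z => (x, z), by fun_prop⟩)).comp
        Collar.disc.i).Homotopy (ContinuousMap.const _ x₀) :=
      { toFun := fun y => K (y.1, discAttach φ s hs (x, y.2))
        continuous_toFun := by fun_prop
        map_zero_left := fun z => (K.apply_zero _).trans (hglue (x, z)).symm
        map_one_left := fun z => K.apply_one _ }
    exact exists_fill_disc _ Λ
  choose H hH using hΛ
  obtain ⟨HM, hHM⟩ := exists_homotopy_prod (P := P.comp (discPt φ s hs))
    (Q := ContinuousMap.const _ x₀) (fun x => H x)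
  obtain ⟨K', hK', -⟩ := Adj.exists_homotopy (P := P) (Q := ContinuousMap.const _ x₀) K HM
    fun t d => (hHM t d.1 _).trans (hH d.1 t d.2)
  exact ⟨K', hK'⟩

end Fill

/-! ### Null-homotopies on strips -/

/-- Choose a value at one representative of every coset of `⟨c⟩` and spread it by powers of `E`.
Infinite order makes the exponent unique, so no consistency condition arises. -/
theorem exists_section_of_perm {G T : Type} [Group G] {c : G} (hc : orderOf c = 0)
    (E : Equiv.Perm T) (f : T → G) (hf : ∀ x, f (E x) = f x * c) (hs : Function.Surjective f) :
    ∃ k : G → T, (∀ g, f (k g) = g) ∧ ∀ g, k (g * c) = E (k g) := by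
  have hz : ∀ (n : ℤ) x, f ((E ^ n) x) = f x * c ^ n := by
    have h1 : ∀ x, f (E⁻¹ x) = f x * c⁻¹ := fun x => by
      rw [eq_mul_inv_iff_mul_eq, ← hf]
      exact congrArg f (E.apply_symm_apply x)
    intro n
    induction n using Int.induction_on with
    | zero => simp
    | succ n ih =>
      intro x
      rw [zpow_add_one, zpow_add_one, Equiv.Perm.mul_apply, ih, hf, mul_assoc]
      congr 1
      exact ((Commute.refl c).zpow_right n).eq
    | pred n ih =>
      intro x
      rw [zpow_sub_one, zpow_sub_one, Equiv.Perm.mul_apply, ih, h1, mul_assoc]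
      congr 1
      exact ((Commute.refl c).inv_left.zpow_right _).eq
  let rep : G → G := fun g => (QuotientGroup.mk g : G ⧸ Subgroup.zpowers c).out
  have hrep : ∀ g, ∃ n : ℤ, c ^ n = (rep g)⁻¹ * g := fun g =>
    Subgroup.mem_zpowers_iff.1 (QuotientGroup.eq.1
      (QuotientGroup.out_eq' (QuotientGroup.mk g : G ⧸ Subgroup.zpowers c)))
  choose n hn using hrep
  choose b hb using hs
  refine ⟨fun g => (E ^ n g) (b (rep g)), fun g => by rw [hz, hb, hn]; simp, fun g => ?_⟩
  have h1 : rep (g * c) = rep g := congrArg Quotient.out (QuotientGroup.eq.2 (by simp))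
  have h2 : n (g * c) = 1 + n g := by
    refine injective_zpow_iff_not_isOfFinOrder.2 (orderOf_eq_zero_iff.1 hc) ?_
    simp only []
    rw [hn, h1, ← mul_assoc, ← hn, add_comm, zpow_add_one]
  simp only [h1, h2, zpow_add, zpow_one, Equiv.Perm.mul_apply]

section Strip

variable {X : Type} [TopologicalSpace X] {x₀ : X}
variable {G : Type} [Group G] [TopologicalSpace G] [DiscreteTopology G]

/-- A map on a disjoint union of lines is null-homotopic if its values can be joined to the
base point. -/
theorem RoseCover.exists_nullHomotopy_line {c : G} (hc : orderOf c = 0)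
    (P : C(RoseCover (fun _ : Unit => c), X)) (hP : ∀ g, Joined x₀ (P (vertex _ g))) :
    Nonempty (P.Homotopy (ContinuousMap.const _ x₀)) := by
  let T : Type := Σ g, Path.Homotopic.Quotient x₀ (P (vertex _ g))
  let u : ∀ g, Path.Homotopic.Quotient (P (vertex _ g)) (P (vertex _ (g * c))) := fun g =>
    .mk ((edge (fun _ : Unit => c) g ()).map P.continuous)
  -- A section equivariant for appending edges is exactly a compatible choice of path classes at the
  -- vertices.
  let e : T → T := fun x => ⟨x.1 * c, x.2.trans (u x.1)⟩
  have he : Function.Bijective e := by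
    constructor
    · rintro ⟨g, t⟩ ⟨g', t'⟩ h
      obtain rfl : g = g' := mul_right_cancel (congrArg Sigma.fst h)
      have h2 : t.trans (u g) = t'.trans (u g) := eq_of_heq (Sigma.mk.inj h).2
      have h3 := congrArg (fun x => Path.Homotopic.Quotient.trans x (u g).symm) h2
      simp only [Path.Homotopic.Quotient.trans_assoc, Path.Homotopic.Quotient.trans_symm,
        Path.Homotopic.Quotient.trans_refl] at h3
      rw [h3]
    · rintro ⟨g, t⟩
      obtain ⟨g, rfl⟩ : ∃ g', g = g' * c := ⟨g * c⁻¹, by simp⟩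
      refine ⟨⟨g, t.trans (u g).symm⟩, ?_⟩
      simp [e, Path.Homotopic.Quotient.trans_assoc]
  obtain ⟨k, h1, h2⟩ := exists_section_of_perm hc (Equiv.ofBijective e he) Sigma.fst
    (fun _ => rfl) fun g => ⟨⟨g, .mk (hP g).somePath⟩, rfl⟩
  have h3 : ∀ g, ∃ t, k g = ⟨g, t⟩ := fun g => by
    rcases e : k g with ⟨g', t⟩
    obtain rfl : g' = g := by rw [← h1 g, e]
    exact ⟨t, rfl⟩
  choose τ hτ using h3
  obtain ⟨K, -⟩ := RoseCover.exists_nullHomotopy P τ fun g _ => by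
    have := h2 g
    rw [hτ, hτ] at this
    exact eq_of_heq (Sigma.mk.inj this).2
  exact ⟨K⟩

/-- A null-homotopy of the ends of a family of paths drags the paths to loops. -/
theorem exists_drag {Z : Type} [TopologicalSpace Z] (P : C(Z × I, X))
    (Λ₀ : (P.comp ⟨fun z => (z, 0), by fun_prop⟩).Homotopy (ContinuousMap.const Z x₀))
    (Λ₁ : (P.comp ⟨fun z => (z, 1), by fun_prop⟩).Homotopy (ContinuousMap.const Z x₀)) :
    ∃ F : C(I × (Z × I), X), (∀ x, F (0, x) = P x) ∧ (∀ t z, F (t, (z, 0)) = Λ₀ (t, z)) ∧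
      ∀ t z, F (t, (z, 1)) = Λ₁ (t, z) := by
  -- At time `t` the interval is stretched linearly onto `[-t, 1 + t]`; the overhang on either side
  -- reads the null-homotopy of that end.
  let v : I × (Z × I) → ℝ := fun x => x.2.2 + x.1 * (2 * x.2.2 - 1)
  let pr : ℝ → I := projIcc 0 1 zero_le_one
  have hpr : Continuous pr := continuous_projIcc
  have hv : Continuous v := by fun_prop
  let f : I × (Z × I) → X := fun x =>
    if v x ≤ 0 then Λ₀ (pr (-v x), x.2.1)
    else if v x ≤ 1 then P (x.2.1, pr (v x)) else Λ₁ (pr (v x - 1), x.2.1)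
  have pr0 : ∀ {y : ℝ}, y ≤ 0 → pr y = 0 := fun h => projIcc_of_le_left zero_le_one h
  have pr1 : ∀ {y : ℝ}, 1 ≤ y → pr y = 1 := fun h => projIcc_of_right_le zero_le_one h
  have hf : Continuous f := by
    refine Continuous.if_le (by fun_prop) (Continuous.if_le (by fun_prop) (by fun_prop) hv
      continuous_const fun x hx => ?_) hv continuous_const fun x hx => ?_
    · rw [hx, pr1 le_rfl, pr0 (by simp)]
      exact (Λ₁.apply_zero _).symm
    · rw [if_pos (by linarith), hx, pr0 (by simp), pr0 le_rfl]
      exact Λ₀.apply_zero _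
  have prt : ∀ t : I, pr t = t := projIcc_val zero_le_one
  refine ⟨⟨f, hf⟩, fun x => ?_, fun t z => ?_, fun t z => ?_⟩
  · change f (0, x) = P x
    have h0 : v (0, x) = x.2 := by simp [v]
    simp only [f, h0]
    rw [if_pos x.2.2.2, prt]
    split_ifs with h
    · have : x.2 = 0 := Subtype.ext (le_antisymm h x.2.2.1)
      rw [pr0 (by simp [this]), Λ₀.apply_zero]
      obtain ⟨z, u⟩ := x
      subst this
      rfl
    · rfl
  · change f (t, (z, 0)) = _
    have h0 : v (t, (z, 0)) = -t := by simp [v]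
    simp only [f, h0]
    rw [if_pos (by linarith [t.2.1]), neg_neg, prt]
  · change f (t, (z, 1)) = _
    have h0 : v (t, (z, 1)) = 1 + t := by simp [v]; ring
    simp only [f, h0]
    rw [if_neg (by linarith [t.2.1])]
    split_ifs with h
    · have : t = 0 := Subtype.ext (show (t : ℝ) = 0 from le_antisymm (by linarith) t.2.1)
      subst this
      rw [pr1 (by simp)]
      exact (Λ₁.apply_zero _).symm
    · rw [add_sub_cancel_left, prt]

/-- Null-homotopies on the ends of a family of strips extend to the strips, if they are compatible
at the vertices. -/
theorem exists_strip_nullHomotopy {c : G} (hc : orderOf c = 0)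
    (P : C(RoseCover (fun _ : Unit => c) × I, X))
    (Λ₀ : (P.comp ⟨fun z => (z, 0), by fun_prop⟩).Homotopy (ContinuousMap.const _ x₀))
    (Λ₁ : (P.comp ⟨fun z => (z, 1), by fun_prop⟩).Homotopy (ContinuousMap.const _ x₀))
    (a b : G → Based x₀)
    (hab : ∀ g, Follows (a g) (P.comp ⟨fun u => (RoseCover.vertex _ g, u), by fun_prop⟩) (b g))
    (h₀ : ∀ g, Follows (a g) (Λ₀.evalAt (RoseCover.vertex _ g)) ⟨x₀, .refl x₀⟩)
    (h₁ : ∀ g, Follows (b g) (Λ₁.evalAt (RoseCover.vertex _ g)) ⟨x₀, .refl x₀⟩) :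
    ∃ K : P.Homotopy (ContinuousMap.const _ x₀),
      (∀ t z, K (t, (z, 0)) = Λ₀.trans (.refl _) (t, z)) ∧
      ∀ t z, K (t, (z, 1)) = Λ₁.trans (.refl _) (t, z) := by
  obtain ⟨F, F0, FL, FR⟩ := exists_drag P Λ₀ Λ₁
  -- After dragging, the strips are a map `L` from the lines to the loop space at `x₀`.
  let Ω : Type := {γ : C(I, X) // γ 0 = x₀ ∧ γ 1 = x₀}
  let κ : Ω := ⟨.const I x₀, rfl, rfl⟩
  let val : C(Ω, C(I, X)) := ⟨Subtype.val, continuous_subtype_val⟩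
  let Fc : C(RoseCover (fun _ : Unit => c), C(I, X)) :=
    (F.comp ⟨fun x : RoseCover (fun _ : Unit => c) × I => (1, x), by fun_prop⟩).curry
  let L : C(RoseCover (fun _ : Unit => c), Ω) :=
    ⟨fun z => ⟨Fc z, (FL 1 z).trans (Λ₀.apply_one z), (FR 1 z).trans (Λ₁.apply_one z)⟩,
      Fc.continuous.subtype_mk _⟩
  -- By `hab`, `h₀` and `h₁` the dragged loop at a vertex fixes the trivial class, so it lies in the
  -- component of the constant loop.
  have hL : ∀ g, Joined κ (L (RoseCover.vertex _ g)) := by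
    intro g
    let γ : Path x₀ x₀ := ⟨Fc (RoseCover.vertex _ g), (L _).2.1, (L _).2.2⟩
    have hγ : γ.Homotopic (.refl x₀) := by
      refine Follows.homotopic_refl (c := ⟨x₀, .refl x₀⟩) ?_
      refine follows_square (F := F.comp ⟨fun x : I × I => (x.2, (RoseCover.vertex _ g, x.1)),
        by fun_prop⟩) (a := a g) (c := b g) ?_ ?_ ?_
      · convert h₀ g using 1
        ext t
        exact FL t _
      · convert hab g using 1
        ext t
        exact F0 _
      · convert h₁ g using 1
        ext t
        exact FR t _
    obtain ⟨h⟩ := hγ.symm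
    refine ⟨⟨⟨fun t => ⟨h.toHomotopy.curry t, h.source t, h.target t⟩,
      (h.toHomotopy.curry).continuous.subtype_mk _⟩, ?_, ?_⟩⟩
    · apply Subtype.ext
      ext t
      exact h.apply_zero t
    · apply Subtype.ext
      ext t
      exact h.apply_one t
  obtain ⟨M⟩ := RoseCover.exists_nullHomotopy_line hc L hL
  let Q : C(RoseCover (fun _ : Unit => c) × I, X) := ⟨fun x => F (1, x), by fun_prop⟩
  let F' : P.Homotopy Q := ⟨F, F0, fun x => rfl⟩
  let M' : Q.Homotopy (ContinuousMap.const _ x₀) :=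
    { toFun := fun x => val (M (x.1, x.2.1)) x.2.2
      continuous_toFun := by fun_prop
      map_zero_left := fun x => by
        rw [M.apply_zero]
        rfl
      map_one_left := fun x => by
        rw [M.apply_one]
        rfl }
  refine ⟨F'.trans M', fun t z => ?_, fun t z => ?_⟩
  · rw [ContinuousMap.Homotopy.trans_apply, ContinuousMap.Homotopy.trans_apply]
    split_ifs
    · exact FL _ z
    · exact (M _).2.1
  · rw [ContinuousMap.Homotopy.trans_apply, ContinuousMap.Homotopy.trans_apply]
    split_ifs
    · exact FR _ z
    · exact (M _).2.2

/-- Functions on the vertices that are constant along edges extend to locally constant functions. -/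
theorem StdCover.exists_locallyConstant {B S T : Type} [TopologicalSpace B] [DiscreteTopology B]
    [TopologicalSpace S] [DiscreteTopology S] [TopologicalSpace T] [DiscreteTopology T]
    {φ : B → G} {s : S → List (B × Bool)} {hs : ∀ k, wordVal φ (s k) = 1} (β : G → T)
    (hβ : ∀ g b, β (g * φ b) = β g) :
    ∃ q : C(StdCover φ s hs, T), ∀ g, q (ofRose φ s hs (RoseCover.vertex φ g)) = β g := by
  have hc : Continuous β := continuous_of_discreteTopology
  let q₀ : C(RoseCover φ, T) := Adj.descC ⟨β, hc⟩ ⟨fun x => β x.1.1, by fun_prop⟩ fun d => by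
    obtain ⟨⟨g, b⟩, _ | _⟩ := d
    exacts [rfl, (hβ g b).symm]
  refine ⟨Adj.descC q₀ ⟨fun x => β x.1.1, by fun_prop⟩ fun d => ?_, fun g => rfl⟩
  obtain ⟨⟨g, k⟩, z⟩ := d
  obtain ⟨t, rfl⟩ := surjective_circleParam z
  -- A map from the interval to a discrete space is constant, so the value spreads from one vertex
  -- over the whole boundary of the disc.
  have h : Continuous fun t => q₀ (RoseCover.liftLoop φ g (s k) t) := by fun_prop
  have h1 := PreconnectedSpace.constant inferInstance h (x := 0) (y := t)
  rw [discAttach_param, ← h1, Path.source]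
  rfl

end Strip

/-! ### Asphericity -/

section Aspherical

variable {A R B S : Type} (r : R → List (A × Bool)) (s : S → List (B × Bool)) (α : B)

/-- The map from the presented group to the fundamental group of the standard complex. -/
def StdComplex.ofGrp : Grp s →* Pi1 (StdComplex s) (StdComplex.vertex s) :=
  PresentedGroup.toGroup (f := fun b => Pi1.mk (StdComplex.edge s b)) (by
    rintro _ ⟨k, rfl⟩
    rw [← wordVal_eq]
    apply Pi1.cls_injective
    let γ : Path (StdComplex.vertex s) (StdComplex.vertex s) :=
      (Rose.loop (s k)).map (StdComplex.ofRose s).continuous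
    have h := cls_wordVal (StdComplex.ofRose s) (.refl (StdComplex.vertex s))
      (fun b => Pi1.mk (StdComplex.edge s b)) (StdComplex.edge s) (fun _ _ => rfl)
      (fun b => by simp) (s k) γ fun _ => rfl
    have h2 : γ.Homotopic (.refl _) :=
      homotopic_of_disc (StdComplex.disc s k) _ fun t => (Quot.sound (StdRel.attach k t)).symm
    rw [Path.Homotopic.Quotient.eq.2 h2] at h
    simpa using h)

@[simp] theorem StdComplex.ofGrp_of (b : B) :
    ofGrp s (PresentedGroup.of b) = Pi1.mk (StdComplex.edge s b) := PresentedGroup.toGroup.of _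

theorem quotient_map_trans {X Y : Type} [TopologicalSpace X] [TopologicalSpace Y] (f : C(X, Y))
    {a b c : X} (t : Path.Homotopic.Quotient a b) (u : Path.Homotopic.Quotient b c) :
    (t.trans u).map f = (t.map f).trans (u.map f) := by
  induction t using Path.Homotopic.Quotient.ind with | mk t =>
  induction u using Path.Homotopic.Quotient.ind with | mk u =>
  exact congrArg Path.Homotopic.Quotient.mk (Path.map_trans t u f.continuous)

theorem quotient_map_symm {X Y : Type} [TopologicalSpace X] [TopologicalSpace Y] (f : C(X, Y))
    {a b : X} (t : Path.Homotopic.Quotient a b) : t.symm.map f = (t.map f).symm := by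
  induction t using Path.Homotopic.Quotient.ind with | mk t =>
  rfl

theorem follows_refl_of_mk_eq {Y : Type} [TopologicalSpace Y] {y₀ y : Y}
    {t : Path.Homotopic.Quotient y₀ y} {γ : Path y y₀} (h : .mk γ = t.symm) :
    Follows ⟨y, t⟩ γ ⟨y₀, .refl y₀⟩ :=
  (follows_path_iff γ).2 ⟨t, rfl, by rw [h]; simp⟩

variable [TopologicalSpace A] [DiscreteTopology A] [TopologicalSpace B]
  [DiscreteTopology B] [TopologicalSpace S] [DiscreteTopology S]

theorem JCover.exists_nullHomotopy_rose :
    ∃ K : ((proj (JPres.holonomy r s α)).comp (ofRose _)).Homotopy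
        (ContinuousMap.const _ (JComplex.vertex r s α)),
      ∀ g, Follows ⟨JComplex.vertex r s α, (JGroup.equiv r s α g).cls⟩
        (K.evalAt (RoseCover.vertex _ g)) ⟨JComplex.vertex r s α, .refl _⟩ := by
  obtain ⟨K, hK⟩ := RoseCover.exists_nullHomotopy
    ((proj (JPres.holonomy r s α)).comp (ofRose _)) (x₀ := JComplex.vertex r s α)
    (fun g => (JGroup.equiv r s α g).cls) fun g a => by
      have h : (JGroup.equiv r s α (g * JPres.gen r s α a)).cls =
          (JGroup.equiv r s α g).cls.trans (.mk (JComplex.genLoop r s α a)) := by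
        rw [map_mul, JGroup.equiv_gen]
        rfl
      exact h
  exact ⟨K, fun g => follows_refl_of_mk_eq (y := JComplex.vertex r s α) (hK g)⟩

variable {r s α}

/-- Through `j` the map to `X` gets compatible path classes in `X` at the vertices, so it contracts
in `X` on the 1-skeleton and then on the discs. The remaining discrepancy with the classes in `𝒥(𝒫)`
is locally constant and is absorbed by a final move along a path. -/
theorem JCover.exists_nullHomotopy_copy
    [Subsingleton (HomotopyGroup.Pi 2 (StdComplex s) (StdComplex.vertex s))] (i : R)
    (j : JPres r s α → Grp s) (hj : ∀ g x, j (g * JPres.ofJ r s α i x) = j g * x) :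
    ∃ K : ((proj (JPres.holonomy r s α)).comp (ofCopy _ i)).Homotopy
        (ContinuousMap.const _ (JComplex.vertex r s α)),
      ∀ g, Follows ⟨JComplex.ofCopy r s α i (StdComplex.vertex s),
          (JGroup.equiv r s α g).cls.trans (.mk (JComplex.tail r s α i))⟩
        (K.evalAt (StdCover.ofRose _ _ _ (RoseCover.vertex _ g)))
        ⟨JComplex.vertex r s α, .refl _⟩ := by
  let H := JPres.holonomy r s α
  let τ : JPres r s α → Path.Homotopic.Quotient (StdComplex.vertex s) (StdComplex.vertex s) :=
    fun g => (StdComplex.ofGrp s (j g)).cls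
  have hτ : ∀ g b, τ (g * H.b i b) = (τ g).trans (.mk (StdComplex.edge s b)) := fun g b => by
    have h : H.b i b = JPres.ofJ r s α i (.of b) := (JPres.ofJ_of r s α i b).symm
    simp only [τ]
    rw [h, hj, map_mul, StdComplex.ofGrp_of]
    rfl
  obtain ⟨K₁, hK₁⟩ := RoseCover.exists_nullHomotopy
    ((StdCover.proj (H.b i) s (H.hs i)).comp (StdCover.ofRose _ _ _)) τ hτ
  obtain ⟨K₂, hK₂⟩ := StdCover.exists_nullHomotopy _ K₁
  let v := JComplex.ofCopy r s α i (StdComplex.vertex s)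
  let tail : Path.Homotopic.Quotient (JComplex.vertex r s α) v := .mk (JComplex.tail r s α i)
  -- Passing from `g` to `g * b_i` appends the edge `b` to both factors, so `β` does not change.
  let β : JPres r s α → Path.Homotopic.Quotient (JComplex.vertex r s α) v := fun g =>
    ((JGroup.equiv r s α g).cls.trans tail).trans ((τ g).map (JComplex.ofCopy r s α i)).symm
  have hβ : ∀ g b, β (g * H.b i b) = β g := by
    intro g b
    have h : (JGroup.equiv r s α (g * H.b i b)).cls = (JGroup.equiv r s α g).cls.trans
        (tail.trans ((Path.Homotopic.Quotient.map (.mk (StdComplex.edge s b))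
          (JComplex.ofCopy r s α i)).trans tail.symm)) := by
      rw [map_mul]
      exact congrArg (fun x : JGroup r s α => ((JGroup.equiv r s α g) * x).cls)
        (JGroup.equiv_copy r s α i b)
    simp only [β]
    rw [hτ, h, quotient_map_trans]
    simp
  let _ : TopologicalSpace (Path.Homotopic.Quotient (JComplex.vertex r s α) v) := ⊥
  have : DiscreteTopology (Path.Homotopic.Quotient (JComplex.vertex r s α) v) := ⟨rfl⟩
  obtain ⟨q, hq⟩ := StdCover.exists_locallyConstant (hs := H.hs i) β hβ
  choose p hp using fun t : Path.Homotopic.Quotient (JComplex.vertex r s α) v =>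
    Path.Homotopic.Quotient.mk_surjective t.symm
  let pc : C(Path.Homotopic.Quotient (JComplex.vertex r s α) v, C(I, JComplex r s α)) :=
    ⟨fun t => p t, continuous_of_discreteTopology⟩
  let K₃ : ((proj H).comp (ofCopy H i)).Homotopy (ContinuousMap.const _ v) :=
    { toFun := fun x => JComplex.ofCopy r s α i (K₂ x)
      continuous_toFun := by fun_prop
      map_zero_left := fun x => congrArg _ (K₂.apply_zero x)
      map_one_left := fun x => congrArg _ (K₂.apply_one x) }
  let K₄ : (ContinuousMap.const (StdCover (H.b i) s (H.hs i)) v).Homotopy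
      (ContinuousMap.const _ (JComplex.vertex r s α)) :=
    ofTracks (pc.comp q) (fun x => (p (q x)).source) fun x => (p (q x)).target
  refine ⟨K₃.trans K₄, fun g => follows_refl_of_mk_eq (y := v) ?_⟩
  let x := StdCover.ofRose _ _ (H.hs i) (RoseCover.vertex _ g)
  have h1 : (K₃.trans K₄).evalAt x = (K₃.evalAt x).trans (K₄.evalAt x) := by
    ext t
    rw [Path.trans_apply]
    exact ContinuousMap.Homotopy.trans_apply _ _ _
  have h2 : Path.Homotopic.Quotient.mk (K₄.evalAt x) = (β g).symm := by
    rw [← hp, ← hq g]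
    rfl
  have h3 : Path.Homotopic.Quotient.mk (K₃.evalAt x) =
      ((τ g).map (JComplex.ofCopy r s α i)).symm := by
    have h4 : K₃.evalAt x = (K₁.evalAt (RoseCover.vertex _ g)).map
        (JComplex.ofCopy r s α i).continuous := by
      ext t
      exact congrArg (JComplex.ofCopy r s α i) (hK₂ t _)
    exact (congrArg Path.Homotopic.Quotient.mk h4).trans
      ((congrArg (fun t => t.map (JComplex.ofCopy r s α i)) (hK₁ g)).trans (quotient_map_symm _ _))
  refine (congrArg Path.Homotopic.Quotient.mk h1).trans ?_
  rw [Path.Homotopic.Quotient.mk_trans, h2, h3]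
  simp only [β, quotient_trans_symm, quotient_symm_symm]
  exact quotient_symm_trans_cancel _ _

-- The null-homotopies over the rose and the copies undo the path classes at the vertices, and the
-- tail relates these classes across a strip; this is the compatibility that the strips require.
variable (r s α) in
theorem JCover.exists_nullHomotopy_proj
    [Subsingleton (HomotopyGroup.Pi 2 (StdComplex s) (StdComplex.vertex s))]
    (hα : orderOf (PresentedGroup.of α : Grp s) = 0) (hr : ∀ i, FreeGroup.mk (r i) ≠ 1) :
    Nonempty ((proj (JPres.holonomy r s α)).Homotopy
      (ContinuousMap.const _ (JComplex.vertex r s α))) := by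
  let H := JPres.holonomy r s α
  obtain ⟨Ka, hKa⟩ := exists_nullHomotopy_rose r s α
  choose j hj using fun i => JPres.exists_retraction r s α hα hr i
  choose Kc hKc using fun i => exists_nullHomotopy_copy i (j i) (hj i)
  obtain ⟨Kc', hKc'⟩ := exists_homotopy_sigma
    (P := ((proj H).comp (Adj.inl _ _)).comp (⟨Sum.inr, continuous_inr⟩ : C(_, JBase H)))
    (Q := ContinuousMap.const _ (JComplex.vertex r s α)) fun i => Kc i
  obtain ⟨KB, hKBa, hKBc⟩ := exists_homotopy_sum (P := (proj H).comp (Adj.inl _ _))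
    (Q := ContinuousMap.const _ (JComplex.vertex r s α)) Ka Kc'
  let inc : ∀ i, C(RoseCover (fun _ : Unit => H.b i α), JStrip H) := fun i =>
    ⟨fun z => (⟨i, z⟩ : JStrip H),
      @continuous_sigmaMk R (fun i => RoseCover fun _ : Unit => H.b i α) _ i⟩
  have hs : ∀ i, ∃ K : ((proj H).comp ((strip H).comp ((inc i).prodMap (.id I)))).Homotopy
      (ContinuousMap.const _ (JComplex.vertex r s α)),
      (∀ t z, K (t, (z, 0)) = KB.trans (.refl _) (t, jLower H (inc i z))) ∧
      ∀ t z, K (t, (z, 1)) = KB.trans (.refl _) (t, jUpper H (inc i z)) := by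
    intro i
    let P := (proj H).comp ((strip H).comp ((inc i).prodMap (.id I)))
    let Λ₀ : (P.comp ⟨fun z => (z, 0), by fun_prop⟩).Homotopy
        (ContinuousMap.const _ (JComplex.vertex r s α)) :=
      { toFun := fun x => KB (x.1, jLower H (inc i x.2))
        continuous_toFun := by fun_prop
        map_zero_left := fun z => (KB.apply_zero _).trans (congrArg (proj H) (strip_zero H _)).symm
        map_one_left := fun z => KB.apply_one _ }
    let Λ₁ : (P.comp ⟨fun z => (z, 1), by fun_prop⟩).Homotopy
        (ContinuousMap.const _ (JComplex.vertex r s α)) :=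
      { toFun := fun x => KB (x.1, jUpper H (inc i x.2))
        continuous_toFun := by fun_prop
        map_zero_left := fun z => (KB.apply_zero _).trans (congrArg (proj H) (strip_one H _)).symm
        map_one_left := fun z => KB.apply_one _ }
    obtain ⟨K, h0, h1⟩ := exists_strip_nullHomotopy (c := H.b i α)
      (JPres.orderOf_copy r s α hα hr i) P Λ₀ Λ₁
      (fun g => ⟨JComplex.vertex r s α, (JGroup.equiv r s α g).cls⟩)
      (fun g => ⟨JComplex.ofCopy r s α i (StdComplex.vertex s),
          (JGroup.equiv r s α g).cls.trans (.mk (JComplex.tail r s α i))⟩)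
      (fun g => (follows_path_iff (JComplex.tail r s α i)).2 ⟨_, rfl, rfl⟩)
      (fun g => by
        convert hKa g using 1
        ext t
        exact hKBa _ _)
      (fun g => by
        convert hKc i g using 1
        ext t
        exact (hKBc _ _).trans (hKc' _ _ _))
    refine ⟨K, fun t z => (h0 t z).trans ?_, fun t z => (h1 t z).trans ?_⟩
    · exact (Λ₀.trans_apply _ _).trans (KB.trans_apply (.refl _) (t, jLower H (inc i z))).symm
    · exact (Λ₁.trans_apply _ _).trans (KB.trans_apply (.refl _) (t, jUpper H (inc i z))).symm
  choose K hK₀ hK₁ using hs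
  let HM : ((proj H).comp (Adj.inr _ _)).Homotopy
      (ContinuousMap.const _ (JComplex.vertex r s α)) :=
    ofTracks ⟨fun x : JStrip H × I => tracks (K x.1.1) (x.1.2, x.2), by
        rw [← Homeomorph.sigmaProdDistrib.symm.comp_continuous_iff']
        exact continuous_sigma fun i => (tracks (K i)).continuous⟩
      (fun x => (K x.1.1).apply_zero (x.1.2, x.2)) fun x => (K x.1.1).apply_one (x.1.2, x.2)
  -- `KB` waits in its second half, while the interiors of the strips are still being contracted.
  obtain ⟨L, -⟩ := Adj.exists_homotopy (P := proj H)
    (Q := ContinuousMap.const _ (JComplex.vertex r s α)) (KB.trans (.refl _)) HM (by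
      rintro t ⟨⟨i, z⟩, _ | _⟩
      exacts [hK₀ i t z, hK₁ i t z])
  exact ⟨L⟩

/-- Only `π₂` of `X` at its vertex enters. The tracks of the null-homotopy also join every point to
the base vertex. -/
theorem isAspherical_jComplex (hα : orderOf (PresentedGroup.of α : Grp s) = 0)
    (hr : ∀ i, FreeGroup.mk (r i) ≠ 1) (hs : IsAspherical (StdComplex s)) :
    IsAspherical (JComplex r s α) := by
  have := hs.2 2 le_rfl (StdComplex.vertex s)
  let H := JPres.holonomy r s α
  obtain ⟨K⟩ := JCover.exists_nullHomotopy_proj r s α hα hr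
  have hq := JCover.isQuotientCoveringMap_proj H
  have hj : ∀ y, Joined y (JComplex.vertex r s α) := fun y => by
    obtain ⟨x, rfl⟩ := hq.surjective y
    exact ⟨K.evalAt x⟩
  exact ⟨⟨⟨JComplex.vertex r s α⟩, fun y y' => (hj y).trans (hj y').symm⟩,
    fun k hk y => subsingleton_pi_of_cover hq.isCoveringMap hq.surjective K hk y⟩

end Aspherical

end JConstruction

end

/-! ### The main theorem -/

theorem propositionp (n m p q : ℕ)
    (r : Fin m → List (Fin n × Bool)) (s : Fin q → List (Fin p × Bool)) (α : Fin p)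
    (hα : orderOf (PresentedGroup.of α : JConstruction.Grp s) = 0) :
    (Group.IsPerfect (JConstruction.Grp s) →
      Nonempty (JConstruction.H1Z (JConstruction.JGroup r s α) ≅
        JConstruction.H1Z (JConstruction.Grp r))) ∧
    ((∀ i, FreeGroup.mk (r i) ≠ 1) →
      JConstruction.IsAspherical (JConstruction.StdComplex s) →
        JConstruction.IsAspherical (JConstruction.JComplex r s α)) ∧
    (∃ κ : JConstruction.JGroup r s α →* JConstruction.Grp r,
      JConstruction.IsCanonicalMap r s α κ ∧
      (∀ κ', JConstruction.IsCanonicalMap r s α κ' → κ' = κ) ∧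
      (Subsingleton (JConstruction.ProfCompletion (JConstruction.Grp s)) →
        IsIso (JConstruction.ProfCompletion.map κ))) := by
  exact ⟨JConstruction.nonempty_h1_iso_jGroup r s α,
    JConstruction.isAspherical_jComplex hα,
    JConstruction.canonicalMap r s α, JConstruction.isCanonicalMap_canonicalMap r s α,
    fun κ' h => h.eq r s α (JConstruction.isCanonicalMap_canonicalMap r s α),
    JConstruction.isIso_profCompletion_canonicalMap r s α⟩
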